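/- Let $\theta\in(0,1)$ and $k>1$. There is $\delta_0>0$, depending only on $\theta$ and $k$, such that the following holds for every $\delta\in(0,\delta_0)$ and every real-valued $a\in C^2([0,\infty)\times\mathbf R)$ with $$|\partial_t^\alpha\partial_x^\beta a(t,x)|\le \frac{\delta}{(1+t)^{k+\alpha}}\qquad(\alpha,\beta\in\{0,1\},\ t\ge 0,\ x\in\mathbf R).$$ (i) There is a function $h\in C^2([0,\infty)\times\mathbf R)$ with $$h_{tt}-h_{xx}-a\,h_t-a_t(1+h)=0,\qquad |h(t,x)|\le\frac{\theta}{(1+t)^{k-1}},\qquad |h_t(t,x)|+|h_x(t,x)|\le\frac{C}{(1+t)^k}\tag{1}$$ on $[0,\infty)\times\mathbf R$ for some constant $C>0$. (ii) Let $h$ be any function as in (1) and put $g=1+h$. Let $1<p<\infty$, and let $(u_0,u_1)\in H^1(\mathbf R)\times L^2(\mathbf R)$ satisfy $$\liminf_{R\to\infty}\int_{-R}^{R}\Big(\big(-g_t(0,x)+g(0,x)a(0,x)\big)u_0(x)+g(0,x)u_1(x)\Big)\,dx>0 ,$$ where the lower limit is taken in $[-\infty,\infty]$. Then the local solution of $$u_{tt}-u_{xx}+a(t,x)u_t=|u|^p\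 \text{ on }(0,\infty)\times\mathbf R,\qquad (u,u_t)(0,\cdot)=(u_0,u_1)$$ blows up in finite time: there are $T^*\in(0,\infty)$ and a solution $u$ on $[0,T^*)$ such that $$\lim_{t\to T^*-0}\|(u,u_t)(t)\|_{H^1\times L^2}=+\infty ,$$ and every solution $v$ on an interval $[0,S)$ with $S\in(0,\infty]$ satisfies $S\le T^*$ and $v=u$ on $[0,S)$. In particular there is no global solution, whatever the power $p$. Here, for $T\in(0,\infty]$, a solution on $[0,T)$ is a function $u\in C([0,T);H^1(\mathbf R))\cap C^1([0,T);L^2(\mathbf R))$ such that $$\int_{[0,T)\times\mathbf R}u\,\big(\partial_t^2\psi-\partial_x^2\psi-\partial_t(a\psi)\big)\,dx\,dt=\int_{\mathbf R}\big\{(a(0,x)u_0+u_1)\psi(0,x)-u_0\,\partial_t\psi(0,x)\big\}\,dx+\int_{[0,T)\times\mathbf R}|u|^p\psi\,dx\,dt$$ for every $\psi\in C_0^2([0,T)\times\mathbf R)$ (compact support in $[0,T)\times\mathbf R$; $\psi$ need not vanish at $t=0$). Derivatives in $t$ at $t=0$ are one-sided. -/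

import Mathlib

open MeasureTheory Filter Set
open scoped Topology ContDiff

noncomputable section

namespace DampedWave

/-- The real Hilbert space `L²(ℝ)`. -/
abbrev L2 : Type := Lp ℝ 2 (volume : Measure ℝ)

/-- `f'` is the weak derivative of `f`: `∫ f φ' = - ∫ f' φ` for every `φ ∈ C_c^∞(ℝ)`. -/
def IsWeakDeriv (f f' : L2) : Prop :=
  ∀ φ : ℝ → ℝ, ContDiff ℝ ∞ φ → HasCompactSupport φ →
    ∫ x, f x * deriv φ x = - ∫ x, f' x * φ x

/-- An `L²` function times a continuous compactly supported function is integrable. -/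
theorem integrable_mul_of_compactSupport (f : L2) {φ : ℝ → ℝ} (hφ : Continuous φ)
    (hc : HasCompactSupport φ) : Integrable (fun x => f x * φ x) := by
  have h2 : MemLp φ 2 (volume : Measure ℝ) := hφ.memLp_of_hasCompactSupport hc
  exact MemLp.integrable_mul (Lp.memLp f) h2

theorem integral_add_mul (f g : L2) {φ : ℝ → ℝ} (hφ : Continuous φ) (hc : HasCompactSupport φ) :
    ∫ x, (f + g : L2) x * φ x = (∫ x, f x * φ x) + ∫ x, g x * φ x := by
  rw [← integral_add (integrable_mul_of_compactSupport f hφ hc)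
    (integrable_mul_of_compactSupport g hφ hc)]
  refine integral_congr_ae ?_
  filter_upwards [Lp.coeFn_add f g] with x hx
  rw [hx, Pi.add_apply, add_mul]

theorem integral_smul_mul (c : ℝ) (f : L2) (φ : ℝ → ℝ) :
    ∫ x, (c • f : L2) x * φ x = c * ∫ x, f x * φ x := by
  rw [← integral_const_mul]
  refine integral_congr_ae ?_
  filter_upwards [Lp.coeFn_smul c f] with x hx
  rw [hx, Pi.smul_apply, smul_eq_mul, mul_assoc]

theorem integral_zero_mul (φ : ℝ → ℝ) : ∫ x, (0 : L2) x * φ x = 0 := by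
  simp

/-- The Sobolev space `H¹(ℝ)`, as the space of pairs `(f, f')` of `L²` functions such that `f'` is
the weak derivative of `f`. The inherited norm satisfies `‖f‖² = ‖f‖²_{L²} + ‖f'‖²_{L²}`. -/
def H1 : Submodule ℝ (WithLp 2 (L2 × L2)) where
  carrier := {w | IsWeakDeriv w.fst w.snd}
  zero_mem' := by
    intro φ _ _
    simp only [WithLp.zero_fst, WithLp.zero_snd, integral_zero_mul, neg_zero]
  add_mem' := by
    intro v w hv hw φ hφ hc
    have h1 := hv φ hφ hc
    have h2 := hw φ hφ hc
    have hd : Continuous (deriv φ) := hφ.continuous_deriv (by simp)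
    simp only [WithLp.add_fst, WithLp.add_snd]
    rw [integral_add_mul _ _ hd hc.deriv, integral_add_mul _ _ hφ.continuous hc, h1, h2]
    ring
  smul_mem' := by
    intro c w hw φ hφ hc
    have h1 := hw φ hφ hc
    simp only [WithLp.smul_fst, WithLp.smul_snd, integral_smul_mul]
    rw [h1]
    ring

/-- The inclusion `H¹(ℝ) → L²(ℝ)`. -/
def toL2 (w : H1) : L2 := w.1.fst

/-- `∂_t f (t, x)` for a function on `[0, ∞) × ℝ`; one-sided at `t = 0`. -/
def dt (f : ℝ → ℝ → ℝ) (t x : ℝ) : ℝ := derivWithin (fun s => f s x) (Ici 0) t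

/-- `∂_x f (t, x)`. -/
def dx (f : ℝ → ℝ → ℝ) (t x : ℝ) : ℝ := deriv (fun y => f t y) x

/-- `f ∈ C²([0, ∞) × ℝ)`. -/
def IsC2 (f : ℝ → ℝ → ℝ) : Prop :=
  ContDiffOn ℝ 2 (fun z : ℝ × ℝ => f z.1 z.2) (Ici 0 ×ˢ univ)

/-- The damping coefficients: `a ∈ C²([0, ∞) × ℝ)` with
`|∂_t^α ∂_x^β a(t, x)| ≤ δ / (1 + t)^(k + α)` for `α, β ∈ {0, 1}`. -/
structure IsDamping (k δ : ℝ) (a : ℝ → ℝ → ℝ) : Prop where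
  contDiff : IsC2 a
  bound : ∀ t, 0 ≤ t → ∀ x, |a t x| ≤ δ / (1 + t) ^ k
  bound_dx : ∀ t, 0 ≤ t → ∀ x, |dx a t x| ≤ δ / (1 + t) ^ k
  bound_dt : ∀ t, 0 ≤ t → ∀ x, |dt a t x| ≤ δ / (1 + t) ^ (k + 1)
  bound_dt_dx : ∀ t, 0 ≤ t → ∀ x, |dt (dx a) t x| ≤ δ / (1 + t) ^ (k + 1)

/-- `h ∈ C²([0, ∞) × ℝ)` is a classical solution of `h_tt - h_xx - a h_t - a_t (1 + h) = 0` with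
`|h| ≤ θ / (1 + t)^(k - 1)` and `|h_t|, |h_x| ≤ C / (1 + t)^k` for some constant `C`. -/
structure IsCorrector (a : ℝ → ℝ → ℝ) (θ k : ℝ) (h : ℝ → ℝ → ℝ) : Prop where
  contDiff : IsC2 h
  equation : ∀ t, 0 ≤ t → ∀ x,
    dt (dt h) t x - dx (dx h) t x - a t x * dt h t x - dt a t x * (1 + h t x) = 0
  bound : ∀ t, 0 ≤ t → ∀ x, |h t x| ≤ θ / (1 + t) ^ (k - 1)
  bound_deriv : ∃ C > 0, ∀ t, 0 ≤ t → ∀ x,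
    |dt h t x| ≤ C / (1 + t) ^ k ∧ |dx h t x| ≤ C / (1 + t) ^ k

/-- The positivity condition on the data, for the weight `g`:
`liminf_{R → ∞} ∫_{-R}^R ((-g_t(0,x) + g(0,x) a(0,x)) u₀(x) + g(0,x) u₁(x)) dx > 0`.
The lower limit is taken in `[-∞, ∞]`. -/
def PositiveData (a g : ℝ → ℝ → ℝ) (u₀ : H1) (u₁ : L2) : Prop :=
  (0 : EReal) < liminf (fun R : ℝ => ((∫ x in (-R)..R,
    ((-dt g 0 x + g 0 x * a 0 x) * toL2 u₀ x + g 0 x * u₁ x) : ℝ) : EReal)) atTop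

/-- The time interval `[0, T)`, where `T` may be `∞`. -/
def timeInterval (T : EReal) : Set ℝ := {t | 0 ≤ t ∧ (t : EReal) < T}

/-- `ψ ∈ C_0²([0, T) × ℝ)`: `ψ` is `C²` and vanishes outside a compact subset of `[0, T) × ℝ`
(it need not vanish at `t = 0`). -/
def IsTestFunction (T : EReal) (ψ : ℝ → ℝ → ℝ) : Prop :=
  ContDiffOn ℝ 2 (fun z : ℝ × ℝ => ψ z.1 z.2) (timeInterval T ×ˢ univ) ∧
  ∃ K : Set (ℝ × ℝ), IsCompact K ∧ K ⊆ timeInterval T ×ˢ univ ∧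
    ∀ t ∈ timeInterval T, ∀ x, (t, x) ∉ K → ψ t x = 0

/-- The `L²`-valued time derivative `u_t`; one-sided at `t = 0`. -/
def velocity (u : ℝ → H1) (t : ℝ) : L2 := derivWithin (fun s => toL2 (u s)) (Ici 0) t

/-- `‖(u, u_t)(t)‖_{H¹ × L²}`. -/
def energyNorm (u : ℝ → H1) (t : ℝ) : ℝ := Real.sqrt (‖u t‖ ^ 2 + ‖velocity u t‖ ^ 2)

/-- `u` is a solution on `[0, T)` of `u_tt - u_xx + a u_t = |u|^p` with data `(u₀, u₁)`:
`u ∈ C([0, T); H¹) ∩ C¹([0, T); L²)` and the equation holds in the weak sense. Only the values of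
`u` on `[0, T)` matter. The space-time integrals are written as iterated integrals, whose values do
not depend on the representatives of the `L²` functions `u t`. -/
structure IsSolution (a : ℝ → ℝ → ℝ) (p : ℝ) (u₀ : H1) (u₁ : L2) (T : EReal) (u : ℝ → H1) :
    Prop where
  continuousOn : ContinuousOn u (timeInterval T)
  contDiffOn : ContDiffOn ℝ 1 (fun t => toL2 (u t)) (timeInterval T)
  weak : ∀ ψ : ℝ → ℝ → ℝ, IsTestFunction T ψ →
    ∫ t in timeInterval T, ∫ x, toL2 (u t) x *
        (dt (dt ψ) t x - dx (dx ψ) t x - dt (fun s y => a s y * ψ s y) t x) =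
      (∫ x, ((a 0 x * toL2 u₀ x + u₁ x) * ψ 0 x - toL2 u₀ x * dt ψ 0 x)) +
        ∫ t in timeInterval T, ∫ x, |toL2 (u t) x| ^ p * ψ t x

end DampedWave

end

/-! Blow-up is a test function argument. The weight `g = 1 + h` solves the adjoint equation `g_tt -
g_xx - a g_t - a_t g = 0`. Test the equation of `u` with `g Φ`, where `Φ(t, x) = ρ(t/R) ρ(x/R)`:
every term in which no derivative falls on `Φ` cancels. Second derivatives of `Φ` are of size `R⁻²`;
each first derivative, of size `R⁻¹`, carries a factor `g_t`, `g_x` or `a`, hence `(1+t)^(-k)`. So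
the operator is bounded by a constant times `Φ^(1/p) b(t)` with `b(t) = R⁻² + R⁻¹ (1+t)^(-k)`
(`IsWeight.abs_waveOperator_le`). Young's inequality absorbs this into half of `∫∫ |u|^p g Φ` and
leaves a multiple of `R ∫ b^q`, where `q` is conjugate to `p`. Because `k > 1`, `R ∫ b` stays
bounded, while `b ≤ 2/R`; the remainder is `O(R^(1-q))` for every `p > 1`
(`IsWeight.exists_initial_le`). The data term, an average of the truncated integrals in the
positivity hypothesis (`IsCutoff.le_integral_mul`), is bounded below by a positive constant for
large `R`. A solution therefore cannot exist up to time `3R` (`IsWeight.exists_lifespan_bound`).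

To turn the bounded life span into norm blow-up and uniqueness, the equation is made an ordinary
differential equation. In the coordinates `u`, `S(-t)(u_t + u_x)`, `S(t)(u_t - u_x)`, with `S` the
translation group on `L²`, no unbounded operator remains. Once the power is truncated, the vector
field is globally Lipschitz, and the embedding of `H¹` in `L^∞` (`ae_abs_le`) makes the truncation
invisible on bounded sets. The flow preserves the constraint linking `u` and `u_x`
(`IsFlow.isWeakDeriv`). Its trajectories are weak solutions (`IsMild.integral_identity`,
`isSolution_of_isMild`), and conversely each weak solution is a trajectory
(`IsSolution.exists_isMild`), by testing with functions of time multiplied by travelling waves. The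
usual continuation argument is `exists_maximal_solution`.

For the existence of `h`, one solves `h_tt - h_xx = F` with zero data at `t = ∞` by integrating
along characteristics, and seeks `F = a h_t + a_t (1 + h)` as a fixed point among functions of order
`(1+t)^(-(k+1))`. The map is a contraction when `δ` is small against `k - 1`. Iterating it together
with its `x`-derivative gives the regularity needed for `h` to be `C²` (`exists_fixedPoint`,
`IsDamping.exists_isCorrector`). -/

open MeasureTheory Filter Set
open scoped Topology ContDiff
noncomputable section
namespace DampedWave
open scoped NNReal InnerProductSpace

/-! ### Square integrable classes and their pairing with test functions -/

/-- The class in `L²(ℝ)` of a square integrable function (zero for other functions). -/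
def lp (φ : ℝ → ℝ) : L2 :=
  open Classical in if h : MemLp φ 2 (volume : Measure ℝ) then h.toLp φ else 0

theorem lp_ae {φ : ℝ → ℝ} (h : MemLp φ 2 (volume : Measure ℝ)) : lp φ =ᵐ[volume] φ := by
  rw [lp, dif_pos h]
  exact h.coeFn_toLp

theorem lp_eq_of_ae {φ : ℝ → ℝ} {f : L2} (h : φ =ᵐ[volume] f) : lp φ = f := by
  have hm : MemLp φ 2 (volume : Measure ℝ) := (memLp_congr_ae h).2 (Lp.memLp f)
  exact Lp.ext ((lp_ae hm).trans h)

/-- The pairing `∫ f φ`. -/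
def pair (f : L2) (φ : ℝ → ℝ) : ℝ := ∫ x, f x * φ x

theorem pair_eq_inner (f : L2) {φ : ℝ → ℝ} (h : MemLp φ 2 (volume : Measure ℝ)) :
    pair f φ = ⟪f, lp φ⟫_ℝ := by
  rw [pair, L2.inner_def]
  refine integral_congr_ae ?_
  filter_upwards [lp_ae h] with x hx
  simp [hx, mul_comm]

theorem pair_add (f g : L2) {φ : ℝ → ℝ} (h : MemLp φ 2 (volume : Measure ℝ)) :
    pair (f + g) φ = pair f φ + pair g φ := by
  simp [pair_eq_inner _ h, inner_add_left]

theorem pair_sub (f g : L2) {φ : ℝ → ℝ} (h : MemLp φ 2 (volume : Measure ℝ)) :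
    pair (f - g) φ = pair f φ - pair g φ := by
  simp [pair_eq_inner _ h, inner_sub_left]

theorem pair_smul (c : ℝ) (f : L2) (φ : ℝ → ℝ) : pair (c • f) φ = c * pair f φ :=
  integral_smul_mul c f φ

theorem memLp_two_of_compactSupport {φ : ℝ → ℝ} (h : Continuous φ) (hc : HasCompactSupport φ) :
    MemLp φ 2 (volume : Measure ℝ) := h.memLp_of_hasCompactSupport hc

theorem eq_zero_of_pair (f : L2)
    (h : ∀ φ : ℝ → ℝ, ContDiff ℝ ∞ φ → HasCompactSupport φ → pair f φ = 0) : f = 0 := by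
  rw [Lp.eq_zero_iff_ae_eq_zero]
  refine ae_eq_zero_of_integral_contDiff_smul_eq_zero
    ((Lp.memLp f).locallyIntegrable (by norm_num)) fun φ h1 h2 => ?_
  rw [← h φ h1 h2, pair]
  exact integral_congr_ae (Eventually.of_forall fun x => by simp [mul_comm])

theorem eq_of_pair {f g : L2}
    (h : ∀ φ : ℝ → ℝ, ContDiff ℝ ∞ φ → HasCompactSupport φ → pair f φ = pair g φ) : f = g := by
  rw [← sub_eq_zero]
  refine eq_zero_of_pair _ fun φ h1 h2 => ?_
  rw [pair_sub _ _ (memLp_two_of_compactSupport h1.continuous h2), h φ h1 h2, sub_self]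

/-! ### Translations -/

theorem measurePreserving_translate (τ : ℝ) :
    MeasurePreserving (fun x : ℝ => x + τ) volume volume :=
  measurePreserving_add_right volume τ

/-- The translation `f ↦ f(· + τ)` on `L²(ℝ)`. -/
def shift (τ : ℝ) : L2 →ₗᵢ[ℝ] L2 :=
  Lp.compMeasurePreservingₗᵢ ℝ (fun x : ℝ => x + τ) (measurePreserving_translate τ)

theorem shift_ae (τ : ℝ) (f : L2) : shift τ f =ᵐ[volume] fun x => f (x + τ) :=
  Lp.coeFn_compMeasurePreserving f (measurePreserving_translate τ)

/-- Translations are continuous in the parameter only strongly, not in operator norm. Joint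
continuity is what makes `t ↦ S(t) f(t)` continuous for a continuous curve `f`. -/
theorem continuous_shift_uncurry : Continuous fun z : ℝ × L2 => shift z.1 z.2 := by
  have hg : Continuous fun z : ℝ × L2 =>
      ((⟨fun q : ℝ × ℝ => q.2 + q.1, by fun_prop⟩ : C(ℝ × ℝ, ℝ)).curry z.1) :=
    (ContinuousMap.continuous _).comp continuous_fst
  exact continuous_snd.compMeasurePreservingLp hg
    (fun z => measurePreserving_translate z.1) (by norm_num)

theorem ae_translate {P : ℝ → Prop} (h : ∀ᵐ x, P x) (τ : ℝ) : ∀ᵐ x, P (x + τ) :=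
  (measurePreserving_translate τ).quasiMeasurePreserving.ae h

theorem shift_shift (σ τ : ℝ) (f : L2) : shift σ (shift τ f) = shift (σ + τ) f := by
  refine Lp.ext ?_
  filter_upwards [shift_ae σ (shift τ f), ae_translate (shift_ae τ f) σ, shift_ae (σ + τ) f]
    with x h1 h2 h3
  rw [h1, h2, h3, add_assoc]

@[simp] theorem shift_zero (f : L2) : shift 0 f = f := by
  refine Lp.ext ?_
  filter_upwards [shift_ae 0 f] with x h1
  rw [h1, add_zero]

@[simp] theorem shift_neg_shift (τ : ℝ) (f : L2) : shift (-τ) (shift τ f) = f := by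
  simp [shift_shift]

@[simp] theorem shift_shift_neg (τ : ℝ) (f : L2) : shift τ (shift (-τ) f) = f := by
  simp [shift_shift]

theorem pair_shift (τ : ℝ) (f : L2) (φ : ℝ → ℝ) :
    pair (shift τ f) φ = pair f fun x => φ (x - τ) := by
  have h1 : pair (shift τ f) φ = ∫ x, (fun y => f y * φ (y - τ)) (x + τ) := by
    refine integral_congr_ae ?_
    filter_upwards [shift_ae τ f] with x hx
    simp [hx]
  rw [h1, integral_add_right_eq_self (fun y => f y * φ (y - τ)) τ, pair]

/-! ### Curves of test functions -/

theorem norm_lp_le_of_support {φ : ℝ → ℝ} {s : Set ℝ} (hms : MeasurableSet s)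
    (hfin : volume s ≠ ⊤) {ε : ℝ} (hε : 0 ≤ ε)
    (hs : ∀ x, x ∉ s → φ x = 0) (hb : ∀ x ∈ s, |φ x| ≤ ε) :
    ‖lp φ‖ ≤ ε * (volume.real s) ^ (1 / 2 : ℝ) := by
  by_cases hm : MemLp φ 2 (volume : Measure ℝ)
  · have h : ‖lp φ‖ ≤ ‖indicatorConstLp 2 hms (μ := (volume : Measure ℝ)) hfin ε‖ := by
      refine Lp.norm_le_norm_of_ae_le ?_
      filter_upwards [lp_ae hm, indicatorConstLp_coeFn (p := 2) (hs := hms) (hμs := hfin)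
        (c := ε)] with x h1 h2
      rw [h1, h2]
      by_cases hx : x ∈ s
      · rw [indicator_of_mem hx]
        exact (hb x hx).trans (le_abs_self _)
      · rw [hs x hx]; simp
    refine h.trans (le_of_eq ?_)
    rw [norm_indicatorConstLp (by norm_num) (by norm_num), Real.norm_of_nonneg hε]
    simp
  · rw [lp, dif_neg hm, norm_zero]
    positivity

theorem norm_lp_le {φ : ℝ → ℝ} {B ε : ℝ} (hε : 0 ≤ ε)
    (hs : ∀ x, x ∉ Icc (-B) B → φ x = 0) (hb : ∀ x ∈ Icc (-B) B, |φ x| ≤ ε) :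
    ‖lp φ‖ ≤ ε * (volume.real (Icc (-B) B)) ^ (1 / 2 : ℝ) :=
  norm_lp_le_of_support measurableSet_Icc (by simp) hε hs hb

theorem lp_add {φ ψ : ℝ → ℝ} (h : MemLp φ 2 (volume : Measure ℝ))
    (h' : MemLp ψ 2 (volume : Measure ℝ)) : lp (fun x => φ x + ψ x) = lp φ + lp ψ := by
  refine lp_eq_of_ae ?_
  filter_upwards [lp_ae h, lp_ae h', Lp.coeFn_add (lp φ) (lp ψ)] with x h1 h2 h3
  rw [h3, Pi.add_apply, h1, h2]

theorem lp_sub {φ ψ : ℝ → ℝ} (h : MemLp φ 2 (volume : Measure ℝ))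
    (h' : MemLp ψ 2 (volume : Measure ℝ)) : lp (fun x => φ x - ψ x) = lp φ - lp ψ := by
  refine lp_eq_of_ae ?_
  filter_upwards [lp_ae h, lp_ae h', Lp.coeFn_sub (lp φ) (lp ψ)] with x h1 h2 h3
  rw [h3, Pi.sub_apply, h1, h2]

theorem lp_smul {φ : ℝ → ℝ} (h : MemLp φ 2 (volume : Measure ℝ)) (c : ℝ) :
    lp (fun x => c * φ x) = c • lp φ := by
  refine lp_eq_of_ae ?_
  filter_upwards [lp_ae h, Lp.coeFn_smul c (lp φ)] with x h1 h3
  rw [h3, Pi.smul_apply, h1, smul_eq_mul]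

theorem pair_add_right (f : L2) {φ ψ : ℝ → ℝ} (h : MemLp φ 2 (volume : Measure ℝ))
    (h' : MemLp ψ 2 (volume : Measure ℝ)) :
    pair f (fun x => φ x + ψ x) = pair f φ + pair f ψ := by
  rw [pair_eq_inner f h, pair_eq_inner f h', ← inner_add_right, ← lp_add h h']
  exact pair_eq_inner f (h.add h')

theorem pair_sub_right (f : L2) {φ ψ : ℝ → ℝ} (h : MemLp φ 2 (volume : Measure ℝ))
    (h' : MemLp ψ 2 (volume : Measure ℝ)) :
    pair f (fun x => φ x - ψ x) = pair f φ - pair f ψ := by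
  rw [pair_eq_inner f h, pair_eq_inner f h', ← inner_sub_right, ← lp_sub h h']
  exact pair_eq_inner f (h.sub h')

theorem pair_const_mul (f : L2) (φ : ℝ → ℝ) (c : ℝ) :
    pair f (fun x => c * φ x) = c * pair f φ := by
  rw [pair, pair, ← integral_const_mul]
  exact integral_congr_ae (Eventually.of_forall fun x => by ring)

/-- `Ψ` is a curve, over the time set `s`, of continuous functions with support in a fixed compact
interval. -/
structure IsTestCurve (s : Set ℝ) (Ψ : ℝ → ℝ → ℝ) : Prop where
  continuousOn : ContinuousOn (fun z : ℝ × ℝ => Ψ z.1 z.2) (s ×ˢ univ)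
  support : ∃ B, ∀ t ∈ s, ∀ x, x ∉ Icc (-B) B → Ψ t x = 0

namespace IsTestCurve

variable {s : Set ℝ} {Ψ Ψ' : ℝ → ℝ → ℝ}

theorem continuous (h : IsTestCurve s Ψ) {t : ℝ} (ht : t ∈ s) : Continuous (Ψ t) := by
  have : Continuous fun x : ℝ => (t, x) := by fun_prop
  exact h.continuousOn.comp_continuous this fun x => ⟨ht, mem_univ _⟩

theorem hasCompactSupport (h : IsTestCurve s Ψ) {t : ℝ} (ht : t ∈ s) :
    HasCompactSupport (Ψ t) := by
  obtain ⟨B, hB⟩ := h.support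
  exact HasCompactSupport.intro isCompact_Icc fun x hx => hB t ht x hx

theorem memLp (h : IsTestCurve s Ψ) {t : ℝ} (ht : t ∈ s) : MemLp (Ψ t) 2 (volume : Measure ℝ) :=
  memLp_two_of_compactSupport (h.continuous ht) (h.hasCompactSupport ht)

theorem mono (h : IsTestCurve s Ψ) {r : Set ℝ} (hr : r ⊆ s) : IsTestCurve r Ψ :=
  ⟨h.continuousOn.mono (prod_mono hr subset_rfl),
    h.support.imp fun _ hB t ht => hB t (hr ht)⟩

/-- The common compact support turns joint continuity into continuity uniform in `x`. -/
theorem eventually_close (h : IsTestCurve s Ψ) {t : ℝ} (ht : t ∈ s) {ε : ℝ} (hε : 0 < ε) :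
    ∀ᶠ r in 𝓝[s] t, ∀ x, |Ψ r x - Ψ t x| ≤ ε := by
  obtain ⟨B, hB⟩ := h.support
  obtain ⟨v, hv, hv'⟩ := IsCompact.mem_uniformity_of_prod (f := Ψ) (isCompact_Icc (a := -B) (b := B))
    (h.continuousOn.mono (prod_mono subset_rfl (subset_univ _))) ht (Metric.dist_mem_uniformity hε)
  filter_upwards [hv, self_mem_nhdsWithin] with r hr hrs x
  by_cases hx : x ∈ Icc (-B) B
  · have := hv' r hr x hx
    simp only [Set.mem_ofPred_eq, Real.dist_eq] at this
    exact this.le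
  · rw [hB r hrs x hx, hB t ht x hx]; simpa using hε.le

theorem continuousOn_lp (h : IsTestCurve s Ψ) : ContinuousOn (fun t => lp (Ψ t)) s := by
  intro t ht
  obtain ⟨B, hB⟩ := h.support
  rw [ContinuousWithinAt, Metric.tendsto_nhds]
  intro ε hε
  set V := (volume.real (Icc (-B) B)) ^ (1 / 2 : ℝ)
  have hV : 0 ≤ V := by positivity
  have hδ : 0 < ε / (V + 1) := by positivity
  filter_upwards [h.eventually_close ht hδ, self_mem_nhdsWithin] with r hr hrs
  rw [dist_eq_norm, ← lp_sub (h.memLp hrs) (h.memLp ht)]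
  refine (norm_lp_le (B := B) hδ.le (fun x hx => ?_) fun x _ => hr x).trans_lt ?_
  · rw [hB r hrs x hx, hB t ht x hx, sub_zero]
  · calc ε / (V + 1) * V < ε / (V + 1) * (V + 1) := by gcongr; linarith
      _ = ε := by field_simp

/-- The mean value inequality for `q ↦ Ψ q x - q Ψ' t x` makes the pointwise Taylor remainder small
uniformly in `x`; on a fixed bounded interval a uniform bound is an `L²` bound. -/
theorem hasDerivAt_lp (h : IsTestCurve s Ψ) (h' : IsTestCurve s Ψ') {t : ℝ} (ht : s ∈ 𝓝 t)
    (hd : ∀ r ∈ s, s ∈ 𝓝 r → ∀ x, HasDerivAt (fun q => Ψ q x) (Ψ' r x) r) :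
    HasDerivAt (fun t => lp (Ψ t)) (lp (Ψ' t)) t := by
  have hts : t ∈ s := mem_of_mem_nhds ht
  obtain ⟨B, hB⟩ := h.support
  obtain ⟨B', hB'⟩ := h'.support
  rw [hasDerivAt_iff_isLittleO, Asymptotics.isLittleO_iff]
  intro c hc
  set C := max B B'
  set V := (volume.real (Icc (-C) C)) ^ (1 / 2 : ℝ)
  have hV : 0 ≤ V := by positivity
  have hδ : 0 < c / (V + 1) := by positivity
  have hsub : ∀ x, x ∉ Icc (-C) C → x ∉ Icc (-B) B ∧ x ∉ Icc (-B') B' := by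
    intro x hx
    refine ⟨fun h => hx ?_, fun h => hx ?_⟩
    · exact ⟨by linarith [h.1, le_max_left B B'], h.2.trans (le_max_left _ _)⟩
    · exact ⟨by linarith [h.1, le_max_right B B'], h.2.trans (le_max_right _ _)⟩
  have hev : ∀ᶠ r in 𝓝 t, r ∈ interior s ∧ ∀ x, |Ψ' r x - Ψ' t x| ≤ c / (V + 1) := by
    have h1 := h'.eventually_close hts hδ
    rw [nhdsWithin_eq_nhds.2 ht] at h1
    exact (interior_mem_nhds.2 ht |> fun h => Filter.eventually_of_mem h fun _ h => h).and h1
  obtain ⟨η, hη, hball⟩ := Metric.eventually_nhds_iff_ball.1 hev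
  filter_upwards [Metric.ball_mem_nhds t hη] with r hr
  have hrs : r ∈ s := interior_subset (hball r hr).1
  have hconv := convex_ball t η
  have key : ∀ x, |Ψ r x - Ψ t x - (r - t) * Ψ' t x| ≤ c / (V + 1) * |r - t| := by
    intro x
    have := hconv.norm_image_sub_le_of_norm_hasDerivWithin_le
      (f := fun q => Ψ q x - q * Ψ' t x) (f' := fun q => Ψ' q x - 1 * Ψ' t x) (C := c / (V + 1))
      (fun q hq => ((hd q (interior_subset (hball q hq).1)
        (mem_interior_iff_mem_nhds.1 (hball q hq).1) x).sub
        ((hasDerivAt_id q).mul_const _)).hasDerivWithinAt)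
      (fun q hq => by rw [one_mul]; exact (hball q hq).2 x) (Metric.mem_ball_self hη) hr
    simp only [Real.norm_eq_abs] at this
    convert this using 2
    ring
  have hm1 := lp_sub (h.memLp hrs) (h.memLp hts)
  have hm2 := lp_smul (h'.memLp hts) (r - t)
  have hm3 := lp_sub ((h.memLp hrs).sub (h.memLp hts)) ((h'.memLp hts).const_mul (r - t))
  simp only [Pi.sub_apply] at hm3
  rw [← hm2, ← hm1]
  erw [← hm3]
  refine (norm_lp_le (B := C) (ε := c / (V + 1) * |r - t|) (by positivity)
    (fun x hx => ?_) fun x _ => key x).trans ?_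
  · rw [hB r hrs x (hsub x hx).1, hB t hts x (hsub x hx).1, hB' t hts x (hsub x hx).2]
    simp
  · rw [Real.norm_eq_abs]
    calc c / (V + 1) * |r - t| * V ≤ c / (V + 1) * |r - t| * (V + 1) := by gcongr; linarith
      _ = c * |r - t| := by field_simp

theorem mul_left (h : IsTestCurve s Ψ) {b : ℝ → ℝ → ℝ}
    (hb : ContinuousOn (fun z : ℝ × ℝ => b z.1 z.2) (s ×ˢ univ)) :
    IsTestCurve s fun t x => b t x * Ψ t x :=
  ⟨hb.mul h.continuousOn, h.support.imp fun B hB t ht x hx => by rw [hB t ht x hx, mul_zero]⟩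

theorem add (h : IsTestCurve s Ψ) (h' : IsTestCurve s Ψ') :
    IsTestCurve s fun t x => Ψ t x + Ψ' t x := by
  obtain ⟨B, hB⟩ := h.support
  obtain ⟨B', hB'⟩ := h'.support
  refine ⟨h.continuousOn.add h'.continuousOn, max B B', fun t ht x hx => ?_⟩
  rw [hB t ht x, hB' t ht x, add_zero]
  · exact fun h => hx ⟨by linarith [h.1, le_max_right B B'], h.2.trans (le_max_right _ _)⟩
  · exact fun h => hx ⟨by linarith [h.1, le_max_left B B'], h.2.trans (le_max_left _ _)⟩

theorem pair_eq (h : IsTestCurve s Ψ) {t : ℝ} (ht : t ∈ s) (f : L2) :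
    pair f (Ψ t) = ⟪f, lp (Ψ t)⟫_ℝ := pair_eq_inner f (h.memLp ht)

theorem continuousOn_pair (h : IsTestCurve s Ψ) {f : ℝ → L2} (hf : ContinuousOn f s) :
    ContinuousOn (fun t => pair (f t) (Ψ t)) s :=
  (hf.inner h.continuousOn_lp).congr fun _ ht => h.pair_eq ht _

theorem hasDerivAt_pair (h : IsTestCurve s Ψ) (h' : IsTestCurve s Ψ') {t : ℝ} (ht : s ∈ 𝓝 t)
    (hd : ∀ r ∈ s, s ∈ 𝓝 r → ∀ x, HasDerivAt (fun q => Ψ q x) (Ψ' r x) r) {f : ℝ → L2} {f' : L2}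
    (hf : HasDerivAt f f' t) :
    HasDerivAt (fun t => pair (f t) (Ψ t)) (pair (f t) (Ψ' t) + pair f' (Ψ t)) t := by
  have hts := mem_of_mem_nhds ht
  rw [h.pair_eq hts, h'.pair_eq hts]
  refine (hf.inner ℝ (h.hasDerivAt_lp h' ht hd)).congr_of_eventuallyEq ?_
  filter_upwards [ht] with r hr
  exact h.pair_eq hr _

end IsTestCurve

theorem isTestCurve_const {φ : ℝ → ℝ} (h : Continuous φ) (hc : HasCompactSupport φ) (s : Set ℝ) :
    IsTestCurve s fun _ => φ := by
  refine ⟨(h.comp continuous_snd).continuousOn, ?_⟩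
  obtain ⟨r, hr⟩ := hc.isCompact.isBounded.subset_closedBall 0
  refine ⟨r, fun t _ x hx => ?_⟩
  by_contra hne
  have := hr (subset_tsupport _ hne)
  rw [Real.closedBall_eq_Icc] at this
  exact hx (by simpa using this)

/-! ### The Sobolev embedding `H¹(ℝ) → L^∞(ℝ)` -/

/-- The weak derivative of an element of `H¹(ℝ)`. -/
def weakDeriv (w : H1) : L2 := w.1.snd

theorem pair_weakDeriv (w : H1) {φ : ℝ → ℝ} (h : ContDiff ℝ ∞ φ) (hc : HasCompactSupport φ) :
    pair (toL2 w) (deriv φ) = -pair (weakDeriv w) φ := w.2 φ h hc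

theorem toL2_weakDeriv_injective {v w : H1} (h1 : toL2 v = toL2 w)
    (h2 : weakDeriv v = weakDeriv w) : v = w := by
  apply Subtype.ext
  apply (WithLp.equiv 2 (L2 × L2)).injective
  exact Prod.ext h1 h2

theorem norm_sq_H1 (w : H1) : ‖w‖ ^ 2 = ‖toL2 w‖ ^ 2 + ‖weakDeriv w‖ ^ 2 :=
  WithLp.prod_norm_sq_eq_of_L2 w.1

theorem norm_toL2_le (w : H1) : ‖toL2 w‖ ≤ ‖w‖ := by
  have := norm_sq_H1 w
  exact abs_le_of_sq_le_sq' (by nlinarith [sq_nonneg ‖weakDeriv w‖]) (norm_nonneg _) |>.2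

theorem norm_weakDeriv_le (w : H1) : ‖weakDeriv w‖ ≤ ‖w‖ := by
  have := norm_sq_H1 w
  exact abs_le_of_sq_le_sq' (by nlinarith [sq_nonneg ‖toL2 w‖]) (norm_nonneg _) |>.2

theorem continuousOn_H1_iff {u : ℝ → H1} {s : Set ℝ} :
    ContinuousOn u s ↔
      ContinuousOn (fun t => toL2 (u t)) s ∧ ContinuousOn (fun t => weakDeriv (u t)) s := by
  have h : Continuous fun z : WithLp 2 (L2 × L2) => (z.fst, z.snd) :=
    WithLp.prod_continuous_ofLp 2 L2 L2
  constructor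
  · intro hu
    have h1 : ContinuousOn (fun t => ((u t).1.fst, (u t).1.snd)) s :=
      h.comp_continuousOn (continuous_subtype_val.comp_continuousOn hu)
    exact ⟨continuous_fst.comp_continuousOn h1, continuous_snd.comp_continuousOn h1⟩
  · rintro ⟨h1, h2⟩
    refine continuousOn_iff_continuous_domRestrict.2 (Continuous.subtype_mk ?_ _)
    have h3 : ContinuousOn (fun t => WithLp.toLp 2 (toL2 (u t), weakDeriv (u t))) s :=
      (WithLp.prod_continuous_toLp 2 L2 L2).comp_continuousOn (h1.prodMk h2)
    exact continuousOn_iff_continuous_domRestrict.1 h3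

/-- The element of `H¹(ℝ)` with given function and weak derivative. -/
def mkH1 (f f' : L2) (h : IsWeakDeriv f f') : H1 := ⟨WithLp.toLp 2 (f, f'), h⟩

theorem abs_pair_le (f : L2) {φ : ℝ → ℝ} (h : MemLp φ 2 (volume : Measure ℝ)) :
    |pair f φ| ≤ ‖f‖ * ‖lp φ‖ := by
  rw [pair_eq_inner f h]
  exact abs_real_inner_le_norm _ _

/-- A primitive of the difference of two probability densities supported in `[x - 1, x + 1]`. -/
theorem exists_primitive_of_densities {x : ℝ} {φ χ : ℝ → ℝ} (hφ : ContDiff ℝ ∞ φ)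
    (hχ : ContDiff ℝ ∞ χ) (hφ0 : ∀ y, 0 ≤ φ y) (hχ0 : ∀ y, 0 ≤ χ y)
    (hφs : ∀ y, y ∉ Icc (x - 1) (x + 1) → φ y = 0) (hχs : ∀ y, y ∉ Icc (x - 1) (x + 1) → χ y = 0)
    (hφ1 : ∫ y, φ y = 1) (hχ1 : ∫ y, χ y = 1) :
    ∃ ψ : ℝ → ℝ, ContDiff ℝ ∞ ψ ∧ (∀ y, deriv ψ y = φ y - χ y) ∧
      (∀ y, y ∉ Icc (x - 1) (x + 1) → ψ y = 0) ∧ ∀ y, |ψ y| ≤ 1 := by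
  have hc : ∀ ρ : ℝ → ℝ, (∀ y, y ∉ Icc (x - 1) (x + 1) → ρ y = 0) → HasCompactSupport ρ :=
    fun ρ h => HasCompactSupport.intro isCompact_Icc h
  have hI : ∀ ρ : ℝ → ℝ, ContDiff ℝ ∞ ρ → (∀ y, y ∉ Icc (x - 1) (x + 1) → ρ y = 0) →
      Integrable ρ := fun ρ h h' => h.continuous.integrable_of_hasCompactSupport (hc ρ h')
  -- Distribution functions take values in `[0, 1]`, and are `0` to the left of the interval and `1`
  -- to its right. The difference of two of them is therefore at most `1` in modulus and vanishes
  -- off the interval.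
  have hpart : ∀ ρ : ℝ → ℝ, ContDiff ℝ ∞ ρ → (∀ y, y ∉ Icc (x - 1) (x + 1) → ρ y = 0) →
      (∀ y, 0 ≤ ρ y) → ∫ y, ρ y = 1 → ∀ y, (∫ z in Iic y, ρ z) ∈ Icc (0 : ℝ) 1 ∧
        (y < x - 1 → ∫ z in Iic y, ρ z = 0) ∧ (x + 1 < y → ∫ z in Iic y, ρ z = 1) := by
    intro ρ h h' h0 h1 y
    refine ⟨⟨integral_nonneg h0, ?_⟩, fun hy => ?_, fun hy => ?_⟩
    · rw [← h1]
      exact setIntegral_le_integral (hI ρ h h') (Eventually.of_forall h0)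
    · refine setIntegral_eq_zero_of_forall_eq_zero fun z hz => h' z fun hz' => ?_
      have := hz'.1
      have : z ≤ y := hz
      linarith
    · rw [← h1]
      refine setIntegral_eq_integral_of_forall_compl_eq_zero fun z hz => h' z fun hz' => ?_
      have := hz'.2
      exact hz (show z ≤ y by linarith)
  have hd : ∀ y, HasDerivAt (fun y => ∫ z in Iic y, (φ z - χ z)) (φ y - χ y) y := by
    intro y
    have hI' : Integrable fun z => φ z - χ z := (hI φ hφ hφs).sub (hI χ hχ hχs)
    have h0 := intervalIntegral.integral_hasDerivAt_right (a := 0) (b := y)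
      (hI'.intervalIntegrable) ((hφ.continuous.sub hχ.continuous).stronglyMeasurableAtFilter _ _)
      (hφ.continuous.sub hχ.continuous).continuousAt
    refine (h0.const_add (∫ z in Iic 0, (φ z - χ z))).congr_of_eventuallyEq
      (Eventually.of_forall fun r => ?_)
    have := intervalIntegral.integral_Iic_sub_Iic (a := 0) (b := r) (f := fun z => φ z - χ z)
      hI'.integrableOn hI'.integrableOn
    simp only [← this]
    ring
  have hder : deriv (fun y => ∫ z in Iic y, (φ z - χ z)) = fun y => φ y - χ y :=
    funext fun y => (hd y).deriv
  have hsplit : ∀ y, ∫ z in Iic y, (φ z - χ z) = (∫ z in Iic y, φ z) - ∫ z in Iic y, χ z :=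
    fun y => integral_sub (hI φ hφ hφs).integrableOn (hI χ hχ hχs).integrableOn
  refine ⟨fun y => ∫ z in Iic y, (φ z - χ z), ?_, fun y => (hd y).deriv, fun y hy => ?_,
    fun y => ?_⟩
  · refine contDiff_infty_iff_deriv.2 ⟨fun y => (hd y).differentiableAt, ?_⟩
    rw [hder]
    exact hφ.sub hχ
  · simp only [hsplit]
    obtain ⟨-, h1, h2⟩ := hpart φ hφ hφs hφ0 hφ1 y
    obtain ⟨-, h3, h4⟩ := hpart χ hχ hχs hχ0 hχ1 y
    rcases lt_or_ge y (x - 1) with h | h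
    · rw [h1 h, h3 h, sub_zero]
    · have h' : x + 1 < y := by
        by_contra hle
        exact hy ⟨h, not_lt.1 hle⟩
      rw [h2 h', h4 h', sub_self]
  · simp only [hsplit]
    obtain ⟨h1, -, -⟩ := hpart φ hφ hφs hφ0 hφ1 y
    obtain ⟨h2, -, -⟩ := hpart χ hχ hχs hχ0 hχ1 y
    rw [abs_le]
    constructor <;> linarith [h1.1, h1.2, h2.1, h2.2]

/-- Replacing `φ` by a fixed bump `χ` near `x` costs only a pairing of the weak derivative with a
primitive of `φ - χ`, which is bounded by `1` whatever the shape of `φ`. The bound thus survives as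
`φ` concentrates at a point. -/
theorem abs_pair_density_le (w : H1) {x : ℝ} {φ : ℝ → ℝ} (hφ : ContDiff ℝ ∞ φ)
    (hφ0 : ∀ y, 0 ≤ φ y) (hφs : ∀ y, y ∉ Icc (x - 1) (x + 1) → φ y = 0) (hφ1 : ∫ y, φ y = 1) :
    |pair (toL2 w) φ| ≤ (2 : ℝ) ^ (1 / 2 : ℝ) * (‖toL2 w‖ + ‖weakDeriv w‖) := by
  -- The inner ball of radius `1/2` has length `1`, so the normalised bump is at most `1`.
  let β : ContDiffBump x := ⟨1 / 2, 1, by norm_num, by norm_num⟩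
  set χ := β.normed volume
  have hχ : ContDiff ℝ ∞ χ := β.contDiff_normed
  have hχ0 : ∀ y, 0 ≤ χ y := β.nonneg_normed
  have hχs : ∀ y, y ∉ Icc (x - 1) (x + 1) → χ y = 0 := by
    intro y hy
    by_contra hne
    have h1 : y ∈ Function.support χ := hne
    rw [β.support_normed_eq, Real.ball_eq_Ioo] at h1
    exact hy (Ioo_subset_Icc_self h1)
  have hχ1 : ∫ y, χ y = 1 := β.integral_normed
  have hχb : ∀ y, |χ y| ≤ 1 := by
    intro y
    rw [abs_of_nonneg (hχ0 y)]
    refine (β.normed_le_div_measure_closedBall_rIn volume y).trans ?_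
    simp [β, measureReal_def]
  obtain ⟨ψ, hψ, hψd, hψs, hψb⟩ := exists_primitive_of_densities hφ hχ hφ0 hχ0 hφs hχs hφ1 hχ1
  have hc : ∀ ρ : ℝ → ℝ, (∀ y, y ∉ Icc (x - 1) (x + 1) → ρ y = 0) → HasCompactSupport ρ :=
    fun ρ h => HasCompactSupport.intro isCompact_Icc h
  have hmφ := memLp_two_of_compactSupport hφ.continuous (hc φ hφs)
  have hmχ := memLp_two_of_compactSupport hχ.continuous (hc χ hχs)
  have hmψ := memLp_two_of_compactSupport hψ.continuous (hc ψ hψs)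
  have h1 : pair (toL2 w) φ = pair (toL2 w) χ - pair (weakDeriv w) ψ := by
    have h2 := pair_weakDeriv w hψ (hc ψ hψs)
    have h3 : deriv ψ = fun y => φ y - χ y := funext hψd
    rw [h3, pair_sub_right _ hmφ hmχ] at h2
    linarith
  have hvol : volume.real (Icc (x - 1) (x + 1)) = 2 := by
    rw [Real.volume_real_Icc_of_le (by linarith)]; ring
  have hN : ∀ ρ : ℝ → ℝ, (∀ y, y ∉ Icc (x - 1) (x + 1) → ρ y = 0) → (∀ y, |ρ y| ≤ 1) →
      ‖lp ρ‖ ≤ (2 : ℝ) ^ (1 / 2 : ℝ) := by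
    intro ρ h h'
    have := norm_lp_le_of_support (s := Icc (x - 1) (x + 1)) measurableSet_Icc (by simp)
      zero_le_one h fun y _ => h' y
    rwa [hvol, one_mul] at this
  calc |pair (toL2 w) φ| ≤ |pair (toL2 w) χ| + |pair (weakDeriv w) ψ| := by
        rw [h1]; exact abs_sub _ _
    _ ≤ ‖toL2 w‖ * (2 : ℝ) ^ (1 / 2 : ℝ) + ‖weakDeriv w‖ * (2 : ℝ) ^ (1 / 2 : ℝ) := by
        refine add_le_add ((abs_pair_le _ hmχ).trans ?_) ((abs_pair_le _ hmψ).trans ?_)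
        · gcongr; exact hN χ hχs hχb
        · gcongr; exact hN ψ hψs hψb
    _ = _ := by ring

-- Mollifications converge almost everywhere by Lebesgue differentiation, and each is a pairing with
-- a probability density near `x`, bounded independently of its width.
open scoped Convolution in
theorem ae_abs_le (w : H1) :
    ∀ᵐ x, |toL2 w x| ≤ (2 : ℝ) ^ (1 / 2 : ℝ) * (‖toL2 w‖ + ‖weakDeriv w‖) := by
  -- The ratio of outer to inner radius stays equal to `2`, as the differentiation theorem requires.
  let β : ℕ → ContDiffBump (0 : ℝ) := fun n =>
    ⟨1 / (2 * (n + 1)), 1 / (n + 1), by positivity, by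
      apply one_div_lt_one_div_of_lt <;> [positivity; linarith [(n.cast_nonneg : (0 : ℝ) ≤ n)]]⟩
  have hlim : Tendsto (fun n => (β n).rOut) atTop (𝓝 0) := tendsto_one_div_add_atTop_nhds_zero_nat
  have hloc : LocallyIntegrable (toL2 w) (volume : Measure ℝ) :=
    (Lp.memLp (toL2 w)).locallyIntegrable (by norm_num)
  filter_upwards [ContDiffBump.ae_convolution_tendsto_right_of_locallyIntegrable hlim
    (K := 2) (Eventually.of_forall fun n => by
      simp only [β]; apply le_of_eq; field_simp) hloc] with x hx
  refine le_of_tendsto hx.abs (Eventually.of_forall fun n => ?_)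
  have hr : (β n).rOut ≤ 1 := by
    simp only [β]
    rw [div_le_one (by positivity)]
    linarith [(n.cast_nonneg : (0 : ℝ) ≤ n)]
  have h1 : ((β n).normed volume ⋆[ContinuousLinearMap.lsmul ℝ ℝ, volume] (toL2 w)) x =
      pair (toL2 w) fun y => (β n).normed volume (x - y) := by
    rw [convolution_eq_swap, pair]
    refine integral_congr_ae (Eventually.of_forall fun y => ?_)
    simp [mul_comm]
  rw [h1]
  refine abs_pair_density_le w (x := x) ?_ (fun y => (β n).nonneg_normed _) (fun y hy => ?_) ?_
  · exact (β n).contDiff_normed.comp (contDiff_const.sub contDiff_id)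
  · by_contra hne
    have h2 : x - y ∈ Function.support ((β n).normed volume) := hne
    rw [(β n).support_normed_eq, Real.ball_eq_Ioo] at h2
    exact hy ⟨by linarith [h2.2], by linarith [h2.1]⟩
  · rw [integral_sub_left_eq_self (fun y => (β n).normed volume y) volume x]
    exact (β n).integral_normed

/-! ### Multiplication by a bounded continuous function -/

/-- The product of a function and an `L²` function. -/
def mulL (b : ℝ → ℝ) (f : L2) : L2 := lp fun x => b x * f x

section mulL

variable {b c : ℝ → ℝ} {C : ℝ}

theorem memLp_mul (hb : Continuous b) (hC : ∀ x, |b x| ≤ C) (f : L2) :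
    MemLp (fun x => b x * f x) 2 (volume : Measure ℝ) := by
  refine (Lp.memLp f).of_le_mul (c := C)
    (hb.aestronglyMeasurable.mul (Lp.aestronglyMeasurable f)) (Eventually.of_forall fun x => ?_)
  rw [norm_mul]
  exact mul_le_mul_of_nonneg_right (hC x) (norm_nonneg _)

theorem mulL_ae (hb : Continuous b) (hC : ∀ x, |b x| ≤ C) (f : L2) :
    mulL b f =ᵐ[volume] fun x => b x * f x := lp_ae (memLp_mul hb hC f)

theorem norm_mulL_le (hb : Continuous b) (hC : ∀ x, |b x| ≤ C) (f : L2) :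
    ‖mulL b f‖ ≤ C * ‖f‖ := by
  refine Lp.norm_le_mul_norm_of_ae_le_mul ?_
  filter_upwards [mulL_ae hb hC f] with x hx
  rw [hx, norm_mul]
  exact mul_le_mul_of_nonneg_right (hC x) (norm_nonneg _)

theorem mulL_sub (hb : Continuous b) (hC : ∀ x, |b x| ≤ C) (f g : L2) :
    mulL b (f - g) = mulL b f - mulL b g := by
  refine Lp.ext ?_
  filter_upwards [mulL_ae hb hC f, mulL_ae hb hC g, mulL_ae hb hC (f - g), Lp.coeFn_sub f g,
    Lp.coeFn_sub (mulL b f) (mulL b g)] with x h1 h2 h3 h4 h5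
  rw [h5, h3, Pi.sub_apply, h1, h2, h4, Pi.sub_apply]
  ring

theorem mulL_zero : mulL b 0 = 0 := by
  refine lp_eq_of_ae ?_
  filter_upwards [Lp.coeFn_zero ℝ 2 (volume : Measure ℝ)] with x
  simp

theorem sub_mulL (hb : Continuous b) (hC : ∀ x, |b x| ≤ C) (hc : Continuous c)
    (hC' : ∀ x, |c x| ≤ C) (f : L2) :
    mulL b f - mulL c f = mulL (fun x => b x - c x) f := by
  have h : ∀ x, |b x - c x| ≤ C + C := fun x =>
    (abs_sub _ _).trans (add_le_add (hC x) (hC' x))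
  refine Lp.ext ?_
  filter_upwards [mulL_ae hb hC f, mulL_ae hc hC' f,
    mulL_ae (b := fun x => b x - c x) (hb.sub hc) h f, Lp.coeFn_sub (mulL b f) (mulL c f)] with x h1 h2 h3 h5
  rw [h5, h3, Pi.sub_apply, h1, h2]
  ring

theorem pair_mulL (hb : Continuous b) (hC : ∀ x, |b x| ≤ C) (f : L2) (φ : ℝ → ℝ) :
    pair (mulL b f) φ = pair f fun x => b x * φ x := by
  refine integral_congr_ae ?_
  filter_upwards [mulL_ae hb hC f] with x hx
  rw [hx]; ring

end mulL

/-! ### The truncated power nonlinearity -/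

/-- The power `|s|^p`, truncated at `|s| = M`. -/
def clipPow (p M s : ℝ) : ℝ := (min |s| M) ^ p

theorem clipPow_of_le {p M s : ℝ} (h : |s| ≤ M) : clipPow p M s = |s| ^ p := by
  rw [clipPow, min_eq_left h]

theorem clipPow_zero {p M : ℝ} (hp : 1 < p) (hM : 0 ≤ M) : clipPow p M 0 = 0 := by
  rw [clipPow_of_le (by simpa using hM), abs_zero, Real.zero_rpow (by linarith)]

/-- On `[0, M]` the derivative of `s ^ p` is at most `p M ^ (p - 1)`, and `s ↦ min |s| M` is a
1-Lipschitz map into that interval. Truncation thus makes the nonlinearity globally Lipschitz on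
`L²`. -/
theorem lipschitzWith_clipPow {p M : ℝ} (hp : 1 < p) (hM : 0 ≤ M) :
    LipschitzWith (p * M ^ (p - 1)).toNNReal (clipPow p M) := by
  have h1 : LipschitzOnWith (p * M ^ (p - 1)).toNNReal (fun s : ℝ => s ^ p) (Icc 0 M) := by
    refine (convex_Icc 0 M).lipschitzOnWith_of_nnnorm_hasDerivWithin_le
      (f' := fun s => p * s ^ (p - 1))
      (fun s _ => (Real.hasDerivAt_rpow_const (Or.inr hp.le)).hasDerivWithinAt) fun s hs => ?_
    rw [← NNReal.coe_le_coe, coe_nnnorm, Real.coe_toNNReal _ (by positivity), Real.norm_eq_abs,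
      abs_of_nonneg (mul_nonneg (by linarith) (Real.rpow_nonneg hs.1 _))]
    gcongr
    · exact hs.1
    · exact hs.2
  have h2 : LipschitzWith 1 fun s : ℝ => min |s| M := by
    have := (LipschitzWith.of_dist_le_mul (K := 1) fun x y : ℝ => by
      rw [Real.dist_eq, Real.dist_eq, NNReal.coe_one, one_mul]
      exact abs_abs_sub_abs_le_abs_sub x y : LipschitzWith 1 fun s : ℝ => |s|)
    exact this.min_const M
  refine LipschitzWith.of_dist_le_mul fun x y => ?_
  refine (h1.dist_le_mul _ ⟨le_min (abs_nonneg x) hM, min_le_right _ _⟩ _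
    ⟨le_min (abs_nonneg y) hM, min_le_right _ _⟩).trans ?_
  gcongr
  simpa using h2.dist_le_mul x y

/-- The Nemytskii operator of the truncated power. -/
def nem (p M : ℝ) (f : L2) : L2 := lp fun x => clipPow p M (f x)

section nem

variable {p M : ℝ}

theorem nem_eq (hp : 1 < p) (hM : 0 ≤ M) (f : L2) :
    nem p M f = (lipschitzWith_clipPow hp hM).compLp (clipPow_zero hp hM) f :=
  lp_eq_of_ae ((lipschitzWith_clipPow hp hM).coeFn_compLp (clipPow_zero hp hM) f).symm

theorem nem_ae (hp : 1 < p) (hM : 0 ≤ M) (f : L2) :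
    nem p M f =ᵐ[volume] fun x => clipPow p M (f x) := by
  rw [nem_eq hp hM]
  exact (lipschitzWith_clipPow hp hM).coeFn_compLp (clipPow_zero hp hM) f

theorem lipschitzWith_nem (hp : 1 < p) (hM : 0 ≤ M) :
    LipschitzWith (p * M ^ (p - 1)).toNNReal (nem p M) := by
  have : nem p M = (lipschitzWith_clipPow hp hM).compLp (clipPow_zero hp hM) :=
    funext fun f => nem_eq hp hM f
  rw [this]
  exact LipschitzWith.lipschitzWith_compLp _ _

theorem nem_zero (hp : 1 < p) (hM : 0 ≤ M) : nem p M 0 = 0 := by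
  rw [nem_eq hp hM]
  exact LipschitzWith.compLp_zero _ _

theorem nem_ae_of_le (hp : 1 < p) (hM : 0 ≤ M) {f : L2} (h : ∀ᵐ x, |f x| ≤ M) :
    nem p M f =ᵐ[volume] fun x => |f x| ^ p := by
  filter_upwards [nem_ae hp hM f, h] with x h1 h2
  rw [h1, clipPow_of_le h2]

theorem nem_eq_of_le (hp : 1 < p) (hM : 0 ≤ M) {N : ℝ} (hN : 0 ≤ N) {f : L2} (h : ∀ᵐ x, |f x| ≤ M)
    (h' : ∀ᵐ x, |f x| ≤ N) : nem p M f = nem p N f :=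
  Lp.ext ((nem_ae_of_le hp hM h).trans (nem_ae_of_le hp hN h').symm)

theorem pair_nem (hp : 1 < p) (hM : 0 ≤ M) {f : L2} (h : ∀ᵐ x, |f x| ≤ M) (φ : ℝ → ℝ) :
    pair (nem p M f) φ = ∫ x, |f x| ^ p * φ x := by
  refine integral_congr_ae ?_
  filter_upwards [nem_ae_of_le hp hM h] with x hx
  rw [hx]

end nem

/-! ### Ordinary differential equations with a globally Lipschitz right-hand side -/

theorem continuous_uncurry_of_lipschitz {E : Type*} [NormedAddCommGroup E] {G : ℝ → E → E}
    {K : ℝ≥0} (hL : ∀ t, LipschitzWith K (G t))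
    (hc : ∀ y, Continuous fun t => G t y) : Continuous fun z : ℝ × E => G z.1 z.2 :=
  continuous_prod_of_continuous_lipschitzWith' (fun z : ℝ × E => G z.1 z.2) K hL hc

section ODE

variable {E : Type*} [NormedAddCommGroup E] [NormedSpace ℝ E] {G : ℝ → E → E} {K : ℝ≥0}

/-- Picard iteration in the norm weighted by `exp (-l t)`. With `l = K + 1` the integral operator
contracts by `K / l < 1` on an interval of any length, so no pasting of short intervals is needed.
-/
theorem exists_solution_of_lipschitz [CompleteSpace E] (hL : ∀ t, LipschitzWith K (G t))
    (hc : ∀ y, Continuous fun t => G t y) (y₀ : E) {T : ℝ} (hT : 0 ≤ T) :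
    ∃ y : ℝ → E, y 0 = y₀ ∧ ∀ t ∈ Icc 0 T, HasDerivWithinAt y (G t (y t)) (Icc 0 T) t := by
  have hG := continuous_uncurry_of_lipschitz hL hc
  set l : ℝ := K + 1 with hl
  have hl0 : 0 < l := by positivity
  -- The unknown is `z = exp (-l t) y`, which turns the weighted norm into the plain supremum norm;
  -- `ext` recovers `y` and extends it continuously beyond the interval.
  let ext : C(Icc 0 T, E) → ℝ → E := fun z t => Real.exp (l * t) • z (projIcc 0 T hT t)
  have hext : ∀ z, Continuous (ext z) := fun z => by
    have := continuous_projIcc (h := hT)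
    fun_prop
  have hGe : ∀ z, Continuous fun s => G s (ext z s) := fun z =>
    hG.comp (continuous_id.prodMk (hext z))
  have hIc : ∀ z, Continuous fun t : ℝ => ∫ s in (0 : ℝ)..t, G s (ext z s) := fun z =>
    intervalIntegral.continuous_primitive (fun a b => (hGe z).intervalIntegrable a b) 0
  let Φ : C(Icc 0 T, E) → C(Icc 0 T, E) := fun z =>
    ⟨fun t => Real.exp (-(l * t)) • (y₀ + ∫ s in (0 : ℝ)..t, G s (ext z s)), by
      have := (hIc z).comp (continuous_subtype_val (p := fun t => t ∈ Icc 0 T))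
      fun_prop⟩
  have hΦ : ∀ z w, dist (Φ z) (Φ w) ≤ K / l * dist z w := by
    intro z w
    rw [ContinuousMap.dist_le (by positivity)]
    intro t
    have ht0 : (0 : ℝ) ≤ t := t.2.1
    have h1 : Φ z t - Φ w t =
        Real.exp (-(l * t)) • ∫ s in (0 : ℝ)..t, (G s (ext z s) - G s (ext w s)) := by
      rw [intervalIntegral.integral_sub ((hGe z).intervalIntegrable _ _)
        ((hGe w).intervalIntegrable _ _)]
      simp only [Φ, ContinuousMap.coe_mk]
      rw [← smul_sub]
      congr 1
      abel
    have h2 : ∀ s : ℝ, ‖G s (ext z s) - G s (ext w s)‖ ≤ K * dist z w * Real.exp (l * s) := by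
      intro s
      rw [← dist_eq_norm]
      refine ((hL s).dist_le_mul _ _).trans ?_
      rw [mul_assoc]
      gcongr
      simp only [ext]
      rw [dist_smul₀, Real.norm_of_nonneg (Real.exp_pos _).le, mul_comm]
      gcongr
      exact ContinuousMap.dist_apply_le_dist _
    have h3 : ∫ s in (0 : ℝ)..t, K * dist z w * Real.exp (l * s) =
        K * dist z w * ((Real.exp (l * t) - 1) / l) := by
      rw [intervalIntegral.integral_const_mul]
      congr 1
      rw [intervalIntegral.integral_comp_mul_left (fun s => Real.exp s) hl0.ne']
      simp [integral_exp, div_eq_inv_mul]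
    rw [dist_eq_norm, h1, norm_smul, Real.norm_of_nonneg (Real.exp_pos _).le]
    have h4 : ‖∫ s in (0 : ℝ)..t, (G s (ext z s) - G s (ext w s))‖ ≤
        K * dist z w * ((Real.exp (l * t) - 1) / l) := by
      rw [← h3]
      exact intervalIntegral.norm_integral_le_of_norm_le ht0
        (Eventually.of_forall fun s _ => h2 s) (Continuous.intervalIntegrable (by fun_prop) _ _)
    calc Real.exp (-(l * t)) * ‖∫ s in (0 : ℝ)..t, (G s (ext z s) - G s (ext w s))‖
        ≤ Real.exp (-(l * t)) * (K * dist z w * ((Real.exp (l * t) - 1) / l)) := by gcongr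
      _ ≤ Real.exp (-(l * t)) * (K * dist z w * (Real.exp (l * t) / l)) := by gcongr; linarith
      _ = K / l * dist z w * (Real.exp (-(l * t)) * Real.exp (l * t)) := by ring
      _ = K / l * dist z w := by rw [← Real.exp_add]; simp
  have hKl : ((K / l).toNNReal : ℝ) = K / l := Real.coe_toNNReal _ (by positivity)
  have hcon : ContractingWith (K / l).toNNReal Φ := by
    refine ⟨?_, LipschitzWith.of_dist_le_mul fun z w => by rw [hKl]; exact hΦ z w⟩
    rw [← NNReal.coe_lt_coe, hKl, NNReal.coe_one, div_lt_one hl0]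
    linarith
  set z := hcon.fixedPoint Φ
  have hz : Φ z = z := hcon.fixedPoint_isFixedPt
  refine ⟨fun t => y₀ + ∫ s in (0 : ℝ)..t, G s (ext z s), by simp, fun t ht => ?_⟩
  have h5 : y₀ + ∫ s in (0 : ℝ)..t, G s (ext z s) = ext z t := by
    have h6 : Real.exp (-(l * t)) • (y₀ + ∫ s in (0 : ℝ)..t, G s (ext z s)) = z ⟨t, ht⟩ :=
      DFunLike.congr_fun hz ⟨t, ht⟩
    have h7 : ext z t = Real.exp (l * t) • z ⟨t, ht⟩ := by
      simp only [ext]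
      rw [projIcc_of_mem hT ht]
    rw [h7, ← h6, smul_smul, ← Real.exp_add, add_neg_cancel, Real.exp_zero, one_smul]
  simp only [h5]
  exact ((intervalIntegral.integral_hasDerivAt_right ((hGe z).intervalIntegrable _ _)
    (hGe z).aestronglyMeasurable.stronglyMeasurableAtFilter (hGe z).continuousAt).const_add
      y₀).hasDerivWithinAt

theorem hasDerivWithinAt_Ici_of_Icc {f : ℝ → E} {f' : E} {a b t : ℝ} (ht : t ∈ Ico a b)
    (h : HasDerivWithinAt f f' (Icc a b) t) : HasDerivWithinAt f f' (Ici t) t :=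
  h.mono_of_mem_nhdsWithin (mem_of_superset (Icc_mem_nhdsGE ht.2) (Icc_subset_Icc_left ht.1))

theorem solution_unique (hL : ∀ t, LipschitzWith K (G t)) {T : ℝ} {y z : ℝ → E}
    (hy : ∀ t ∈ Icc 0 T, HasDerivWithinAt y (G t (y t)) (Icc 0 T) t)
    (hz : ∀ t ∈ Icc 0 T, HasDerivWithinAt z (G t (z t)) (Icc 0 T) t) (h0 : y 0 = z 0) :
    ∀ t ∈ Icc 0 T, y t = z t :=
  ODE_solution_unique_of_mem_Icc_right (v := G) (s := fun _ => univ)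
    (fun t _ => (hL t).lipschitzOnWith)
    (fun t ht => (hy t ht).continuousWithinAt)
    (fun t ht => hasDerivWithinAt_Ici_of_Icc ht (hy t (Ico_subset_Icc_self ht)))
    (fun _ _ => mem_univ _)
    (fun t ht => (hz t ht).continuousWithinAt)
    (fun t ht => hasDerivWithinAt_Ici_of_Icc ht (hz t (Ico_subset_Icc_self ht)))
    (fun _ _ => mem_univ _) h0

end ODE

/-! ### The damped wave equation as an ordinary differential equation -/

/-- A bounded continuous coefficient, uniformly Lipschitz continuous in time. -/
structure IsCoeff (A : ℝ → ℝ → ℝ) (C : ℝ≥0) : Prop where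
  continuous : Continuous fun z : ℝ × ℝ => A z.1 z.2
  bound : ∀ t x, |A t x| ≤ C
  lip : ∀ s t x, |A s x - A t x| ≤ C * |s - t|

namespace IsCoeff

variable {A : ℝ → ℝ → ℝ} {C : ℝ≥0}

theorem continuous_apply (h : IsCoeff A C) (t : ℝ) : Continuous (A t) :=
  h.continuous.comp (continuous_const.prodMk continuous_id)

/-- Uniform Lipschitz dependence of the coefficient on time makes multiplication continuous in
operator norm. -/
theorem continuous_mulL (h : IsCoeff A C) : Continuous fun z : ℝ × L2 => mulL (A z.1) z.2 := by
  refine continuous_uncurry_of_lipschitz (G := fun t f => mulL (A t) f) (K := C)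
    (fun t => LipschitzWith.of_dist_le_mul fun f g => ?_) fun f => ?_
  · rw [dist_eq_norm, dist_eq_norm, ← mulL_sub (h.continuous_apply t) (h.bound t)]
    exact norm_mulL_le (h.continuous_apply t) (h.bound t) _
  · have : LipschitzWith (C * ‖f‖₊) fun t => mulL (A t) f := by
      refine LipschitzWith.of_dist_le_mul fun s t => ?_
      rw [dist_eq_norm, sub_mulL (h.continuous_apply s) (h.bound s) (h.continuous_apply t)
        (h.bound t)]
      refine (norm_mulL_le ((h.continuous_apply s).sub (h.continuous_apply t)) (h.lip s t)
        f).trans (le_of_eq ?_)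
      rw [NNReal.coe_mul, coe_nnnorm, Real.dist_eq]
      ring
    exact this.continuous

end IsCoeff

/-- The phase space `L² × L² × L²`. -/
abbrev Phase : Type := L2 × L2 × L2

/-- The time derivative of `u` in terms of the phase space coordinates. -/
def wave (t : ℝ) (y : Phase) : L2 := (1 / 2 : ℝ) • (shift t y.2.1 + shift (-t) y.2.2)

/-- The space derivative of `u` in terms of the phase space coordinates. -/
def slope (t : ℝ) (y : Phase) : L2 := (1 / 2 : ℝ) • (shift t y.2.1 - shift (-t) y.2.2)

/-- The phase space coordinates `(u, S(-t)(u_t + u_x), S(t)(u_t - u_x))`. -/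
def phase (t : ℝ) (u : H1) (w : L2) : Phase :=
  (toL2 u, shift (-t) (w + weakDeriv u), shift t (w - weakDeriv u))

@[simp] theorem wave_phase (t : ℝ) (u : H1) (w : L2) : wave t (phase t u w) = w := by
  simp only [wave, phase, shift_shift_neg, shift_neg_shift]
  rw [add_add_sub_cancel, ← two_smul ℝ w, smul_smul]
  norm_num

@[simp] theorem slope_phase (t : ℝ) (u : H1) (w : L2) :
    slope t (phase t u w) = weakDeriv u := by
  simp only [slope, phase, shift_shift_neg, shift_neg_shift]
  rw [add_sub_sub_cancel, ← two_smul ℝ (weakDeriv u), smul_smul]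
  norm_num

/-- The source term `|u|^p - a u_t`, with truncated power. -/
def force (A : ℝ → ℝ → ℝ) (p M t : ℝ) (y : Phase) : L2 :=
  nem p M y.1 - mulL (A t) (wave t y)

/-- The vector field of the damped wave equation. -/
def field (A : ℝ → ℝ → ℝ) (p M t : ℝ) (y : Phase) : Phase :=
  (wave t y, shift (-t) (force A p M t y), shift t (force A p M t y))

theorem wave_sub (t : ℝ) (y z : Phase) : wave t (y - z) = wave t y - wave t z := by
  simp only [wave, Prod.snd_sub, Prod.fst_sub, map_sub]
  rw [← smul_sub]
  congr 1
  abel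

theorem norm_half_smul_le {f g : L2} {c : ℝ} (hf : ‖f‖ ≤ c) (hg : ‖g‖ ≤ c) :
    ‖(1 / 2 : ℝ) • (f + g)‖ ≤ c ∧ ‖(1 / 2 : ℝ) • (f - g)‖ ≤ c := by
  rw [norm_smul, norm_smul, Real.norm_of_nonneg (by norm_num)]
  constructor
  · linarith [norm_add_le f g]
  · linarith [norm_sub_le f g]

theorem norm_snd_fst_le (y : Phase) : ‖y.2.1‖ ≤ ‖y‖ :=
  (norm_fst_le y.2).trans (norm_snd_le y)

theorem norm_snd_snd_le (y : Phase) : ‖y.2.2‖ ≤ ‖y‖ :=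
  (norm_snd_le y.2).trans (norm_snd_le y)

theorem norm_wave_le (t : ℝ) (y : Phase) : ‖wave t y‖ ≤ ‖y‖ := by
  refine (norm_half_smul_le ?_ ?_).1
  · rw [LinearIsometry.norm_map]; exact norm_snd_fst_le y
  · rw [LinearIsometry.norm_map]; exact norm_snd_snd_le y

theorem norm_slope_le (t : ℝ) (y : Phase) : ‖slope t y‖ ≤ ‖y‖ := by
  refine (norm_half_smul_le ?_ ?_).2
  · rw [LinearIsometry.norm_map]; exact norm_snd_fst_le y
  · rw [LinearIsometry.norm_map]; exact norm_snd_snd_le y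

theorem norm_phase_le (t : ℝ) (u : H1) (w : L2) : ‖phase t u w‖ ≤ ‖u‖ + ‖w‖ := by
  have h1 := norm_toL2_le u
  have h2 := norm_weakDeriv_le u
  refine norm_prod_le_iff.2 ⟨by simp only [phase]; linarith [norm_nonneg w],
    norm_prod_le_iff.2 ⟨?_, ?_⟩⟩
  · simp only [phase, LinearIsometry.norm_map]
    linarith [norm_add_le w (weakDeriv u)]
  · simp only [phase, LinearIsometry.norm_map]
    linarith [norm_sub_le w (weakDeriv u)]

theorem continuous_shift_of {f : ℝ → L2} {r : ℝ → ℝ} {s : Set ℝ} (hr : ContinuousOn r s)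
    (hf : ContinuousOn f s) : ContinuousOn (fun t => shift (r t) (f t)) s :=
  Continuous.comp_continuousOn' (f := fun t => (r t, f t)) continuous_shift_uncurry (hr.prodMk hf)

theorem continuousOn_wave {y : ℝ → Phase} {s : Set ℝ} (hy : ContinuousOn y s) :
    ContinuousOn (fun t => wave t (y t)) s := by
  have h1 : ContinuousOn (fun t => shift t (y t).2.1) s :=
    continuous_shift_of continuousOn_id hy.snd.fst
  have h2 : ContinuousOn (fun t => shift (-t) (y t).2.2) s :=
    continuous_shift_of continuousOn_id.neg hy.snd.snd
  exact (h1.add h2).const_smul (1 / 2 : ℝ)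

theorem continuousOn_slope {y : ℝ → Phase} {s : Set ℝ} (hy : ContinuousOn y s) :
    ContinuousOn (fun t => slope t (y t)) s := by
  have h1 : ContinuousOn (fun t => shift t (y t).2.1) s :=
    continuous_shift_of continuousOn_id hy.snd.fst
  have h2 : ContinuousOn (fun t => shift (-t) (y t).2.2) s :=
    continuous_shift_of continuousOn_id.neg hy.snd.snd
  exact (h1.sub h2).const_smul (1 / 2 : ℝ)

theorem continuousOn_phase {u : ℝ → H1} {w : ℝ → L2} {s : Set ℝ} (hu : ContinuousOn u s)
    (hw : ContinuousOn w s) : ContinuousOn (fun t => phase t (u t) (w t)) s := by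
  obtain ⟨h1, h2⟩ := continuousOn_H1_iff.1 hu
  exact h1.prodMk ((continuous_shift_of continuousOn_id.neg (hw.add h2)).prodMk
    (continuous_shift_of continuousOn_id (hw.sub h2)))

section field

variable {A : ℝ → ℝ → ℝ} {C : ℝ≥0} {p M : ℝ}

theorem continuousOn_force (hA : IsCoeff A C) (hp : 1 < p) (hM : 0 ≤ M) {y : ℝ → Phase}
    {s : Set ℝ} (hy : ContinuousOn y s) : ContinuousOn (fun t => force A p M t (y t)) s :=
  ((lipschitzWith_nem hp hM).continuous.comp_continuousOn hy.fst).sub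
    (hA.continuous_mulL.comp_continuousOn (continuousOn_id.prodMk (continuousOn_wave hy)))

theorem continuousOn_field (hA : IsCoeff A C) (hp : 1 < p) (hM : 0 ≤ M) {y : ℝ → Phase}
    {s : Set ℝ} (hy : ContinuousOn y s) : ContinuousOn (fun t => field A p M t (y t)) s :=
  (continuousOn_wave hy).prodMk
    ((continuous_shift_of continuousOn_id.neg (continuousOn_force hA hp hM hy)).prodMk
      (continuous_shift_of continuousOn_id (continuousOn_force hA hp hM hy)))

theorem force_zero (hp : 1 < p) (hM : 0 ≤ M) (t : ℝ) : force A p M t 0 = 0 := by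
  simp [force, nem_zero hp hM, wave, mulL_zero]

theorem field_zero (hp : 1 < p) (hM : 0 ≤ M) (t : ℝ) : field A p M t 0 = 0 := by
  rw [field, force_zero hp hM]
  simp [wave]

/-- A Lipschitz constant of the vector field. -/
def fieldLip (p M : ℝ) (C : ℝ≥0) : ℝ≥0 := 1 + ((p * M ^ (p - 1)).toNNReal + C)

/-- Translations are isometries and `wave` has norm at most `1`. No space derivative occurs in these
coordinates, so only the power and the damping contribute beyond the constant `1`. -/
theorem lipschitzWith_field (hA : IsCoeff A C) (hp : 1 < p) (hM : 0 ≤ M) (t : ℝ) :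
    LipschitzWith (fieldLip p M C) (field A p M t) := by
  set N := (p * M ^ (p - 1)).toNNReal with hN
  refine LipschitzWith.of_dist_le_mul fun y z => ?_
  have h1 : ‖wave t y - wave t z‖ ≤ ‖y - z‖ := by
    rw [← wave_sub]; exact norm_wave_le t _
  have h2 : ‖nem p M y.1 - nem p M z.1‖ ≤ N * ‖y - z‖ := by
    have := (lipschitzWith_nem hp hM).dist_le_mul y.1 z.1
    rw [dist_eq_norm, dist_eq_norm] at this
    refine this.trans ?_
    gcongr
    exact norm_fst_le (y - z)
  have h3 : ‖mulL (A t) (wave t y) - mulL (A t) (wave t z)‖ ≤ C * ‖y - z‖ := by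
    rw [← mulL_sub (hA.continuous_apply t) (hA.bound t)]
    exact (norm_mulL_le (hA.continuous_apply t) (hA.bound t) _).trans (by gcongr)
  have h4 : ‖force A p M t y - force A p M t z‖ ≤ (N + C) * ‖y - z‖ := by
    have : force A p M t y - force A p M t z = (nem p M y.1 - nem p M z.1) -
        (mulL (A t) (wave t y) - mulL (A t) (wave t z)) := by
      simp only [force]; abel
    rw [this, add_mul]
    exact (norm_sub_le _ _).trans (add_le_add h2 h3)
  have hK : ((fieldLip p M C : ℝ≥0) : ℝ) = 1 + (N + C) := by simp [fieldLip, hN]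
  have h0 : 0 ≤ ‖y - z‖ := norm_nonneg _
  have hNC : (0 : ℝ) ≤ N + C := by positivity
  rw [dist_eq_norm, dist_eq_norm, hK]
  refine norm_prod_le_iff.2 ⟨?_, norm_prod_le_iff.2 ⟨?_, ?_⟩⟩
  · exact h1.trans (by nlinarith)
  · simp only [field, Prod.snd_sub, Prod.fst_sub, ← map_sub, LinearIsometry.norm_map]
    exact h4.trans (by nlinarith)
  · simp only [field, Prod.snd_sub, ← map_sub, LinearIsometry.norm_map]
    exact h4.trans (by nlinarith)

theorem norm_field_le (hA : IsCoeff A C) (hp : 1 < p) (hM : 0 ≤ M) (t : ℝ) (y : Phase) :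
    ‖field A p M t y‖ ≤ fieldLip p M C * ‖y‖ := by
  have := (lipschitzWith_field hA hp hM t).dist_le_mul y 0
  rwa [field_zero hp hM, dist_zero_right, dist_zero_right] at this

/-- The truncation level is irrelevant on states bounded by both levels; this allows solutions built
with different truncations to be compared. -/
theorem field_eq_of_le (hp : 1 < p) (hM : 0 ≤ M) {N : ℝ} (hN : 0 ≤ N) (t : ℝ) {y : Phase}
    (h : ∀ᵐ x, |y.1 x| ≤ M) (h' : ∀ᵐ x, |y.1 x| ≤ N) : field A p M t y = field A p N t y := by
  simp only [field, force, nem_eq_of_le hp hM hN h h']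

/-- `y` solves the differential equation of the field on `[0, T]`. -/
def IsFlow (A : ℝ → ℝ → ℝ) (p M T : ℝ) (y : ℝ → Phase) : Prop :=
  ∀ t ∈ Icc 0 T, HasDerivWithinAt y (field A p M t (y t)) (Icc 0 T) t

theorem exists_isFlow (hA : IsCoeff A C) (hp : 1 < p) (hM : 0 ≤ M) (y₀ : Phase) {T : ℝ}
    (hT : 0 ≤ T) : ∃ y : ℝ → Phase, y 0 = y₀ ∧ IsFlow A p M T y :=
  exists_solution_of_lipschitz (lipschitzWith_field hA hp hM)
    (fun _ => continuousOn_univ.1 (continuousOn_field hA hp hM continuousOn_const)) y₀ hT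

theorem IsFlow.continuousOn {T : ℝ} {y : ℝ → Phase} (h : IsFlow A p M T y) :
    ContinuousOn y (Icc 0 T) := fun t ht => (h t ht).continuousWithinAt

theorem IsFlow.mono {T T' : ℝ} {y : ℝ → Phase} (h : IsFlow A p M T y) (hT : T' ≤ T) :
    IsFlow A p M T' y := fun t ht =>
  (h t ⟨ht.1, ht.2.trans hT⟩).mono (Icc_subset_Icc_right hT)

theorem IsFlow.eq (hA : IsCoeff A C) (hp : 1 < p) (hM : 0 ≤ M) {T : ℝ} {y z : ℝ → Phase}
    (hy : IsFlow A p M T y) (hz : IsFlow A p M T z) (h0 : y 0 = z 0) :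
    ∀ t ∈ Icc 0 T, y t = z t :=
  solution_unique (lipschitzWith_field hA hp hM) hy hz h0

end field

/-! ### Propagation of the constraint between a function and its slope -/

theorem isTestCurve_translate {φ : ℝ → ℝ} (h : Continuous φ) (hc : HasCompactSupport φ) (σ R : ℝ) :
    IsTestCurve (Icc (-R) R) fun t x => φ (x + σ * t) := by
  obtain ⟨B, hB⟩ := (isTestCurve_const h hc univ).support
  refine ⟨(by fun_prop : Continuous fun z : ℝ × ℝ => φ (z.2 + σ * z.1)).continuousOn,
    B + |σ| * R, fun t ht x hx => hB 0 (mem_univ _) _ fun hx' => hx ?_⟩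
  have h1 : |σ * t| ≤ |σ| * R := by
    rw [abs_mul]
    exact mul_le_mul_of_nonneg_left (abs_le.2 ht) (abs_nonneg _)
  rw [abs_le] at h1
  exact ⟨by linarith [hx'.1, hx'.2], by linarith [hx'.1, hx'.2]⟩

theorem isTestCurve_translate_nonneg {φ : ℝ → ℝ} (h : Continuous φ) (hc : HasCompactSupport φ)
    (σ T : ℝ) : IsTestCurve (Icc 0 T) fun t x => φ (x + σ * t) :=
  (isTestCurve_translate h hc σ T).mono fun _ ht => ⟨by linarith [ht.1, ht.2], ht.2⟩

theorem hasDerivAt_translate {φ : ℝ → ℝ} (h : ContDiff ℝ 1 φ) (σ t x : ℝ) :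
    HasDerivAt (fun t => φ (x + σ * t)) (σ * deriv φ (x + σ * t)) t := by
  have h1 : HasDerivAt (fun t => x + σ * t) σ t := by
    simpa using ((hasDerivAt_id t).const_mul σ).const_add x
  have h2 := ((h.differentiable (by norm_num)).differentiableAt (x := x + σ * t)).hasDerivAt
  exact (HasDerivAt.comp t h2 h1 : HasDerivAt (fun t => φ (x + σ * t)) _ t).congr_deriv (by ring)

theorem eq_of_hasDerivAt_zero {q : ℝ → ℝ} {T : ℝ} (hq : ContinuousOn q (Icc 0 T))
    (hd : ∀ t ∈ Ioo 0 T, HasDerivAt q 0 t) : ∀ t ∈ Icc 0 T, q t = q 0 := by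
  intro t ht
  have := intervalIntegral.integral_eq_sub_of_hasDerivAt_of_le ht.1
    (hq.mono (Icc_subset_Icc_right ht.2)) (fun s hs => hd s ⟨hs.1, hs.2.trans_le ht.2⟩)
    (by simp)
  simp only [intervalIntegral.integral_zero] at this
  linarith

section constraint

variable {A : ℝ → ℝ → ℝ} {p M T : ℝ}

theorem pair_wave (t : ℝ) (y : Phase) {φ : ℝ → ℝ} (h : Continuous φ) (hc : HasCompactSupport φ) :
    pair (wave t y) φ = 1 / 2 * (pair (shift t y.2.1) φ + pair (shift (-t) y.2.2) φ) := by
  rw [wave, pair_smul, pair_add _ _ (memLp_two_of_compactSupport h hc)]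

theorem pair_slope (t : ℝ) (y : Phase) {φ : ℝ → ℝ} (h : Continuous φ) (hc : HasCompactSupport φ) :
    pair (slope t y) φ = 1 / 2 * (pair (shift t y.2.1) φ - pair (shift (-t) y.2.2) φ) := by
  rw [slope, pair_smul, pair_sub _ _ (memLp_two_of_compactSupport h hc)]

/-- The three phase coordinates are independent unknowns of the differential equation, so it must be
checked that the slope remains the weak derivative. The defect, tested with `φ`, is conserved: the
two force contributions are equal after translation and enter the slope with opposite signs, while
the transport terms cancel `∫ u_t φ'`. -/
theorem IsFlow.isWeakDeriv {y : ℝ → Phase} (hy : IsFlow A p M T y)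
    (h0 : IsWeakDeriv (y 0).1 (slope 0 (y 0))) :
    ∀ t ∈ Icc 0 T, IsWeakDeriv (y t).1 (slope t (y t)) := by
  intro t ht φ hφ hc
  have hφ1 : ContDiff ℝ 1 φ := hφ.of_le (by exact_mod_cast le_top)
  have hφ' : Continuous (deriv φ) := hφ.continuous_deriv (by simp)
  -- The translations are moved onto `φ`, which can be differentiated; the `L²` coordinates cannot.
  set q : ℝ → ℝ := fun t => pair (y t).1 (deriv φ) +
    1 / 2 * (pair (y t).2.1 (fun x => φ (x + -1 * t)) - pair (y t).2.2 fun x => φ (x + 1 * t))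
    with hq
  have hqs : ∀ t, q t = pair (y t).1 (deriv φ) + pair (slope t (y t)) φ := by
    intro t
    rw [pair_slope t _ hφ.continuous hc, pair_shift, pair_shift]
    simp only [hq, sub_neg_eq_add, neg_mul, one_mul, ← sub_eq_add_neg]
  have hyc := hy.continuousOn
  have hT : ∀ σ, IsTestCurve (Icc 0 T) fun t x => φ (x + σ * t) :=
    fun σ => isTestCurve_translate_nonneg hφ.continuous hc σ T
  have hT' : ∀ σ, IsTestCurve (Icc 0 T) fun t x => σ * deriv φ (x + σ * t) := fun σ =>
    (isTestCurve_translate_nonneg hφ' hc.deriv σ T).mul_left continuousOn_const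
  have hC := isTestCurve_const hφ' hc.deriv (Icc 0 T)
  have hqc : ContinuousOn q (Icc 0 T) :=
    (hC.continuousOn_pair hyc.fst).add
      ((((hT (-1)).continuousOn_pair hyc.snd.fst).sub
        ((hT 1).continuousOn_pair hyc.snd.snd)).const_mul _)
  have hqd : ∀ t ∈ Ioo 0 T, HasDerivAt q 0 t := by
    intro t ht
    have hn : Icc 0 T ∈ 𝓝 t := Icc_mem_nhds ht.1 ht.2
    have hyd := (hy t (Ioo_subset_Icc_self ht)).hasDerivAt hn
    have d1 := hC.hasDerivAt_pair (Ψ' := fun _ _ => 0)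
      ⟨continuousOn_const, 0, fun _ _ _ _ => rfl⟩ hn
      (fun r _ _ x => hasDerivAt_const r _) hyd.fst
    have d2 := (hT (-1)).hasDerivAt_pair (hT' (-1)) hn
      (fun r _ _ x => hasDerivAt_translate hφ1 (-1) r x) hyd.snd.fst
    have d3 := (hT 1).hasDerivAt_pair (hT' 1) hn
      (fun r _ _ x => hasDerivAt_translate hφ1 1 r x) hyd.snd.snd
    have e1 : ∀ f : L2, pair (shift t f) (deriv φ) = pair f fun x => deriv φ (x + -1 * t) := by
      intro f
      rw [pair_shift]
      simp [sub_eq_add_neg]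
    have e2 : ∀ f : L2, pair (shift (-t) f) (deriv φ) = pair f fun x => deriv φ (x + 1 * t) := by
      intro f
      rw [pair_shift]
      simp
    have e3 : ∀ f : L2, pair (shift (-t) f) (fun x => φ (x + -1 * t)) = pair f φ := by
      intro f
      rw [pair_shift]
      simp
    have e4 : ∀ f : L2, pair (shift t f) (fun x => φ (x + 1 * t)) = pair f φ := by
      intro f
      rw [pair_shift]
      simp
    have e5 : ∀ f : L2, (pair f fun _ => 0) = 0 := by simp [pair]
    refine (d1.add ((d2.sub d3).const_mul (1 / 2))).congr_deriv ?_
    simp only [field, pair_const_mul]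
    rw [pair_wave t _ hφ' hc.deriv, e1, e2, e3, e4, e5]
    ring
  have h1 := eq_of_hasDerivAt_zero hqc hqd t ht
  rw [hqs, hqs] at h1
  have h2 : pair (y 0).1 (deriv φ) = -pair (slope 0 (y 0)) φ := h0 φ hφ hc
  have h3 : pair (y t).1 (deriv φ) = -pair (slope t (y t)) φ := by linarith
  exact h3

theorem eq_phase {t : ℝ} {y : Phase} (h : IsWeakDeriv y.1 (slope t y)) :
    y = phase t (mkH1 y.1 (slope t y) h) (wave t y) := by
  have e1 : wave t y + slope t y = shift t y.2.1 := by
    rw [wave, slope, ← smul_add, add_add_sub_cancel, ← two_smul ℝ, smul_smul]; norm_num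
  have e2 : wave t y - slope t y = shift (-t) y.2.2 := by
    rw [wave, slope, ← smul_sub, add_sub_sub_cancel, ← two_smul ℝ, smul_smul]; norm_num
  have hw : weakDeriv (mkH1 y.1 (slope t y) h) = slope t y := rfl
  have ht : toL2 (mkH1 y.1 (slope t y) h) = y.1 := rfl
  rw [phase, hw, ht, e1, e2, shift_neg_shift, shift_shift_neg]

theorem IsFlow.exists_eq_phase {y : ℝ → Phase} (hy : IsFlow A p M T y) {u₀ : H1} {u₁ : L2}
    (h0 : y 0 = phase 0 u₀ u₁) :
    ∃ u : ℝ → H1, ∀ t ∈ Icc 0 T, y t = phase t (u t) (wave t (y t)) := by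
  classical
  have h1 : IsWeakDeriv (y 0).1 (slope 0 (y 0)) := by
    rw [h0, slope_phase]; exact u₀.2
  refine ⟨fun t => if h : IsWeakDeriv (y t).1 (slope t (y t)) then mkH1 _ _ h else 0,
    fun t ht => ?_⟩
  simp only [dif_pos (hy.isWeakDeriv h1 t ht)]
  exact eq_phase _

/-- Both `u` and its weak derivative are controlled by the phase norm, and `√2` is rounded up to
`2`. The factor `4` is the source of the truncation levels `4 * (B + 1)` used for states of norm at
most `B + 1`. -/
theorem ae_abs_phase_le (t : ℝ) (u : H1) (w : L2) :
    ∀ᵐ x, |toL2 u x| ≤ 4 * ‖phase t u w‖ := by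
  filter_upwards [ae_abs_le u] with x hx
  have h1 : ‖toL2 u‖ ≤ ‖phase t u w‖ := norm_fst_le (phase t u w)
  have h2 : ‖weakDeriv u‖ ≤ ‖phase t u w‖ := by
    have := norm_slope_le t (phase t u w)
    rwa [slope_phase] at this
  have h3 : (2 : ℝ) ^ (1 / 2 : ℝ) ≤ 2 := by
    calc (2 : ℝ) ^ (1 / 2 : ℝ) ≤ 2 ^ (1 : ℝ) :=
          Real.rpow_le_rpow_of_exponent_le (by norm_num) (by norm_num)
      _ = 2 := Real.rpow_one 2
  calc |toL2 u x| ≤ (2 : ℝ) ^ (1 / 2 : ℝ) * (‖toL2 u‖ + ‖weakDeriv u‖) := hx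
    _ ≤ 2 * (‖phase t u w‖ + ‖phase t u w‖) := by gcongr
    _ = _ := by ring

end constraint

/-! ### Partial derivatives on `[0, T) × ℝ` -/

section calculus

variable {T : EReal} {f : ℝ → ℝ → ℝ}

theorem timeInterval_mem_nhdsWithin {t : ℝ} (ht : t ∈ timeInterval T) :
    timeInterval T ∈ 𝓝[Ici 0] t := by
  have h : {s : ℝ | (s : EReal) < T} ∈ 𝓝 t :=
    (isOpen_Iio.preimage continuous_coe_real_ereal).mem_nhds ht.2
  filter_upwards [self_mem_nhdsWithin, mem_nhdsWithin_of_mem_nhds h] with s h1 h2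
  exact ⟨h1, h2⟩

theorem timeInterval_mem_nhds {t : ℝ} (ht : t ∈ timeInterval T) (h0 : 0 < t) :
    timeInterval T ∈ 𝓝 t := by
  have := timeInterval_mem_nhdsWithin ht
  rwa [nhdsWithin_eq_nhds.2 (Ici_mem_nhds h0)] at this

theorem timeInterval_subset : timeInterval T ⊆ Ici 0 := fun _ ht => ht.1

theorem timeInterval_coe (T : ℝ) : timeInterval (T : EReal) = Ico 0 T := by
  ext t
  simp [timeInterval]

theorem timeInterval_top : timeInterval ⊤ = Ici 0 := by
  ext t
  simp [timeInterval, EReal.coe_lt_top]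

theorem measurableSet_timeInterval : MeasurableSet (timeInterval T) :=
  measurableSet_Ici.inter (measurable_coe_real_ereal measurableSet_Iio)

theorem Icc_subset_timeInterval {b : ℝ} (hb : b ∈ timeInterval T) :
    Icc 0 b ⊆ timeInterval T := fun _ ht =>
  ⟨ht.1, (EReal.coe_le_coe_iff.2 ht.2).trans_lt hb.2⟩

theorem uniqueDiffOn_strip : UniqueDiffOn ℝ (timeInterval T ×ˢ (univ : Set ℝ)) := by
  refine UniqueDiffOn.prod (fun t ht => ?_) uniqueDiffOn_univ
  exact (uniqueDiffOn_Ici 0 t ht.1).mono_nhds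
    (nhdsWithin_le_of_mem (timeInterval_mem_nhdsWithin ht))

theorem hasDerivWithinAt_dt_aux {t x : ℝ} (ht : t ∈ timeInterval T)
    {L : ℝ × ℝ →L[ℝ] ℝ} (h : HasFDerivWithinAt (fun z : ℝ × ℝ => f z.1 z.2) L
      (timeInterval T ×ˢ univ) (t, x)) :
    HasDerivWithinAt (fun s => f s x) (L (1, 0)) (Ici 0) t := by
  have h1 : HasDerivWithinAt (fun s : ℝ => (s, x)) (1, 0) (timeInterval T) t :=
    (hasDerivWithinAt_id t _).prodMk (hasDerivWithinAt_const t _ x)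
  have h2 := HasFDerivWithinAt.comp_hasDerivWithinAt (f := fun s : ℝ => (s, x)) t h h1
    fun s hs => ⟨hs, mem_univ _⟩
  exact h2.mono_of_mem_nhdsWithin (timeInterval_mem_nhdsWithin ht)

theorem hasDerivAt_dx_aux {t x : ℝ} (ht : t ∈ timeInterval T)
    {L : ℝ × ℝ →L[ℝ] ℝ} (h : HasFDerivWithinAt (fun z : ℝ × ℝ => f z.1 z.2) L
      (timeInterval T ×ˢ univ) (t, x)) :
    HasDerivAt (fun y => f t y) (L (0, 1)) x := by
  have h1 : HasDerivWithinAt (fun y : ℝ => (t, y)) (0, 1) univ x :=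
    (hasDerivWithinAt_const x _ t).prodMk (hasDerivWithinAt_id x _)
  exact (h.comp_hasDerivWithinAt x h1 fun y _ => ⟨ht, mem_univ _⟩).hasDerivAt univ_mem

theorem dt_eq_of_hasFDerivWithinAt {t x : ℝ} (ht : t ∈ timeInterval T)
    {L : ℝ × ℝ →L[ℝ] ℝ} (h : HasFDerivWithinAt (fun z : ℝ × ℝ => f z.1 z.2) L
      (timeInterval T ×ˢ univ) (t, x)) : dt f t x = L (1, 0) :=
  (hasDerivWithinAt_dt_aux ht h).derivWithin (uniqueDiffOn_Ici 0 t ht.1)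

theorem dx_eq_of_hasFDerivWithinAt {t x : ℝ} (ht : t ∈ timeInterval T)
    {L : ℝ × ℝ →L[ℝ] ℝ} (h : HasFDerivWithinAt (fun z : ℝ × ℝ => f z.1 z.2) L
      (timeInterval T ×ˢ univ) (t, x)) : dx f t x = L (0, 1) :=
  (hasDerivAt_dx_aux ht h).deriv

/-- `f` is of class `C^n` on `[0, T) × ℝ`. -/
def IsSmooth (T : EReal) (n : WithTop ℕ∞) (f : ℝ → ℝ → ℝ) : Prop :=
  ContDiffOn ℝ n (fun z : ℝ × ℝ => f z.1 z.2) (timeInterval T ×ˢ univ)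

namespace IsSmooth

variable {n : WithTop ℕ∞}

theorem of_isC2 (h : IsC2 f) : IsSmooth T 2 f :=
  ContDiffOn.mono h (prod_mono timeInterval_subset subset_rfl)

theorem hasFDerivWithinAt (h : IsSmooth T 1 f) {t : ℝ} (ht : t ∈ timeInterval T) (x : ℝ) :
    HasFDerivWithinAt (fun z : ℝ × ℝ => f z.1 z.2)
      (fderivWithin ℝ (fun z : ℝ × ℝ => f z.1 z.2) (timeInterval T ×ˢ univ) (t, x))
      (timeInterval T ×ˢ univ) (t, x) :=
  (ContDiffOn.differentiableOn h one_ne_zero (t, x) ⟨ht, mem_univ _⟩).hasFDerivWithinAt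

theorem hasDerivWithinAt_dt (h : IsSmooth T 1 f) {t : ℝ} (ht : t ∈ timeInterval T) (x : ℝ) :
    HasDerivWithinAt (fun s => f s x) (dt f t x) (Ici 0) t := by
  rw [dt_eq_of_hasFDerivWithinAt ht (h.hasFDerivWithinAt ht x)]
  exact hasDerivWithinAt_dt_aux ht (h.hasFDerivWithinAt ht x)

theorem hasDerivAt_dt (h : IsSmooth T 1 f) {t : ℝ} (ht : t ∈ timeInterval T) (h0 : 0 < t)
    (x : ℝ) : HasDerivAt (fun s => f s x) (dt f t x) t :=
  (h.hasDerivWithinAt_dt ht x).hasDerivAt (Ici_mem_nhds h0)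

theorem hasDerivAt_dx (h : IsSmooth T 1 f) {t : ℝ} (ht : t ∈ timeInterval T) (x : ℝ) :
    HasDerivAt (fun y => f t y) (dx f t x) x := by
  rw [dx_eq_of_hasFDerivWithinAt ht (h.hasFDerivWithinAt ht x)]
  exact hasDerivAt_dx_aux ht (h.hasFDerivWithinAt ht x)

/-- The case `σ = ±1` differentiates along a characteristic and supplies the time derivative of a
translated test function. -/
theorem hasDerivAt_line (h : IsSmooth T 1 f) {t : ℝ} (ht : t ∈ timeInterval T) (h0 : 0 < t)
    (σ x : ℝ) : HasDerivAt (fun s => f s (x + σ * s))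
      (dt f t (x + σ * t) + σ * dx f t (x + σ * t)) t := by
  have hF := h.hasFDerivWithinAt ht (x + σ * t)
  rw [dt_eq_of_hasFDerivWithinAt ht hF, dx_eq_of_hasFDerivWithinAt ht hF]
  have hF' := hF.hasFDerivAt (prod_mem_nhds (timeInterval_mem_nhds ht h0) univ_mem)
  have h1 : HasDerivAt (fun s : ℝ => (s, x + σ * s)) (1, σ) t := by
    have h2 : HasDerivAt (fun s => x + σ * s) σ t := by
      simpa using ((hasDerivAt_id t).const_mul σ).const_add x
    exact (hasDerivAt_id t).prodMk h2
  have h3 := HasFDerivAt.comp_hasDerivAt (f := fun s : ℝ => (s, x + σ * s)) t hF' h1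
  refine h3.congr_deriv ?_
  rw [show ((1 : ℝ), σ) = (1, 0) + σ • ((0 : ℝ), (1 : ℝ)) by simp, map_add, map_smul, smul_eq_mul]

theorem dt (h : IsSmooth T (n + 1) f) : IsSmooth T n (dt f) := by
  have h1 := ContDiffOn.fderivWithin h uniqueDiffOn_strip le_rfl
  have h2 := h1.clm_apply (contDiffOn_const (c := ((1 : ℝ), (0 : ℝ))))
  have h3 : IsSmooth T 1 f := ContDiffOn.of_le h (by simp)
  exact h2.congr fun z hz => dt_eq_of_hasFDerivWithinAt hz.1 (h3.hasFDerivWithinAt hz.1 z.2)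

theorem dx (h : IsSmooth T (n + 1) f) : IsSmooth T n (dx f) := by
  have h1 := ContDiffOn.fderivWithin h uniqueDiffOn_strip le_rfl
  have h2 := h1.clm_apply (contDiffOn_const (c := ((0 : ℝ), (1 : ℝ))))
  have h3 : IsSmooth T 1 f := ContDiffOn.of_le h (by simp)
  exact h2.congr fun z hz => dx_eq_of_hasFDerivWithinAt hz.1 (h3.hasFDerivWithinAt hz.1 z.2)

theorem dt_one (h : IsSmooth T 2 f) : IsSmooth T 1 (DampedWave.dt f) :=
  IsSmooth.dt (n := 1) (by simpa [one_add_one_eq_two] using h)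

theorem dx_one (h : IsSmooth T 2 f) : IsSmooth T 1 (DampedWave.dx f) :=
  IsSmooth.dx (n := 1) (by simpa [one_add_one_eq_two] using h)

theorem dt_zero (h : IsSmooth T 1 f) : IsSmooth T 0 (DampedWave.dt f) :=
  IsSmooth.dt (n := 0) (by simpa using h)

theorem dx_zero (h : IsSmooth T 1 f) : IsSmooth T 0 (DampedWave.dx f) :=
  IsSmooth.dx (n := 0) (by simpa using h)

theorem of_le {m : WithTop ℕ∞} (h : IsSmooth T n f) (hm : m ≤ n) : IsSmooth T m f :=
  ContDiffOn.of_le h hm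

theorem one (h : IsSmooth T 2 f) : IsSmooth T 1 f := h.of_le (by norm_num)

theorem mul {g : ℝ → ℝ → ℝ} (h : IsSmooth T n f) (hg : IsSmooth T n g) :
    IsSmooth T n fun t x => f t x * g t x := ContDiffOn.mul h hg

theorem continuousOn (h : IsSmooth T n f) :
    ContinuousOn (fun z : ℝ × ℝ => f z.1 z.2) (timeInterval T ×ˢ univ) :=
  ContDiffOn.continuousOn h

end IsSmooth

/-- `f` vanishes on `[0, T) × ℝ` outside `[0, b] × [-B, B]`. -/
def VanishesOff (T : EReal) (b B : ℝ) (f : ℝ → ℝ → ℝ) : Prop :=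
  ∀ t ∈ timeInterval T, ∀ x, b < t ∨ x ∉ Icc (-B) B → f t x = 0

namespace VanishesOff

variable {b B : ℝ}

theorem dt (h : VanishesOff T b B f) : VanishesOff T b B (dt f) := by
  intro t ht x hx
  have h1 : (fun s => f s x) =ᶠ[𝓝[Ici 0] t] fun _ => 0 := by
    rcases hx with hx | hx
    · filter_upwards [timeInterval_mem_nhdsWithin ht,
        mem_nhdsWithin_of_mem_nhds (Ioi_mem_nhds hx)] with s h1 h2
      exact h s h1 x (Or.inl h2)
    · filter_upwards [timeInterval_mem_nhdsWithin ht] with s h1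
      exact h s h1 x (Or.inr hx)
  rw [DampedWave.dt, h1.derivWithin_eq (h t ht x hx)]
  simp

theorem dx (h : VanishesOff T b B f) : VanishesOff T b B (dx f) := by
  intro t ht x hx
  have h1 : (fun y => f t y) =ᶠ[𝓝 x] fun _ => 0 := by
    rcases hx with hx | hx
    · exact Eventually.of_forall fun y => h t ht y (Or.inl hx)
    · filter_upwards [isClosed_Icc.isOpen_compl.mem_nhds hx] with y hy
      exact h t ht y (Or.inr hy)
  rw [DampedWave.dx, h1.deriv_eq]
  simp

theorem mul_left (h : VanishesOff T b B f) (g : ℝ → ℝ → ℝ) :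
    VanishesOff T b B fun t x => g t x * f t x := fun t ht x hx => by
  simp only [h t ht x hx, mul_zero]

theorem isTestCurve (h : VanishesOff T b B f) {n : WithTop ℕ∞} (hf : IsSmooth T n f) :
    IsTestCurve (timeInterval T) f :=
  ⟨hf.continuousOn, B, fun t ht x hx => h t ht x (Or.inr hx)⟩

theorem isTestCurve_translate (h : VanishesOff T b B f) {n : WithTop ℕ∞} (hf : IsSmooth T n f)
    {c : ℝ} (hc : c ∈ timeInterval T) (σ : ℝ) :
    IsTestCurve (Icc 0 c) fun t x => f t (x + σ * t) := by
  have hmap : ContinuousOn (fun z : ℝ × ℝ => (z.1, z.2 + σ * z.1)) (Icc 0 c ×ˢ univ) := by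
    fun_prop
  refine ⟨hf.continuousOn.comp hmap fun z hz => ⟨Icc_subset_timeInterval hc hz.1, mem_univ _⟩,
    B + |σ| * c, fun t ht x hx => h t (Icc_subset_timeInterval hc ht) _ (Or.inr fun hx' => hx ?_)⟩
  have h1 : |σ * t| ≤ |σ| * c := by
    rw [abs_mul, abs_of_nonneg ht.1]
    exact mul_le_mul_of_nonneg_left ht.2 (abs_nonneg _)
  rw [abs_le] at h1
  exact ⟨by linarith [hx'.1, hx'.2], by linarith [hx'.1, hx'.2]⟩

end VanishesOff

/-- A compact subset of `[0, T) × ℝ` has a greatest time, which is still smaller than `T`, and a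
bounded space projection. -/
theorem IsTestFunction.exists_vanishesOff {ψ : ℝ → ℝ → ℝ} (hT : 0 < T)
    (h : IsTestFunction T ψ) : ∃ b ∈ timeInterval T, ∃ B, VanishesOff T b B ψ := by
  obtain ⟨-, K, hK, hKs, hK0⟩ := h
  have h0 : (0 : ℝ) ∈ timeInterval T := ⟨le_rfl, by simpa using hT⟩
  rcases K.eq_empty_or_nonempty with rfl | hne
  · exact ⟨0, h0, 0, fun t ht x _ => hK0 t ht x (by simp)⟩
  obtain ⟨b, ⟨z, hz, rfl⟩, hb⟩ := (hK.image continuous_fst).exists_isGreatest (hne.image _)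
  obtain ⟨B, hB⟩ := (hK.image continuous_snd).isBounded.subset_closedBall 0
  refine ⟨z.1, (hKs hz).1, B, fun t ht x hx => hK0 t ht x fun hmem => ?_⟩
  rcases hx with hx | hx
  · exact hx.not_ge (hb ⟨_, hmem, rfl⟩)
  · have := hB ⟨_, hmem, rfl⟩
    rw [Real.closedBall_eq_Icc] at this
    exact hx (by simpa using this)

theorem exists_between_timeInterval {b : ℝ} (hb : b ∈ timeInterval T) :
    ∃ c ∈ timeInterval T, b < c := by
  obtain ⟨c, h1, h2⟩ := EReal.lt_iff_exists_real_btwn.1 hb.2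
  have h1' : b < c := EReal.coe_lt_coe_iff.1 h1
  exact ⟨c, ⟨hb.1.trans h1'.le, h2⟩, h1'⟩

theorem setIntegral_timeInterval_eq {b c : ℝ} (hc : c ∈ timeInterval T) (hbc : b < c)
    {q : ℝ → ℝ} (hq : ∀ t ∈ timeInterval T, b < t → q t = 0) :
    ∫ t in timeInterval T, q t = ∫ t in (0 : ℝ)..c, q t := by
  rw [intervalIntegral.integral_of_le hc.1, ← integral_Icc_eq_integral_Ioc]
  refine (setIntegral_eq_of_subset_of_forall_sdiff_eq_zero measurableSet_timeInterval
    (Icc_subset_timeInterval hc) fun t ht => hq t ht.1 ?_)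
  by_contra hle
  exact ht.2 ⟨ht.1.1, (not_lt.1 hle).trans hbc.le⟩

end calculus

/-! ### The weak derivative against `C¹` test functions -/

theorem pair_integral {f : ℝ → L2} {a b : ℝ} (hf : IntervalIntegrable f volume a b) {φ : ℝ → ℝ}
    (h : MemLp φ 2 (volume : Measure ℝ)) :
    pair (∫ s in a..b, f s) φ = ∫ s in a..b, pair (f s) φ := by
  simp only [pair_eq_inner _ h, real_inner_comm (lp φ)]
  exact ((innerSL ℝ (lp φ)).intervalIntegral_comp_comm hf).symm

/-- After pairing with `φ`, the derivative in `s` of `S(s) w` falls on the translated `φ`, and the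
definition of the weak derivative brings it back as `S(s) w'`. -/
theorem shift_sub_eq_integral (w : H1) (τ : ℝ) :
    shift τ (toL2 w) - toL2 w = ∫ s in (0 : ℝ)..τ, shift s (weakDeriv w) := by
  have hc : Continuous fun s => shift s (weakDeriv w) :=
    continuous_shift_uncurry.comp (continuous_id.prodMk continuous_const)
  refine eq_of_pair fun φ hφ hφc => ?_
  have hφ1 : ContDiff ℝ 1 φ := hφ.of_le (by exact_mod_cast le_top)
  have hφ' : Continuous (deriv φ) := hφ.continuous_deriv (by simp)
  have hm := memLp_two_of_compactSupport hφ.continuous hφc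
  rw [pair_integral (hc.intervalIntegrable _ _) hm, pair_sub _ _ hm]
  have hd : ∀ s, HasDerivAt (fun s => pair (shift s (toL2 w)) φ)
      (pair (shift s (weakDeriv w)) φ) s := by
    intro s
    have hT := fun R => isTestCurve_translate hφ.continuous hφc (-1) R
    have hT' := fun R => (isTestCurve_translate hφ' hφc.deriv (-1) R).mul_left
      (b := fun _ _ => -1) continuousOn_const
    have hn : Icc (-(|s| + 1)) (|s| + 1) ∈ 𝓝 s :=
      Icc_mem_nhds (by linarith [neg_abs_le s]) (by linarith [le_abs_self s])
    have h1 := (hT (|s| + 1)).hasDerivAt_pair (hT' (|s| + 1)) hn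
      (fun r _ _ x => hasDerivAt_translate hφ1 (-1) r x) (hasDerivAt_const s (toL2 w))
    have h2 : ∀ s, pair (shift s (toL2 w)) φ = pair (toL2 w) fun x => φ (x + -1 * s) := by
      intro s
      rw [pair_shift]
      simp [sub_eq_add_neg]
    simp only [h2]
    refine h1.congr_deriv ?_
    have h3 : pair (toL2 w) (deriv fun x => φ (x - s)) =
        -pair (weakDeriv w) fun x => φ (x - s) :=
      pair_weakDeriv w (hφ.comp (contDiff_id.sub contDiff_const))
        (hφc.comp_homeomorph (Homeomorph.subRight s))
    have h4 : (deriv fun x => φ (x - s)) = fun x => deriv φ (x - s) :=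
      funext fun x => deriv_comp_sub_const (f := φ) s x
    rw [h4] at h3
    have h5 : pair (0 : L2) (fun x => φ (x + -1 * s)) = 0 := integral_zero_mul _
    rw [pair_const_mul, h5, pair_shift]
    simp only [neg_mul, one_mul, ← sub_eq_add_neg, h3]
    ring
  rw [intervalIntegral.integral_eq_sub_of_hasDerivAt (fun s _ => hd s)]
  · simp
  · refine Continuous.intervalIntegrable ?_ _ _
    simp only [pair_eq_inner _ hm]
    exact hc.inner continuous_const

theorem hasDerivAt_shift (w : H1) : HasDerivAt (fun τ => shift τ (toL2 w)) (weakDeriv w) 0 := by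
  have hc : Continuous fun s => shift s (weakDeriv w) :=
    continuous_shift_uncurry.comp (continuous_id.prodMk continuous_const)
  have h1 := (intervalIntegral.integral_hasDerivAt_right (a := 0) (b := 0)
    (hc.intervalIntegrable _ _) hc.aestronglyMeasurable.stronglyMeasurableAtFilter
    hc.continuousAt).const_add (toL2 w)
  simp only [← shift_sub_eq_integral, add_sub_cancel, shift_zero] at h1
  exact h1

/-- Differentiate `⟨S(τ) w, φ⟩` at `τ = 0` in two ways: in `L²`, where the translation group has
derivative `w'`, and on `φ`. This avoids mollifying `φ`. It is needed because space derivatives of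
`C²` test functions are only `C¹`. -/
theorem pair_weakDeriv_of_contDiff_one (w : H1) {φ : ℝ → ℝ} (h : ContDiff ℝ 1 φ)
    (hc : HasCompactSupport φ) : pair (toL2 w) (deriv φ) = -pair (weakDeriv w) φ := by
  have hm := memLp_two_of_compactSupport h.continuous hc
  have hφ' : Continuous (deriv φ) := h.continuous_deriv le_rfl
  have h1 : HasDerivAt (fun τ => pair (shift τ (toL2 w)) φ) (pair (weakDeriv w) φ) 0 := by
    simp only [pair_eq_inner _ hm]
    simpa using (hasDerivAt_shift w).inner ℝ (hasDerivAt_const 0 (lp φ))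
  have hT := isTestCurve_translate h.continuous hc (-1) 1
  have hT' := (isTestCurve_translate hφ' hc.deriv (-1) 1).mul_left
    (b := fun _ _ => -1) continuousOn_const
  have h2 := hT.hasDerivAt_pair hT' (t := 0) (Icc_mem_nhds (by norm_num) (by norm_num))
    (fun r _ _ x => hasDerivAt_translate h (-1) r x) (hasDerivAt_const 0 (toL2 w))
  have h3 : ∀ s, pair (shift s (toL2 w)) φ = pair (toL2 w) fun x => φ (x + -1 * s) := by
    intro s
    rw [pair_shift]
    simp [sub_eq_add_neg]
  simp only [h3] at h1
  have h4 := h1.unique h2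
  have h5 : pair (0 : L2) (fun x => φ (x + -1 * 0)) = 0 := integral_zero_mul _
  rw [pair_const_mul, h5] at h4
  simp only [mul_zero, add_zero] at h4
  linarith

/-! ### Mild solutions are weak solutions -/

/-- The coefficient `a`, extended to negative times by its initial value. -/
def freeze (a : ℝ → ℝ → ℝ) (t x : ℝ) : ℝ := a (max t 0) x

theorem freeze_of_nonneg (a : ℝ → ℝ → ℝ) {t : ℝ} (ht : 0 ≤ t) : freeze a t = a t := by
  funext x
  rw [freeze, max_eq_left ht]

theorem continuous_freeze {a : ℝ → ℝ → ℝ}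
    (h : ContinuousOn (fun z : ℝ × ℝ => a z.1 z.2) (Ici 0 ×ˢ univ)) :
    Continuous fun z : ℝ × ℝ => freeze a z.1 z.2 :=
  h.comp_continuous (f := fun z : ℝ × ℝ => (max z.1 0, z.2)) (by fun_prop)
    fun z => ⟨le_max_right z.1 0, mem_univ _⟩

theorem div_one_add_rpow_le {δ q t : ℝ} (hδ : 0 ≤ δ) (hq : 0 ≤ q) (ht : 0 ≤ t) :
    δ / (1 + t) ^ q ≤ δ :=
  div_le_self hδ (Real.one_le_rpow (by linarith) hq)

/-- The bound on `a_t` gives the Lipschitz constant by the mean value inequality, and `t ↦ max t 0`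
does not increase distances. -/
theorem IsDamping.isCoeff {k δ : ℝ} {a : ℝ → ℝ → ℝ} (hk : 0 ≤ k) (hδ : 0 ≤ δ)
    (h : IsDamping k δ a) : IsCoeff (freeze a) δ.toNNReal := by
  have hsm : IsSmooth ⊤ 1 a := (IsSmooth.of_isC2 h.contDiff).one
  refine ⟨continuous_freeze h.contDiff.continuousOn, fun t x => ?_, fun s t x => ?_⟩
  · rw [Real.coe_toNNReal _ hδ]
    exact (h.bound _ (le_max_right _ _) x).trans (div_one_add_rpow_le hδ hk (le_max_right _ _))
  · rw [Real.coe_toNNReal _ hδ]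
    have h1 := (convex_Ici (0 : ℝ)).norm_image_sub_le_of_norm_hasDerivWithin_le
      (f := fun s => a s x) (f' := fun s => dt a s x) (C := δ)
      (fun r hr => hsm.hasDerivWithinAt_dt (by rwa [timeInterval_top]) x)
      (fun r hr => (h.bound_dt r hr x).trans (div_one_add_rpow_le hδ (by linarith) hr))
      (le_max_right t 0) (le_max_right s 0)
    refine h1.trans (mul_le_mul_of_nonneg_left ?_ hδ)
    simpa using abs_max_sub_max_le_abs s t 0

/-- Mild solutions on `[0, T]`, bounded by `M`, of the damped wave equation. -/
structure IsMild (A : ℝ → ℝ → ℝ) (p M T : ℝ) (u₀ : H1) (u₁ : L2) (u : ℝ → H1) (w : ℝ → L2) :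
    Prop where
  flow : IsFlow A p M T fun t => phase t (u t) (w t)
  initial : u 0 = u₀
  init_velocity : w 0 = u₁
  bound : ∀ t ∈ Icc 0 T, ∀ᵐ x, |toL2 (u t) x| ≤ M

namespace IsMild

variable {A a : ℝ → ℝ → ℝ} {p M T : ℝ} {u₀ : H1} {u₁ : L2} {u : ℝ → H1} {w : ℝ → L2} {C : ℝ≥0}

theorem mono (h : IsMild A p M T u₀ u₁ u w) {T' : ℝ} (hT : T' ≤ T) :
    IsMild A p M T' u₀ u₁ u w :=
  ⟨h.flow.mono hT, h.initial, h.init_velocity, fun t ht => h.bound t ⟨ht.1, ht.2.trans hT⟩⟩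

theorem hasDerivWithinAt (h : IsMild A p M T u₀ u₁ u w) {t : ℝ} (ht : t ∈ Icc 0 T) :
    HasDerivWithinAt (fun t => toL2 (u t)) (w t) (Icc 0 T) t := by
  have h1 : HasDerivWithinAt (fun t => (phase t (u t) (w t)).1)
      (field A p M t (phase t (u t) (w t))).1 (Icc 0 T) t :=
    (ContinuousLinearMap.fst ℝ L2 (L2 × L2)).hasFDerivAt.comp_hasDerivWithinAt t (h.flow t ht)
  exact h1.congr_deriv (wave_phase t (u t) (w t))

theorem continuousOn_velocity (h : IsMild A p M T u₀ u₁ u w) : ContinuousOn w (Icc 0 T) :=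
  (continuousOn_wave h.flow.continuousOn).congr fun t _ => (wave_phase t (u t) (w t)).symm

theorem continuousOn (h : IsMild A p M T u₀ u₁ u w) : ContinuousOn u (Icc 0 T) :=
  continuousOn_H1_iff.2 ⟨h.flow.continuousOn.fst,
    (continuousOn_slope h.flow.continuousOn).congr fun t _ => (slope_phase t (u t) (w t)).symm⟩

/-- The velocity itself need not be differentiable in `L²`. Its pairing is, once written as half the
sum of the pairings of the two travelling coordinates with `ψ` transported along the opposite
characteristics. -/
theorem hasDerivAt_pair_velocity (h : IsMild A p M T u₀ u₁ u w) {S : EReal} {b B : ℝ}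
    {ψ : ℝ → ℝ → ℝ} (hψ : IsSmooth S 1 ψ) (hv : VanishesOff S b B ψ) (hT : T ∈ timeInterval S)
    {t : ℝ} (ht : t ∈ Ioo 0 T) :
    HasDerivAt (fun t => pair (w t) (ψ t)) (pair (w t) (dt ψ t) - pair (weakDeriv (u t)) (dx ψ t) +
      pair (force A p M t (phase t (u t) (w t))) (ψ t)) t := by
  set z : ℝ → Phase := fun t => phase t (u t) (w t) with hz
  have hS := Icc_subset_timeInterval hT
  have htc : t ∈ Icc 0 T := Ioo_subset_Icc_self ht
  have hn : Icc 0 T ∈ 𝓝 t := Icc_mem_nhds ht.1 ht.2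
  have hc := hv.isTestCurve hψ
  have hct := hv.dt.isTestCurve hψ.dt_zero
  have hcx := hv.dx.isTestCurve hψ.dx_zero
  have hzd := (h.flow t htc).hasDerivAt hn
  have hline : ∀ σ, ∀ r ∈ Icc 0 T, Icc 0 T ∈ 𝓝 r → ∀ x,
      HasDerivAt (fun q => ψ q (x + σ * q))
        (dt ψ r (x + σ * r) + σ * dx ψ r (x + σ * r)) r := by
    intro σ r hr hnr x
    have h0 : 0 < r := by
      have : r ∈ interior (Icc 0 T) := mem_interior_iff_mem_nhds.2 hnr
      rw [interior_Icc] at this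
      exact this.1
    exact hψ.hasDerivAt_line (hS hr) h0 σ x
  have hT1 := fun σ => hv.isTestCurve_translate hψ hT σ
  have hT2 : ∀ σ, IsTestCurve (Icc 0 T) fun t x =>
      dt ψ t (x + σ * t) + σ * dx ψ t (x + σ * t) := fun σ =>
    (hv.dt.isTestCurve_translate hψ.dt_zero hT σ).add
      ((hv.dx.isTestCurve_translate hψ.dx_zero hT σ).mul_left continuousOn_const)
  have d1 := (hT1 (-1)).hasDerivAt_pair (hT2 (-1)) hn (hline (-1)) hzd.snd.fst
  have d2 := (hT1 1).hasDerivAt_pair (hT2 1) hn (hline 1) hzd.snd.snd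
  have e1 : ∀ (τ : ℝ) (f : L2) (φ : ℝ → ℝ),
      (pair f fun x => φ (x + -1 * τ)) = pair (shift τ f) φ := by
    intro τ f φ
    rw [pair_shift]
    simp [sub_eq_add_neg]
  have e2 : ∀ (τ : ℝ) (f : L2) (φ : ℝ → ℝ),
      (pair f fun x => φ (x + 1 * τ)) = pair (shift (-τ) f) φ := by
    intro τ f φ
    rw [pair_shift]
    simp
  have hw : ∀ r ∈ Icc 0 T, pair (w r) (ψ r) = 1 / 2 *
      ((pair (z r).2.1 fun x => ψ r (x + -1 * r)) + pair (z r).2.2 fun x => ψ r (x + 1 * r)) := by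
    intro r hr
    rw [e1, e2, ← pair_wave r (z r) (hc.continuous (hS hr)) (hc.hasCompactSupport (hS hr)),
      hz, wave_phase]
  refine (((d1.add d2).const_mul (1 / 2)).congr_of_eventuallyEq
    (by filter_upwards [hn] with r hr using hw r hr)).congr_deriv ?_
  have hmt := hct.memLp (hS htc)
  have hmx := hcx.memLp (hS htc)
  rw [e1 t _ (fun y => dt ψ t y + -1 * dx ψ t y), e2 t _ (fun y => dt ψ t y + 1 * dx ψ t y),
    e1 t, e2 t, pair_add_right _ hmt (hmx.const_mul _), pair_add_right _ hmt (hmx.const_mul _),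
    pair_const_mul, pair_const_mul]
  have e3 := pair_wave t (z t) (hct.continuous (hS htc)) (hct.hasCompactSupport (hS htc))
  have e4 := pair_slope t (z t) (hcx.continuous (hS htc)) (hcx.hasCompactSupport (hS htc))
  rw [hz, wave_phase] at e3
  rw [hz, slope_phase] at e4
  rw [e3, e4]
  simp only [field, shift_shift_neg, shift_neg_shift]
  ring

/-- The fundamental theorem of calculus for the functional `I` below, whose derivative is the
difference of the two integrands in the weak formulation. -/
theorem integral_identity (h : IsMild (freeze a) p M T u₀ u₁ u w) (hA : IsCoeff (freeze a) C)
    (ha : IsC2 a) (hp : 1 < p) (hM : 0 ≤ M) {S : EReal} {b B : ℝ} {ψ : ℝ → ℝ → ℝ}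
    (hψ : IsSmooth S 2 ψ) (hv : VanishesOff S b B ψ) (hT : T ∈ timeInterval S) (hb : b < T) :
    ∫ t in (0 : ℝ)..T, ∫ x, toL2 (u t) x *
        (dt (dt ψ) t x - dx (dx ψ) t x - dt (fun s y => a s y * ψ s y) t x) =
      (∫ x, ((a 0 x * toL2 u₀ x + u₁ x) * ψ 0 x - toL2 u₀ x * dt ψ 0 x)) +
        ∫ t in (0 : ℝ)..T, ∫ x, |toL2 (u t) x| ^ p * ψ t x := by
  have hS := Icc_subset_timeInterval hT
  have hT0 : 0 ≤ T := hT.1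
  have haψ : IsSmooth S 2 fun t x => a t x * ψ t x := (IsSmooth.of_isC2 ha).mul hψ
  have hav : VanishesOff S b B fun t x => a t x * ψ t x := hv.mul_left a
  have c0 := (hv.isTestCurve hψ).mono hS
  have c1 := (hv.dt.isTestCurve hψ.dt_one).mono hS
  have c2 := (hv.dt.dt.isTestCurve hψ.dt_one.dt_zero).mono hS
  have c3 := (hv.dx.isTestCurve hψ.dx_one).mono hS
  have c4 := (hv.dx.dx.isTestCurve hψ.dx_one.dx_zero).mono hS
  have c5 := (hav.isTestCurve haψ).mono hS
  have c6 := (hav.dt.isTestCurve haψ.one.dt_zero).mono hS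
  have hu : ContinuousOn (fun t => toL2 (u t)) (Icc 0 T) := fun t ht =>
    (h.hasDerivWithinAt ht).continuousWithinAt
  have hw := h.continuousOn_velocity
  have hN : ContinuousOn (fun t => nem p M (toL2 (u t))) (Icc 0 T) :=
    (lipschitzWith_nem hp hM).continuous.comp_continuousOn hu
  set L : ℝ → ℝ := fun t => pair (toL2 (u t)) (dt (dt ψ) t) - pair (toL2 (u t)) (dx (dx ψ) t) -
    pair (toL2 (u t)) (dt (fun s y => a s y * ψ s y) t) with hL
  set N : ℝ → ℝ := fun t => pair (nem p M (toL2 (u t))) (ψ t) with hNdef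
  -- These are the boundary terms of two integrations by parts in time: `I` vanishes at `T` with
  -- `ψ`, and `I 0` is the initial term of the weak formulation.
  set I : ℝ → ℝ := fun t => pair (w t) (ψ t) - pair (toL2 (u t)) (dt ψ t) +
    pair (toL2 (u t)) (fun x => a t x * ψ t x) with hI
  have hLc : ContinuousOn L (Icc 0 T) :=
    ((c2.continuousOn_pair hu).sub (c4.continuousOn_pair hu)).sub (c6.continuousOn_pair hu)
  have hNc : ContinuousOn N (Icc 0 T) := c0.continuousOn_pair hN
  have hIc : ContinuousOn I (Icc 0 T) :=
    ((c0.continuousOn_pair hw).sub (c1.continuousOn_pair hu)).add (c5.continuousOn_pair hu)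
  have hpos : ∀ r, Icc 0 T ∈ 𝓝 r → 0 < r := by
    intro r hnr
    have : r ∈ interior (Icc 0 T) := mem_interior_iff_mem_nhds.2 hnr
    rw [interior_Icc] at this
    exact this.1
  have hId : ∀ t ∈ Ioo 0 T, HasDerivAt I (N t - L t) t := by
    intro t ht
    have htc := Ioo_subset_Icc_self ht
    have hn : Icc 0 T ∈ 𝓝 t := Icc_mem_nhds ht.1 ht.2
    have hud := (h.hasDerivWithinAt htc).hasDerivAt hn
    have d1 := h.hasDerivAt_pair_velocity hψ.one hv hT ht
    have d2 := c1.hasDerivAt_pair c2 hn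
      (fun r hr hnr x => hψ.dt_one.hasDerivAt_dt (hS hr) (hpos r hnr) x) hud
    have d3 := c5.hasDerivAt_pair c6 hn
      (fun r hr hnr x => haψ.one.hasDerivAt_dt (hS hr) (hpos r hnr) x) hud
    refine ((d1.sub d2).add d3).congr_deriv ?_
    have e1 : pair (toL2 (u t)) (dx (dx ψ) t) = -pair (weakDeriv (u t)) (dx ψ t) := by
      refine pair_weakDeriv_of_contDiff_one (u t) (φ := dx ψ t) ?_ (c3.hasCompactSupport htc)
      exact contDiff_one_iff_deriv.2 ⟨fun x => (hψ.dx_one.hasDerivAt_dx (hS htc) x).differentiableAt,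
        c4.continuous htc⟩
    have e2 : pair (force (freeze a) p M t (phase t (u t) (w t))) (ψ t) =
        N t - pair (w t) (fun x => a t x * ψ t x) := by
      rw [force, wave_phase, pair_sub _ _ (c0.memLp htc),
        pair_mulL (hA.continuous_apply t) (hA.bound t), freeze_of_nonneg a ht.1.le]
      rfl
    rw [e2]
    simp only [hL, e1]
    ring
  have hFTC := intervalIntegral.integral_eq_sub_of_hasDerivAt_of_le hT0 hIc hId
    ((hNc.sub hLc).intervalIntegrable_of_Icc hT0)
  rw [intervalIntegral.integral_sub (hNc.intervalIntegrable_of_Icc hT0)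
    (hLc.intervalIntegrable_of_Icc hT0)] at hFTC
  have hTm : T ∈ Icc 0 T := ⟨hT0, le_rfl⟩
  have h0m : (0 : ℝ) ∈ Icc 0 T := ⟨le_rfl, hT0⟩
  have hIT : I T = 0 := by
    have f1 : ψ T = fun _ => 0 := funext fun x => hv T hT x (Or.inl hb)
    have f2 : dt ψ T = fun _ => 0 := funext fun x => hv.dt T hT x (Or.inl hb)
    simp [hI, f1, f2, pair]
  have hI0 : I 0 = ∫ x, ((a 0 x * toL2 u₀ x + u₁ x) * ψ 0 x - toL2 u₀ x * dt ψ 0 x) := by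
    have i0 := integrable_mul_of_compactSupport u₁ (c0.continuous h0m) (c0.hasCompactSupport h0m)
    have i1 := integrable_mul_of_compactSupport (toL2 u₀) (c1.continuous h0m)
      (c1.hasCompactSupport h0m)
    have i5 := integrable_mul_of_compactSupport (toL2 u₀) (c5.continuous h0m)
      (c5.hasCompactSupport h0m)
    simp only [hI, h.initial, h.init_velocity, pair]
    have i01 : Integrable fun x => u₁ x * ψ 0 x - toL2 u₀ x * dt ψ 0 x := i0.sub i1
    rw [← integral_sub i0 i1, ← integral_add i01 i5]
    exact integral_congr_ae (Eventually.of_forall fun x => by ring)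
  have hl : ∫ t in (0 : ℝ)..T, ∫ x, toL2 (u t) x *
      (dt (dt ψ) t x - dx (dx ψ) t x - dt (fun s y => a s y * ψ s y) t x) =
      ∫ t in (0 : ℝ)..T, L t := by
    refine intervalIntegral.integral_congr fun t ht => ?_
    rw [uIcc_of_le hT0] at ht
    simp only [hL]
    rw [← pair_sub_right _ (c2.memLp ht) (c4.memLp ht)]
    have m1 : MemLp (fun x => dt (dt ψ) t x - dx (dx ψ) t x) 2 (volume : Measure ℝ) :=
      (c2.memLp ht).sub (c4.memLp ht)
    rw [← pair_sub_right _ m1 (c6.memLp ht)]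
    rfl
  have hr : ∫ t in (0 : ℝ)..T, ∫ x, |toL2 (u t) x| ^ p * ψ t x = ∫ t in (0 : ℝ)..T, N t := by
    refine intervalIntegral.integral_congr fun t ht => ?_
    rw [uIcc_of_le hT0] at ht
    exact (pair_nem hp hM (h.bound t ht) (ψ t)).symm
  rw [hl, hr, ← hI0]
  linarith

end IsMild

section

variable {a : ℝ → ℝ → ℝ} {p T : ℝ} {u₀ : H1} {u₁ : L2} {u : ℝ → H1} {w : ℝ → L2} {C : ℝ≥0}

/-- Mild solutions are weak solutions, with velocity the second component. -/
theorem isSolution_of_isMild (hA : IsCoeff (freeze a) C) (ha : IsC2 a) (hp : 1 < p) (hT : 0 < T)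
    (h : ∀ T' < T, 0 < T' → ∃ M, 0 ≤ M ∧ IsMild (freeze a) p M T' u₀ u₁ u w) :
    IsSolution a p u₀ u₁ (T : EReal) u ∧ ∀ t ∈ Ico 0 T, velocity u t = w t := by
  have hnear : ∀ t ∈ Ico 0 T, ∃ T' < T, 0 < T' ∧ t ∈ Ico 0 T' := by
    intro t ht
    exact ⟨(t + T) / 2, by linarith [ht.2], by linarith [ht.1], ht.1, by linarith [ht.2]⟩
  have hnh : ∀ t T' : ℝ, t ∈ Ico 0 T' → Icc 0 T' ∈ 𝓝[Ici 0] t := by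
    intro t T' ht
    filter_upwards [self_mem_nhdsWithin, mem_nhdsWithin_of_mem_nhds (Iic_mem_nhds ht.2)]
      with s h1 h2 using ⟨h1, h2⟩
  have hder : ∀ t ∈ Ico 0 T, HasDerivWithinAt (fun s => toL2 (u s)) (w t) (Ici 0) t := by
    intro t ht
    obtain ⟨T', h1, h2, h3⟩ := hnear t ht
    obtain ⟨M, -, hM⟩ := h T' h1 h2
    exact (hM.hasDerivWithinAt (Ico_subset_Icc_self h3)).mono_of_mem_nhdsWithin (hnh _ _ h3)
  have hcont : ∀ {X : Type} [TopologicalSpace X] (f : ℝ → X),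
      (∀ T' < T, 0 < T' → ContinuousOn f (Icc 0 T')) → ContinuousOn f (Ico 0 T) := by
    intro X _ f hf t ht
    obtain ⟨T', h1, h2, h3⟩ := hnear t ht
    exact ((hf T' h1 h2 t (Ico_subset_Icc_self h3)).mono_of_mem_nhdsWithin (hnh _ _ h3)).mono
      Ico_subset_Ici_self
  have hvel : ∀ t ∈ Ico 0 T, velocity u t = w t := fun t ht =>
    (hder t ht).derivWithin (uniqueDiffOn_Ici 0 t ht.1)
  refine ⟨⟨?_, ?_, ?_⟩, hvel⟩
  · rw [timeInterval_coe]
    refine hcont u fun T' h1 h2 => ?_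
    obtain ⟨M, -, hM⟩ := h T' h1 h2
    exact hM.continuousOn
  · rw [timeInterval_coe]
    have hw : ContinuousOn w (Ico 0 T) := by
      refine hcont w fun T' h1 h2 => ?_
      obtain ⟨M, -, hM⟩ := h T' h1 h2
      exact hM.continuousOn_velocity
    have hder' : ∀ t ∈ Ico 0 T, HasDerivWithinAt (fun s => toL2 (u s)) (w t) (Ico 0 T) t :=
      fun t ht => (hder t ht).mono Ico_subset_Ici_self
    rw [show (1 : WithTop ℕ∞) = 0 + 1 by simp,
      contDiffOn_succ_iff_derivWithin (uniqueDiffOn_Ico 0 T)]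
    refine ⟨fun t ht => (hder' t ht).differentiableWithinAt, by simp, contDiffOn_zero.2 ?_⟩
    exact hw.congr fun t ht => (hder' t ht).derivWithin (uniqueDiffOn_Ico 0 T t ht)
  · intro ψ hψ
    obtain ⟨b, hb, B, hv⟩ := hψ.exists_vanishesOff (by exact_mod_cast hT)
    obtain ⟨c, hc, hbc⟩ := exists_between_timeInterval hb
    have hc' : c < T := by
      rw [timeInterval_coe] at hc
      exact hc.2
    obtain ⟨M, hM0, hM⟩ := h c hc' (hb.1.trans_lt hbc)
    rw [setIntegral_timeInterval_eq hc hbc, setIntegral_timeInterval_eq hc hbc]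
    · exact hM.integral_identity hA ha hp hM0 hψ.1 hv hc hbc
    · intro t ht hbt
      simp [hv t ht _ (Or.inl hbt)]
    · intro t ht hbt
      simp [hv.dt.dt t ht _ (Or.inl hbt), hv.dx.dx t ht _ (Or.inl hbt),
        (hv.mul_left a).dt t ht _ (Or.inl hbt)]

end

/-! ### Weak solutions are mild solutions -/

theorem toL2_injective {v w : H1} (h : toL2 v = toL2 w) : v = w := by
  refine toL2_weakDeriv_injective h (eq_of_pair fun φ hφ hc => ?_)
  have h1 := pair_weakDeriv v hφ hc
  have h2 := pair_weakDeriv w hφ hc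
  rw [h] at h1
  linarith

theorem hasDerivWithinAt_integral {E : Type*} [NormedAddCommGroup E] [NormedSpace ℝ E]
    [CompleteSpace E] {f : ℝ → E} {c t : ℝ} (hf : ContinuousOn f (Icc 0 c)) (ht : t ∈ Icc 0 c) :
    HasDerivWithinAt (fun t => ∫ s in (0 : ℝ)..t, f s) (f t) (Icc 0 c) t := by
  have : Fact (t ∈ Icc 0 c) := ⟨ht⟩
  refine intervalIntegral.integral_hasDerivWithinAt_right (s := Icc 0 c) (t := Icc 0 c)
    ((hf.mono (Icc_subset_Icc_right ht.2)).intervalIntegrable_of_Icc ht.1) ?_ (hf t ht)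
  exact hf.stronglyMeasurableAtFilter_nhdsWithin measurableSet_Icc t

theorem continuous_primitive_Icc {f : ℝ → ℝ} {c : ℝ} (hf : ContinuousOn f (Icc 0 c)) :
    ContinuousOn (fun t => ∫ s in (0 : ℝ)..t, f s) (Icc 0 c) := fun _ ht =>
  (hasDerivWithinAt_integral hf ht).continuousWithinAt

/-- The fundamental lemma of the calculus of variations on `[0, c)`, with a boundary term. -/
theorem eq_zero_of_integral_mul_add {q : ℝ → ℝ} {c r : ℝ} (hc : 0 < c)
    (hq : ContinuousOn q (Icc 0 c))
    (h : ∀ χ : ℝ → ℝ, ContDiff ℝ ∞ χ → HasCompactSupport χ → tsupport χ ⊆ Iio c →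
      (∫ t in (0 : ℝ)..c, q t * χ t) + r * χ 0 = 0) :
    (∀ t ∈ Ico 0 c, q t = 0) ∧ r = 0 := by
  have h1 : ∀ᵐ t, t ∈ Ioo 0 c → q t = 0 := by
    refine isOpen_Ioo.ae_eq_zero_of_integral_contDiff_smul_eq_zero
      ((hq.mono Ioo_subset_Icc_self).locallyIntegrableOn measurableSet_Ioo) fun χ h1 h2 h3 => ?_
    have h4 := h χ h1 h2 (h3.trans fun t ht => ht.2)
    have h5 : χ 0 = 0 := by
      by_contra hne
      exact lt_irrefl _ (h3 (subset_tsupport χ hne)).1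
    rw [h5, mul_zero, add_zero, intervalIntegral.integral_of_le hc.le] at h4
    rw [← h4, setIntegral_eq_integral_of_forall_compl_eq_zero]
    · exact integral_congr_ae (Eventually.of_forall fun t => by simp [mul_comm])
    · intro t ht
      have h6 : χ t = 0 := by
        by_contra hne
        exact ht (Ioo_subset_Ioc_self (h3 (subset_tsupport χ hne)))
      rw [h6, mul_zero]
  have h2 : EqOn q (fun _ => 0) (Ioo 0 c) :=
    Measure.eqOn_open_of_ae_eq ((ae_restrict_iff' measurableSet_Ioo).2 h1) isOpen_Ioo
      (hq.mono Ioo_subset_Icc_self) continuousOn_const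
  have h3 : EqOn q (fun _ => 0) (Icc 0 c) :=
    h2.of_subset_closure hq continuousOn_const Ioo_subset_Icc_self
      (by rw [closure_Ioo hc.ne])
  refine ⟨fun t ht => h3 (Ico_subset_Icc_self ht), ?_⟩
  -- Once `q` vanishes, one test function supported to the left of `c` with value `1` at `0`
  -- isolates the boundary coefficient.
  let β : ContDiffBump (0 : ℝ) := ⟨c / 4, c / 2, by positivity, by linarith⟩
  have h4 := h β β.contDiff β.hasCompactSupport (by
    rw [β.tsupport_eq, Real.closedBall_eq_Icc]
    intro t ht
    have := ht.2
    simp only [β, zero_add] at this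
    exact lt_of_le_of_lt this (by linarith))
  have h5 : ∫ t in (0 : ℝ)..c, q t * β t = 0 := by
    rw [intervalIntegral.integral_congr (g := fun _ => (0 : ℝ)), intervalIntegral.integral_zero]
    intro t ht
    rw [uIcc_of_le hc.le] at ht
    simp [h3 ht]
  have h6 : β 0 = 1 := β.one_of_mem_closedBall (Metric.mem_closedBall_self (by positivity))
  rw [h5, h6] at h4
  linarith

theorem dt_eq_of_hasDerivAt {f : ℝ → ℝ → ℝ} {t x f' : ℝ} (ht : 0 ≤ t)
    (h : HasDerivAt (fun s => f s x) f' t) : dt f t x = f' :=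
  h.hasDerivWithinAt.derivWithin (uniqueDiffOn_Ici 0 t ht)

section

variable {a : ℝ → ℝ → ℝ} {p : ℝ} {S : EReal} {u₀ : H1} {u₁ : L2} {u : ℝ → H1} {C : ℝ≥0}

theorem IsSolution.hasDerivWithinAt (h : IsSolution a p u₀ u₁ S u) {t : ℝ}
    (ht : t ∈ timeInterval S) :
    HasDerivWithinAt (fun s => toL2 (u s)) (velocity u t) (Ici 0) t := by
  have h1 := ((h.contDiffOn.differentiableOn one_ne_zero t ht).hasDerivWithinAt).mono_of_mem_nhdsWithin
    (timeInterval_mem_nhdsWithin ht)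
  exact h1.differentiableWithinAt.hasDerivWithinAt

theorem uniqueDiffOn_timeInterval : UniqueDiffOn ℝ (timeInterval S) := fun t ht =>
  (uniqueDiffOn_Ici 0 t ht.1).mono_nhds (nhdsWithin_le_of_mem (timeInterval_mem_nhdsWithin ht))

theorem IsSolution.continuousOn_velocity (h : IsSolution a p u₀ u₁ S u) :
    ContinuousOn (velocity u) (timeInterval S) := by
  have h1 := h.contDiffOn.continuousOn_derivWithin uniqueDiffOn_timeInterval le_rfl
  refine h1.congr fun t ht => ?_
  exact (((h.hasDerivWithinAt ht).mono timeInterval_subset).derivWithin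
    (uniqueDiffOn_timeInterval t ht)).symm

theorem exists_bound_of_tsupport_subset_Iio {χ : ℝ → ℝ} {c : ℝ} (hc : 0 < c)
    (h : HasCompactSupport χ) (hs : tsupport χ ⊆ Iio c) :
    ∃ b, 0 ≤ b ∧ b < c ∧ ∀ t, b < t → χ t = 0 := by
  rcases (tsupport χ).eq_empty_or_nonempty with he | hne
  · refine ⟨0, le_rfl, hc, fun t _ => ?_⟩
    by_contra hne
    have := subset_tsupport χ hne
    rw [he] at this
    exact this
  · obtain ⟨b, hb, hmax⟩ := h.isCompact.exists_isGreatest hne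
    refine ⟨max 0 b, le_max_left _ _, max_lt hc (hs hb), fun t ht => ?_⟩
    by_contra hne
    have := hmax (subset_tsupport χ hne)
    exact absurd (this.trans (le_max_right 0 b)) (not_le.2 ht)

/-- The weak formulation for the product of a function of time and a travelling wave. -/
theorem IsSolution.integral_travelling (h : IsSolution a p u₀ u₁ S u)
    (hA : IsCoeff (freeze a) C) (ha : IsC2 a) (hp : 1 < p) {c M : ℝ} (hM : 0 ≤ M) (hc : 0 < c)
    (hcS : c ∈ timeInterval S) (hbd : ∀ t ∈ Icc 0 c, ∀ᵐ x, |toL2 (u t) x| ≤ M) {σ : ℝ}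
    (hσ : σ * σ = 1) {φ : ℝ → ℝ} (hφ : ContDiff ℝ ∞ φ) (hφc : HasCompactSupport φ) {χ : ℝ → ℝ}
    (hχ : ContDiff ℝ ∞ χ) (hχc : HasCompactSupport χ) (hχs : tsupport χ ⊆ Iio c) :
    (∫ t in (0 : ℝ)..c, (pair (velocity u t + σ • weakDeriv (u t)) (fun x => φ (x + σ * t)) -
        (∫ s in (0 : ℝ)..t, pair (force (freeze a) p M s (phase s (u s) (velocity u s)))
          fun x => φ (x + σ * s)) -
        (pair (u₁ + σ • weakDeriv u₀) φ + pair (toL2 u₀ - toL2 (u 0)) fun x => a 0 x * φ x)) *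
          χ t) + pair (toL2 (u 0) - toL2 u₀) φ * χ 0 = 0 := by
  obtain ⟨b, hb0, hbc, hχb⟩ := exists_bound_of_tsupport_subset_Iio hc hχc hχs
  set w := velocity u with hw
  -- The primitive is based at `c`, so `η` vanishes beyond the support of `χ`. It need not vanish
  -- for negative times, which a test function on `[0, T)` permits.
  set η : ℝ → ℝ := fun t => ∫ s in c..t, χ s with hη
  have hηd : ∀ t, HasDerivAt η (χ t) t := fun t =>
    intervalIntegral.integral_hasDerivAt_right (hχ.continuous.intervalIntegrable _ _)
      (hχ.continuous.stronglyMeasurableAtFilter _ _) hχ.continuous.continuousAt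
  have hηs : ContDiff ℝ ∞ η := contDiff_infty_iff_deriv.2
    ⟨fun t => (hηd t).differentiableAt, by rwa [show deriv η = χ from funext fun t => (hηd t).deriv]⟩
  have hηb : ∀ t, b < t → η t = 0 := by
    intro t ht
    simp only [hη]
    rw [intervalIntegral.integral_congr (g := fun _ => (0 : ℝ)), intervalIntegral.integral_zero]
    intro s hs
    exact hχb s ((lt_min hbc ht).trans_le hs.1)
  have hφd : Differentiable ℝ φ := hφ.differentiable (by simp)
  have hφd₁ : ContDiff ℝ ∞ (deriv φ) := (contDiff_infty_iff_deriv.1 hφ).2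
  have hφd₂ : ContDiff ℝ ∞ (deriv (deriv φ)) := (contDiff_infty_iff_deriv.1 hφd₁).2
  have hχd₁ : ContDiff ℝ ∞ (deriv χ) := (contDiff_infty_iff_deriv.1 hχ).2
  have hone : ∀ {θ : ℝ → ℝ}, ContDiff ℝ ∞ θ → ContDiff ℝ 1 θ := fun h =>
    h.of_le (by exact_mod_cast le_top)
  have hχd : ∀ t, HasDerivAt χ (deriv χ t) t := fun t =>
    ((hχ.differentiable (by simp)) t).hasDerivAt
  set ψ : ℝ → ℝ → ℝ := fun t x => η t * φ (x + σ * t) with hψ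
  have hψs : ∀ T, IsSmooth T 2 ψ := by
    intro T
    have h1 : ContDiff ℝ 2 fun z : ℝ × ℝ => η z.1 * φ (z.2 + σ * z.1) := by
      have e1 : ContDiff ℝ 2 η := contDiff_infty.1 hηs 2
      have e2 : ContDiff ℝ 2 φ := contDiff_infty.1 hφ 2
      fun_prop
    exact h1.contDiffOn
  have hψt : ∀ t, 0 ≤ t → ∀ x, dt ψ t x =
      χ t * φ (x + σ * t) + η t * (σ * deriv φ (x + σ * t)) := fun t ht x =>
    dt_eq_of_hasDerivAt ht ((hηd t).mul (hasDerivAt_translate (hone hφ) σ t x))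
  -- Since `σ² = 1`, the term `η φ''` equals the one in `ψ_xx`. The wave operator of `ψ` contains at
  -- most one derivative of `φ`, which the weak derivative of `u` can absorb.
  have hψtt : ∀ t, 0 ≤ t → ∀ x, dt (dt ψ) t x = deriv χ t * φ (x + σ * t) +
      2 * σ * χ t * deriv φ (x + σ * t) + η t * deriv (deriv φ) (x + σ * t) := by
    intro t ht x
    have h1 : HasDerivAt (fun t => χ t * φ (x + σ * t) + η t * (σ * deriv φ (x + σ * t)))
        (deriv χ t * φ (x + σ * t) + χ t * (σ * deriv φ (x + σ * t)) +
          (χ t * (σ * deriv φ (x + σ * t)) +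
            η t * (σ * (σ * deriv (deriv φ) (x + σ * t))))) t :=
      ((hχd t).mul (hasDerivAt_translate (hone hφ) σ t x)).add
        ((hηd t).mul ((hasDerivAt_translate (hone hφd₁) σ t x).const_mul σ))
    have h2 := (h1.hasDerivWithinAt (s := Ici 0)).congr (fun s hs => hψt s hs x) (hψt t ht x)
    rw [dt, h2.derivWithin (uniqueDiffOn_Ici 0 t ht), ← mul_assoc σ σ, hσ]
    ring
  have hsh : ∀ {θ : ℝ → ℝ}, ContDiff ℝ ∞ θ → ∀ r x,
      HasDerivAt (fun x => θ (x + r)) (deriv θ (x + r)) x := by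
    intro θ hθ r x
    have h1 : HasDerivAt (fun x => x + r) 1 x := (hasDerivAt_id x).add_const r
    have h2 := ((hθ.differentiable (by simp)) (x + r)).hasDerivAt
    exact (HasDerivAt.comp x h2 h1 : HasDerivAt (fun x => θ (x + r)) _ x).congr_deriv (mul_one _)
  have hψxx : ∀ t x, dx (dx ψ) t x = η t * deriv (deriv φ) (x + σ * t) := by
    intro t x
    have h1 : dx ψ t = fun x => η t * deriv φ (x + σ * t) :=
      funext fun y => ((hsh hφ (σ * t) y).const_mul (η t)).deriv
    rw [dx, h1]
    exact ((hsh hφd₁ (σ * t) x).const_mul (η t)).deriv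
  obtain ⟨B, hB⟩ := (isTestCurve_translate_nonneg hφ.continuous hφc σ c).support
  have hv : VanishesOff S b B ψ := by
    intro t ht x hx
    rcases lt_or_ge b t with h1 | h1
    · simp [hψ, hηb t h1]
    · rcases hx with hx | hx
      · exact absurd hx (not_lt.2 h1)
      · simp [hψ, hB t ⟨ht.1, h1.trans hbc.le⟩ x hx]
  have hsub := Icc_subset_timeInterval hcS
  have hbS : b ∈ timeInterval S := hsub ⟨hb0, hbc.le⟩
  have htest : IsTestFunction S ψ := by
    refine ⟨hψs S, Icc 0 b ×ˢ Icc (-B) B, isCompact_Icc.prod isCompact_Icc,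
      prod_mono (Icc_subset_timeInterval hbS) (subset_univ _), fun t ht x hx => ?_⟩
    refine hv t ht x ?_
    by_contra hcon
    rw [not_or, not_lt, not_not] at hcon
    exact hx ⟨⟨ht.1, hcon.1⟩, hcon.2⟩
  have hav : VanishesOff S b B fun t x => a t x * ψ t x := hv.mul_left a
  have haψ : IsSmooth S 2 fun t x => a t x * ψ t x := (IsSmooth.of_isC2 ha).mul (hψs S)
  have hweak := h.weak ψ htest
  rw [setIntegral_timeInterval_eq hcS hbc (fun t ht hbt => by
      simp [hv.dt.dt t ht _ (Or.inl hbt), hv.dx.dx t ht _ (Or.inl hbt),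
        hav.dt t ht _ (Or.inl hbt)]),
    setIntegral_timeInterval_eq hcS hbc (fun t ht hbt => by simp [hv t ht _ (Or.inl hbt)])]
    at hweak
  have hwc := h.continuousOn_velocity.mono hsub
  have huc := h.continuousOn.mono hsub
  obtain ⟨hu1, -⟩ := continuousOn_H1_iff.1 huc
  have k0 := isTestCurve_translate_nonneg hφ.continuous hφc σ c
  have k1 := isTestCurve_translate_nonneg hφd₁.continuous hφc.deriv σ c
  have k1' : IsTestCurve (Icc 0 c) fun t x => σ * deriv φ (x + σ * t) :=
    k1.mul_left continuousOn_const
  have k2 := isTestCurve_translate_nonneg hφd₂.continuous hφc.deriv.deriv σ c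
  have c5 := (hav.isTestCurve haψ).mono hsub
  have c6 := (hav.dt.isTestCurve haψ.one.dt_zero).mono hsub
  set A : ℝ → ℝ := fun t => pair (toL2 (u t)) fun x => φ (x + σ * t) with hAdef
  set A₁ : ℝ → ℝ := fun t => pair (toL2 (u t)) fun x => deriv φ (x + σ * t) with hA₁
  set W : ℝ → ℝ := fun t => pair (w t) fun x => φ (x + σ * t) with hW
  set P : ℝ → ℝ := fun t => pair (toL2 (u t)) fun x => a t x * ψ t x with hP
  set D : ℝ → ℝ := fun t => pair (toL2 (u t)) (dt (fun s y => a s y * ψ s y) t) with hD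
  set N : ℝ → ℝ := fun t => pair (nem p M (toL2 (u t))) fun x => φ (x + σ * t) with hN
  set n : ℝ → ℝ := fun t => pair (force (freeze a) p M t (phase t (u t) (w t)))
    fun x => φ (x + σ * t) with hn
  set r := pair (u₁ + σ • weakDeriv u₀) φ + pair (toL2 u₀ - toL2 (u 0)) fun x => a 0 x * φ x
    with hr
  have hAc : ContinuousOn A (Icc 0 c) := k0.continuousOn_pair hu1
  have hA₁c : ContinuousOn A₁ (Icc 0 c) := k1.continuousOn_pair hu1
  have hWc : ContinuousOn W (Icc 0 c) := k0.continuousOn_pair hwc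
  have hPc : ContinuousOn P (Icc 0 c) := c5.continuousOn_pair hu1
  have hDc : ContinuousOn D (Icc 0 c) := c6.continuousOn_pair hu1
  have hNc : ContinuousOn N (Icc 0 c) :=
    k0.continuousOn_pair ((lipschitzWith_nem hp hM).continuous.comp_continuousOn hu1)
  have hnc : ContinuousOn n (Icc 0 c) :=
    k0.continuousOn_pair (continuousOn_force hA hp hM (continuousOn_phase huc hwc))
  have hnI := continuous_primitive_Icc hnc
  have hηc : ContinuousOn η (Icc 0 c) := hηs.continuous.continuousOn
  have hχc' : ContinuousOn χ (Icc 0 c) := hχ.continuous.continuousOn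
  have hm : ∀ t, pair (w t + σ • weakDeriv (u t)) (fun x => φ (x + σ * t)) =
      W t - σ * A₁ t := by
    intro t
    have h1 : (deriv fun x => φ (x + σ * t)) = fun x => deriv φ (x + σ * t) :=
      funext fun x => (hsh hφ (σ * t) x).deriv
    have hcs : HasCompactSupport fun x => φ (x + σ * t) :=
      hφc.comp_homeomorph (Homeomorph.addRight (σ * t))
    have hcd : ContDiff ℝ ∞ fun x => φ (x + σ * t) := hφ.comp (contDiff_id.add contDiff_const)
    have h2 := pair_weakDeriv (u t) hcd hcs
    rw [h1] at h2
    rw [pair_add _ _ (memLp_two_of_compactSupport hcd.continuous hcs), pair_smul]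
    simp only [hW, hA₁, h2]
    ring
  set E : ℝ → ℝ := fun t => A t * deriv χ t + 2 * σ * A₁ t * χ t - D t with hE
  have hEc : ContinuousOn E (Icc 0 c) :=
    ((hAc.mul hχd₁.continuous.continuousOn).add
      ((continuousOn_const.mul hA₁c).mul hχc')).sub hDc
  set G : ℝ → ℝ := fun t => (W t - σ * A₁ t - (∫ s in (0 : ℝ)..t, n s) - r) * χ t with hG
  have hGc : ContinuousOn G (Icc 0 c) :=
    (((hWc.sub (continuousOn_const.mul hA₁c)).sub hnI).sub continuousOn_const).mul hχc'
  -- `Q` is chosen so that its derivative is the difference of the two weak integrands plus the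
  -- desired integrand `G`. It vanishes at `c`, and `Q 0` matches the initial terms up to the
  -- multiple of `χ 0` in the statement.
  set Q : ℝ → ℝ := fun t => A t * χ t - P t - (∫ s in (0 : ℝ)..t, n s) * η t - r * η t with hQ
  have hQc : ContinuousOn Q (Icc 0 c) :=
    (((hAc.mul hχc').sub hPc).sub (hnI.mul hηc)).sub (continuousOn_const.mul hηc)
  have hpos : ∀ r, Icc 0 c ∈ 𝓝 r → 0 < r := by
    intro r hnr
    have : r ∈ interior (Icc 0 c) := mem_interior_iff_mem_nhds.2 hnr
    rw [interior_Icc] at this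
    exact this.1
  have hQd : ∀ t ∈ Ioo 0 c, HasDerivAt Q (E t - N t * η t + G t) t := by
    intro t ht
    have htc := Ioo_subset_Icc_self ht
    have hnb : Icc 0 c ∈ 𝓝 t := Icc_mem_nhds ht.1 ht.2
    have hud := (h.hasDerivWithinAt (hsub htc)).hasDerivAt (Ici_mem_nhds ht.1)
    have d1 := k0.hasDerivAt_pair k1' hnb
      (fun r _ _ x => hasDerivAt_translate (hone hφ) σ r x) hud
    have d2 := c5.hasDerivAt_pair c6 hnb
      (fun r hr hnr x => haψ.one.hasDerivAt_dt (hsub hr) (hpos r hnr) x) hud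
    have d3 := (hasDerivWithinAt_integral hnc htc).hasDerivAt hnb
    refine ((((d1.mul (hχd t)).sub d2).sub (d3.mul (hηd t))).sub
      ((hηd t).const_mul r)).congr_deriv ?_
    have e1 : pair (w t) (fun x => a t x * ψ t x) = η t * (N t - n t) := by
      have e2 : n t = N t - pair (w t) fun x => a t x * φ (x + σ * t) := by
        simp only [hn, hN]
        rw [force, wave_phase, pair_sub _ _ (k0.memLp htc),
          pair_mulL (hA.continuous_apply t) (hA.bound t), freeze_of_nonneg a ht.1.le]
        rfl
      rw [e2, sub_sub_cancel, ← pair_const_mul]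
      congr 1
      funext x
      simp only [hψ]
      ring
    rw [pair_const_mul]
    simp only [hE, hG, ← hw, e1]
    ring
  have hFTC := intervalIntegral.integral_eq_sub_of_hasDerivAt_of_le hc.le hQc hQd
    (((hEc.sub (hNc.mul hηc)).add hGc).intervalIntegrable_of_Icc hc.le)
  have iE := hEc.intervalIntegrable_of_Icc (μ := volume) hc.le
  have iN : IntervalIntegrable (fun t => N t * η t) volume 0 c :=
    (hNc.mul hηc).intervalIntegrable_of_Icc hc.le
  have iG := hGc.intervalIntegrable_of_Icc (μ := volume) hc.le
  rw [intervalIntegral.integral_add (iE.sub iN) iG, intervalIntegral.integral_sub iE iN] at hFTC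
  have hl : ∫ t in (0 : ℝ)..c, ∫ x, toL2 (u t) x *
      (dt (dt ψ) t x - dx (dx ψ) t x - dt (fun s y => a s y * ψ s y) t x) =
      ∫ t in (0 : ℝ)..c, E t := by
    refine intervalIntegral.integral_congr fun t ht => ?_
    rw [uIcc_of_le hc.le] at ht
    have m0 := k0.memLp ht
    have m1 := k1.memLp ht
    have e1 : (fun x => dt (dt ψ) t x - dx (dx ψ) t x - dt (fun s y => a s y * ψ s y) t x) =
        fun x => (deriv χ t * φ (x + σ * t) + 2 * σ * χ t * deriv φ (x + σ * t)) -
          dt (fun s y => a s y * ψ s y) t x := by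
      funext x
      rw [hψtt t ht.1, hψxx]
      ring
    have m01 : MemLp (fun x => deriv χ t * φ (x + σ * t) + 2 * σ * χ t * deriv φ (x + σ * t)) 2
        (volume : Measure ℝ) := (m0.const_mul _).add (m1.const_mul _)
    have e2 : pair (toL2 (u t)) (fun x => dt (dt ψ) t x - dx (dx ψ) t x -
        dt (fun s y => a s y * ψ s y) t x) = E t := by
      rw [e1, pair_sub_right _ m01 (c6.memLp ht), pair_add_right _ (m0.const_mul _)
        (m1.const_mul _), pair_const_mul, pair_const_mul]
      simp only [hE, hAdef, hA₁, hD]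
      ring
    exact e2
  have hrN : ∫ t in (0 : ℝ)..c, ∫ x, |toL2 (u t) x| ^ p * ψ t x =
      ∫ t in (0 : ℝ)..c, N t * η t := by
    refine intervalIntegral.integral_congr fun t ht => ?_
    rw [uIcc_of_le hc.le] at ht
    have e1 := pair_nem hp hM (hbd t ht) (ψ t)
    change (∫ x, |toL2 (u t) x| ^ p * ψ t x) = N t * η t
    rw [← e1]
    exact (pair_const_mul _ _ _).trans (mul_comm _ _)
  have h0c : (0 : ℝ) ∈ Icc 0 c := ⟨le_rfl, hc.le⟩
  have hφm := memLp_two_of_compactSupport hφ.continuous hφc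
  have hφm₁ := memLp_two_of_compactSupport hφd₁.continuous hφc.deriv
  have haφm : MemLp (fun x => a 0 x * φ x) 2 (volume : Measure ℝ) := by
    refine memLp_two_of_compactSupport (Continuous.mul ?_ hφ.continuous) hφc.mul_left
    have := hA.continuous_apply 0
    rwa [freeze_of_nonneg a le_rfl] at this
  have hI : ∫ x, ((a 0 x * toL2 u₀ x + u₁ x) * ψ 0 x - toL2 u₀ x * dt ψ 0 x) =
      η 0 * (pair (toL2 u₀) (fun x => a 0 x * φ x) + pair u₁ φ) -
        (χ 0 * pair (toL2 u₀) φ + η 0 * σ * pair (toL2 u₀) (deriv φ)) := by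
    have j1 : Integrable fun x => toL2 u₀ x * (a 0 x * φ x) :=
      MemLp.integrable_mul (Lp.memLp (toL2 u₀)) haφm
    have j2 : Integrable fun x => u₁ x * φ x := MemLp.integrable_mul (Lp.memLp u₁) hφm
    have j3 : Integrable fun x => toL2 u₀ x * φ x :=
      MemLp.integrable_mul (Lp.memLp (toL2 u₀)) hφm
    have j4 : Integrable fun x => toL2 u₀ x * deriv φ x :=
      MemLp.integrable_mul (Lp.memLp (toL2 u₀)) hφm₁
    have j5 : Integrable fun x => η 0 * (toL2 u₀ x * (a 0 x * φ x) + u₁ x * φ x) :=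
      (j1.add j2).const_mul _
    have j6 : Integrable fun x => χ 0 * (toL2 u₀ x * φ x) + η 0 * σ * (toL2 u₀ x * deriv φ x) :=
      (j3.const_mul _).add (j4.const_mul _)
    simp only [pair]
    rw [← integral_add j1 j2, ← integral_const_mul, ← integral_const_mul, ← integral_const_mul,
      ← integral_add (j3.const_mul _) (j4.const_mul _), ← integral_sub j5 j6]
    refine integral_congr_ae (Eventually.of_forall fun x => ?_)
    beta_reduce
    rw [hψt 0 le_rfl x]
    simp only [hψ, mul_zero, add_zero]
    ring
  have hQcv : Q c = 0 := by
    have f1 : (fun x => a c x * ψ c x) = fun _ => 0 := funext fun x => by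
      simp [hψ, hηb c hbc]
    have f2 : P c = 0 := by
      change pair (toL2 (u c)) (fun x => a c x * ψ c x) = 0
      rw [f1]
      simp [pair]
    simp [hQ, f2, hηb c hbc, hχb c hbc]
  have hQ0 : Q 0 = χ 0 * pair (toL2 (u 0)) φ -
      η 0 * (pair (toL2 (u 0)) fun x => a 0 x * φ x) - r * η 0 := by
    have f1 : (fun x => a 0 x * ψ 0 x) = fun x => η 0 * (a 0 x * φ x) := funext fun x => by
      simp only [hψ, mul_zero, add_zero]
      ring
    simp only [hQ, hAdef, hP, f1, mul_zero, add_zero, pair_const_mul,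
      intervalIntegral.integral_same, zero_mul, sub_zero]
    ring
  have hr' : r = pair u₁ φ - σ * pair (toL2 u₀) (deriv φ) +
      (pair (toL2 u₀) (fun x => a 0 x * φ x) - pair (toL2 (u 0)) fun x => a 0 x * φ x) := by
    rw [hr, pair_add _ _ hφm, pair_smul, pair_sub _ _ haφm, pair_weakDeriv u₀ hφ hφc]
    ring
  have hgoal : ∫ t in (0 : ℝ)..c, (pair (w t + σ • weakDeriv (u t)) (fun x => φ (x + σ * t)) -
      (∫ s in (0 : ℝ)..t, n s) - r) * χ t = ∫ t in (0 : ℝ)..c, G t :=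
    intervalIntegral.integral_congr fun t _ => by simp only [hm, hG]
  rw [hl, hrN, hI] at hweak
  rw [hgoal, pair_sub _ _ hφm]
  rw [hQcv, hQ0] at hFTC
  have hmul : r * η 0 = (pair u₁ φ - σ * pair (toL2 u₀) (deriv φ) +
      (pair (toL2 u₀) (fun x => a 0 x * φ x) - pair (toL2 (u 0)) fun x => a 0 x * φ x)) * η 0 := by
    rw [hr']
  linarith

/-- Testing with travelling waves of both directions identifies `S(-σt)(u_t + σ u_x)` with the time
integral of the translated force plus its initial value. This is the differential equation for the
two travelling coordinates. -/
theorem IsSolution.exists_isMild (h : IsSolution a p u₀ u₁ S u)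
    (hA : IsCoeff (freeze a) C) (ha : IsC2 a) (hp : 1 < p) {T : ℝ} (hT : T ∈ timeInterval S) :
    ∃ M, 0 ≤ M ∧ IsMild (freeze a) p M T u₀ u₁ u (velocity u) := by
  -- The variational lemma gives identities on `[0, c)` only; `c` beyond `T` includes the endpoint
  -- `T`.
  obtain ⟨c, hcS, hTc⟩ := exists_between_timeInterval hT
  have hc : 0 < c := hT.1.trans_lt hTc
  have hsub := Icc_subset_timeInterval hcS
  have hw := h.continuousOn_velocity.mono hsub
  have hu := h.continuousOn.mono hsub
  obtain ⟨hu1, hu2⟩ := continuousOn_H1_iff.1 hu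
  have hph := continuousOn_phase hu hw
  obtain ⟨R, hR⟩ := isCompact_Icc.exists_bound_of_continuousOn hph
  have hR0 : 0 ≤ R := (norm_nonneg _).trans (hR 0 ⟨le_rfl, hc.le⟩)
  set M := 4 * R with hMdef
  have hM : 0 ≤ M := by positivity
  have hbd : ∀ t ∈ Icc 0 c, ∀ᵐ x, |toL2 (u t) x| ≤ M := by
    intro t ht
    filter_upwards [ae_abs_phase_le t (u t) (velocity u t)] with x hx
    exact hx.trans (by rw [hMdef]; gcongr; exact hR t ht)
  set F : ℝ → L2 := fun s => force (freeze a) p M s (phase s (u s) (velocity u s)) with hF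
  have hFc : ContinuousOn F (Icc 0 c) := continuousOn_force hA hp hM hph
  have hid : ∀ (σ : ℝ) (f : L2) (τ : ℝ) (φ : ℝ → ℝ),
      (pair f fun x => φ (x + σ * τ)) = pair (shift (-(σ * τ)) f) φ := by
    intro σ f τ φ
    rw [pair_shift]
    simp
  have hcσ : ∀ (σ : ℝ) (f : ℝ → L2), ContinuousOn f (Icc 0 c) →
      ContinuousOn (fun s => shift (-(σ * s)) (f s)) (Icc 0 c) := fun σ f hf =>
    continuous_shift_of (by fun_prop) hf
  -- The extra pairing of `u₀ - u(0)` with `a φ` remains only until the boundary term has shown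
  -- `u(0) = u₀`: the initial data are encoded in the weak formulation.
  have hmain : ∀ σ : ℝ, σ * σ = 1 → ∀ φ : ℝ → ℝ, ContDiff ℝ ∞ φ → HasCompactSupport φ →
      (∀ t ∈ Ico 0 c, pair (shift (-(σ * t)) (velocity u t + σ • weakDeriv (u t))) φ =
        (∫ s in (0 : ℝ)..t, pair (shift (-(σ * s)) (F s)) φ) +
        (pair (u₁ + σ • weakDeriv u₀) φ + pair (toL2 u₀ - toL2 (u 0)) fun x => a 0 x * φ x)) ∧
      pair (toL2 (u 0) - toL2 u₀) φ = 0 := by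
    intro σ hσ φ hφ hφc
    have hm := memLp_two_of_compactSupport hφ.continuous hφc
    have hpc : ∀ f : ℝ → L2, ContinuousOn f (Icc 0 c) →
        ContinuousOn (fun s => pair (f s) φ) (Icc 0 c) := fun f hf =>
      (isTestCurve_const hφ.continuous hφc (Icc 0 c)).continuousOn_pair hf
    have hint := fun χ h1 h2 h3 =>
      h.integral_travelling hA ha hp hM hc hcS hbd hσ hφ hφc (χ := χ) h1 h2 h3
    simp only [hid] at hint
    obtain ⟨h1, h2⟩ := eq_zero_of_integral_mul_add hc (((hpc _ (hcσ σ _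
      (hw.add (hu2.const_smul σ)))).sub (continuous_primitive_Icc (hpc _ (hcσ σ _ hFc)))).sub
        continuousOn_const) hint
    exact ⟨fun t ht => by
      have := h1 t ht
      simp only [Pi.add_apply, Pi.smul_apply, Pi.sub_apply] at this
      linarith, h2⟩
  have hu0 : u 0 = u₀ := by
    refine toL2_injective (sub_eq_zero.1 (eq_zero_of_pair _ fun φ h1 h2 => ?_))
    exact (hmain 1 (by norm_num) φ h1 h2).2
  have hduh : ∀ σ : ℝ, σ * σ = 1 → ∀ t ∈ Ico 0 c,
      shift (-(σ * t)) (velocity u t + σ • weakDeriv (u t)) =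
        (u₁ + σ • weakDeriv u₀) + ∫ s in (0 : ℝ)..t, shift (-(σ * s)) (F s) := by
    intro σ hσ t ht
    refine eq_of_pair fun φ hφ hφc => ?_
    have hm := memLp_two_of_compactSupport hφ.continuous hφc
    rw [(hmain σ hσ φ hφ hφc).1 t ht, pair_add (u₁ + σ • weakDeriv u₀) _ hm, pair_integral _ hm, hu0, sub_self]
    · have : pair (0 : L2) (fun x => a 0 x * φ x) = 0 := integral_zero_mul _
      rw [this]
      ring
    · exact ((hcσ σ _ hFc).mono (Icc_subset_Icc_right ht.2.le)).intervalIntegrable_of_Icc ht.1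
  have hw0 : velocity u 0 = u₁ := by
    have := hduh 1 (by norm_num) 0 ⟨le_rfl, hc⟩
    simpa [hu0] using this
  have hTc' : Icc 0 T ⊆ Icc 0 c := Icc_subset_Icc_right hTc.le
  refine ⟨M, hM, ⟨fun t ht => ?_, hu0, hw0, fun t ht => hbd t (hTc' ht)⟩⟩
  have htc : t ∈ Ico 0 c := ⟨ht.1, ht.2.trans_lt hTc⟩
  have hdσ : ∀ σ : ℝ, σ * σ = 1 → HasDerivWithinAt
      (fun t => shift (-(σ * t)) (velocity u t + σ • weakDeriv (u t)))
      (shift (-(σ * t)) (F t)) (Icc 0 T) t := by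
    intro σ hσ
    have h1 := ((hasDerivWithinAt_integral (hcσ σ _ hFc) (Ico_subset_Icc_self htc)).const_add
      (u₁ + σ • weakDeriv u₀)).mono hTc'
    exact h1.congr (fun s hs => hduh σ hσ s ⟨hs.1, hs.2.trans_lt hTc⟩) (hduh σ hσ t htc)
  have d0 : HasDerivWithinAt (fun s => toL2 (u s)) (velocity u t) (Icc 0 T) t :=
    (h.hasDerivWithinAt (hsub (hTc' ht))).mono Icc_subset_Ici_self
  have d1 := hdσ 1 (by norm_num)
  have d2 := hdσ (-1) (by norm_num)
  simp only [one_mul, neg_mul, neg_neg, one_smul, neg_smul, ← sub_eq_add_neg] at d1 d2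
  refine (d0.prodMk (d1.prodMk d2)).congr_deriv ?_
  simp only [field, wave_phase, hF]

end

/-! ### Cut-off functions and the life span of solutions -/

/-- Even cut-off functions equal to `1` on `[-1, 1]` and to `0` off `(-2, 2)`, whose first two
derivatives are controlled by the power `1 / p` of the function. -/
structure IsCutoff (p C : ℝ) (ρ : ℝ → ℝ) : Prop where
  contDiff : ContDiff ℝ 2 ρ
  nonneg : ∀ s, 0 ≤ ρ s
  le_one : ∀ s, ρ s ≤ 1
  eq_one : ∀ s, |s| ≤ 1 → ρ s = 1
  eq_zero : ∀ s, 2 ≤ |s| → ρ s = 0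
  antitoneOn : AntitoneOn ρ (Ici 0)
  even : ∀ s, ρ (-s) = ρ s
  bound : ∀ s, |deriv ρ s| ≤ C * ρ s ^ (1 / p)
  bound_two : ∀ s, |deriv (deriv ρ) s| ≤ C * ρ s ^ (1 / p)

theorem exists_isCutoff {p : ℝ} (hp : 1 < p) : ∃ C ρ, 0 ≤ C ∧ IsCutoff p C ρ := by
  -- With `ρ = χ ^ n`, two derivatives leave a factor `χ ^ (n - 2)`. This is at most `ρ ^ (1/p)`
  -- when `n - 2 ≥ n / p`, that is `n ≥ 2p / (p - 1)`.
  obtain ⟨n, hn⟩ := exists_nat_ge (2 * p / (p - 1))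
  have hp1 : 0 < p - 1 := sub_pos.2 hp
  have hnp : (2 : ℝ) * p ≤ n * (p - 1) := (div_le_iff₀ hp1).1 hn
  have hn2 : (2 : ℝ) < n := by
    by_contra hcon
    nlinarith [not_lt.1 hcon, mul_le_mul_of_nonneg_right (not_lt.1 hcon) hp1.le]
  obtain ⟨m, rfl⟩ : ∃ m, n = m + 2 := ⟨n - 2, by
    have : 2 < n := by exact_mod_cast hn2
    omega⟩
  -- The argument is at least `1` exactly for `|s| ≤ 1` and at most `0` exactly for `|s| ≥ 2`.
  set χ : ℝ → ℝ := fun s => Real.smoothTransition ((4 - s ^ 2) / 3) with hχ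
  have hs : ContDiff ℝ ∞ χ := Real.smoothTransition.contDiff.comp (by fun_prop)
  have h0 : ∀ s, 0 ≤ χ s := fun s => Real.smoothTransition.nonneg _
  have h1 : ∀ s, χ s ≤ 1 := fun s => Real.smoothTransition.le_one _
  have hz : ∀ s, 2 ≤ |s| → χ s = 0 := fun s hs =>
    Real.smoothTransition.zero_of_nonpos (by nlinarith [sq_abs s, abs_nonneg s])
  have hcs : HasCompactSupport χ := by
    refine HasCompactSupport.of_support_subset_isCompact (isCompact_Icc (a := (-2 : ℝ)) (b := 2))
      fun s hs => ?_
    refine abs_le.1 ?_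
    by_contra hcon
    exact hs (hz s (not_le.1 hcon).le)
  have hs1 : ContDiff ℝ ∞ (deriv χ) := hs.iterate_deriv 1
  obtain ⟨B₁, hB₁⟩ := hcs.deriv.exists_bound_of_continuous hs1.continuous
  have hs2 : ContDiff ℝ ∞ (deriv (deriv χ)) := hs.iterate_deriv 2
  obtain ⟨B₂, hB₂⟩ := hcs.deriv.deriv.exists_bound_of_continuous hs2.continuous
  have hB₁0 : 0 ≤ B₁ := (norm_nonneg _).trans (hB₁ 0)
  have hB₂0 : 0 ≤ B₂ := (norm_nonneg _).trans (hB₂ 0)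
  have d0 : ∀ s, HasDerivAt χ (deriv χ s) s := fun s =>
    ((hs.differentiable (by simp)) s).hasDerivAt
  have d1 : ∀ s, HasDerivAt (deriv χ) (deriv (deriv χ) s) s := fun s =>
    ((hs1.differentiable (by simp)) s).hasDerivAt
  have e1 : deriv (fun s => χ s ^ (m + 2)) = fun s => (m + 2) * (χ s ^ (m + 1) * deriv χ s) := by
    funext s
    refine ((d0 s).fun_pow (m + 2)).deriv.trans ?_
    push_cast
    ring
  have e2 : ∀ s, deriv (deriv (fun s => χ s ^ (m + 2))) s =
      (m + 2) * ((m + 1) * χ s ^ m * deriv χ s * deriv χ s + χ s ^ (m + 1) * deriv (deriv χ) s) := by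
    intro s
    rw [e1]
    refine ((((d0 s).fun_pow (m + 1)).mul (d1 s)).const_mul ((m : ℝ) + 2)).deriv.trans ?_
    push_cast
    simp only
  have hpow : ∀ s, χ s ^ m ≤ (χ s ^ (m + 2)) ^ (1 / p) := by
    intro s
    rw [← Real.rpow_natCast, ← Real.rpow_natCast, ← Real.rpow_mul (h0 s)]
    rcases (h0 s).eq_or_lt with hx | hx
    -- At a zero of `χ` the strict inequality `n > 2` is needed, since `0 ^ 0 = 1`.
    · have hm : (0 : ℝ) < m := by push_cast at hn2; linarith
      rw [← hx, Real.zero_rpow hm.ne']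
      exact Real.rpow_nonneg le_rfl _
    · refine Real.rpow_le_rpow_of_exponent_ge hx (h1 s) ?_
      rw [mul_one_div, div_le_iff₀ (by linarith)]
      push_cast at hnp ⊢
      nlinarith
  have hpow1 : ∀ s, χ s ^ (m + 1) ≤ χ s ^ m := fun s =>
    pow_le_pow_of_le_one (h0 s) (h1 s) (Nat.le_succ m)
  refine ⟨(m + 2) * ((m + 1) * (B₁ * B₁) + B₂ + B₁), fun s => χ s ^ (m + 2), by positivity,
    ⟨(hs.pow _).of_le (by norm_cast), fun s => pow_nonneg (h0 s) _,
      fun s => pow_le_one₀ (h0 s) (h1 s), fun s hs => ?_, fun s hs => ?_, fun s hs t ht hst => ?_,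
      fun s => ?_, fun s => ?_, fun s => ?_⟩⟩
  · have : χ s = 1 := Real.smoothTransition.one_of_one_le (by nlinarith [sq_abs s, abs_nonneg s])
    simp [this]
  · simp [hz s hs]
  · refine pow_le_pow_left₀ (h0 t) (Real.smoothTransition.monotone ?_) _
    have : s ^ 2 ≤ t ^ 2 := pow_le_pow_left₀ hs hst 2
    linarith
  · simp [hχ]
  · rw [e1]
    have hb := hB₁ s
    rw [Real.norm_eq_abs] at hb
    rw [abs_mul, abs_mul, abs_of_nonneg (pow_nonneg (h0 s) _),
      abs_of_nonneg (by positivity : (0 : ℝ) ≤ (m : ℝ) + 2),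
      mul_assoc ((m : ℝ) + 2)]
    refine mul_le_mul_of_nonneg_left ?_ (by positivity)
    have hX0 : (0 : ℝ) ≤ (χ s ^ (m + 2)) ^ (1 / p) := Real.rpow_nonneg (pow_nonneg (h0 s) _) _
    have hq := (hpow1 s).trans (hpow s)
    calc χ s ^ (m + 1) * |deriv χ s| ≤ (χ s ^ (m + 2)) ^ (1 / p) * B₁ := by gcongr
      _ ≤ ((m + 1) * (B₁ * B₁) + B₂ + B₁) * (χ s ^ (m + 2)) ^ (1 / p) := by
          rw [mul_comm]
          refine mul_le_mul_of_nonneg_right ?_ hX0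
          have : 0 ≤ ((m : ℝ) + 1) * (B₁ * B₁) := by positivity
          linarith
  · rw [e2]
    have hb := hB₁ s
    have hb2 := hB₂ s
    rw [Real.norm_eq_abs] at hb hb2
    rw [abs_mul, abs_of_nonneg (by positivity : (0 : ℝ) ≤ (m : ℝ) + 2),
      mul_assoc ((m : ℝ) + 2)]
    refine mul_le_mul_of_nonneg_left ?_ (by positivity)
    have hX0 : (0 : ℝ) ≤ (χ s ^ (m + 2)) ^ (1 / p) := Real.rpow_nonneg (pow_nonneg (h0 s) _) _
    have hq := (hpow1 s).trans (hpow s)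
    have hq0 := hpow s
    refine (abs_add_le _ _).trans ?_
    rw [abs_mul, abs_mul, abs_mul, abs_mul, abs_of_nonneg (pow_nonneg (h0 s) m),
      abs_of_nonneg (pow_nonneg (h0 s) (m + 1)),
      abs_of_nonneg (by positivity : (0 : ℝ) ≤ (m : ℝ) + 1)]
    have i1 : ((m : ℝ) + 1) * χ s ^ m * |deriv χ s| * |deriv χ s| ≤
        (m + 1) * (χ s ^ (m + 2)) ^ (1 / p) * B₁ * B₁ := by
      have := pow_nonneg (h0 s) m
      gcongr
    have i2 : χ s ^ (m + 1) * |deriv (deriv χ) s| ≤ (χ s ^ (m + 2)) ^ (1 / p) * B₂ := by gcongr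
    have i3 := mul_nonneg hB₁0 hX0
    linarith

/-- An average of the integrals of `m` over the intervals `[-r, r]`, `r ≥ R`. -/
theorem IsCutoff.le_integral_mul {p C c R : ℝ} {ρ m : ℝ → ℝ} (h : IsCutoff p C ρ) (hR : 0 < R)
    (hm : IntegrableOn m (Icc (-(2 * R)) (2 * R))) (hc : ∀ r, R ≤ r → c ≤ ∫ x in (-r)..r, m x) :
    c ≤ ∫ x, m x * ρ (x / R) := by
  have hd : ∀ s, HasDerivAt ρ (deriv ρ s) s := fun s =>
    ((h.contDiff.differentiable (by norm_num)) s).hasDerivAt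
  have hρc : Continuous (deriv ρ) := h.contDiff.continuous_deriv (by norm_num)
  have hle : ∀ s, 0 < s → deriv ρ s ≤ 0 := by
    intro s hs
    have h1 := h.antitoneOn.derivWithin_nonpos (x := s)
    rwa [derivWithin_of_mem_nhds (Ici_mem_nhds hs)] at h1
  have hint : ∀ a b, IntervalIntegrable (deriv ρ) volume a b := fun a b => hρc.intervalIntegrable _ _
  -- A layer-cake formula: `ρ (x / R)` averages the indicators of the intervals `(-rR, rR)`, `1 < r
  -- ≤ 2`, with the nonnegative density `-ρ'`. By Fubini the lower bound for truncated integrals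
  -- passes to the smooth cut-off, although the integrand need not be integrable on the line.
  have hrep : ∀ x : ℝ, ∫ r in Ioc (1 : ℝ) 2, (Ioi (|x| / R)).indicator (fun r => -deriv ρ r) r =
      ρ (x / R) := by
    intro x
    have hx : ρ (x / R) = ρ (|x| / R) := by
      rcases abs_cases x with ⟨h1, _⟩ | ⟨h1, _⟩ <;> rw [h1]
      rw [neg_div, h.even]
    rw [hx, setIntegral_indicator measurableSet_Ioi]
    set s := |x| / R with hs
    have hs0 : 0 ≤ s := by positivity
    have h2 : ρ 2 = 0 := h.eq_zero 2 (by norm_num)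
    have hset : Ioc (1 : ℝ) 2 ∩ Ioi s = Ioc (max 1 s) 2 := by
      ext r
      simp only [mem_inter_iff, mem_Ioc, mem_Ioi, max_lt_iff]
      tauto
    rw [hset]
    rcases le_or_gt s 2 with hs2 | hs2
    · rw [← intervalIntegral.integral_of_le (max_le one_le_two hs2), intervalIntegral.integral_neg,
        intervalIntegral.integral_eq_sub_of_hasDerivAt (fun r _ => hd r) (hint _ _), h2, zero_sub,
        neg_neg]
      rcases le_total s 1 with h1 | h1
      · rw [max_eq_left h1, h.eq_one 1 (by norm_num), h.eq_one s (by rwa [abs_of_nonneg hs0])]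
      · rw [max_eq_right h1]
    · rw [Ioc_eq_empty (not_lt.2 (hs2.le.trans (le_max_right _ _))), h.eq_zero s
        (by rw [abs_of_nonneg hs0]; exact hs2.le)]
      simp
  set μ : Measure ℝ := volume.restrict (Ioc (1 : ℝ) 2) with hμ
  set n : ℝ → ℝ := (Icc (-(2 * R)) (2 * R)).indicator m with hn
  have hni : Integrable n := (integrable_indicator_iff measurableSet_Icc).2 hm
  have hS : MeasurableSet {z : ℝ × ℝ | |z.1| / R < z.2} :=
    measurableSet_lt (by fun_prop) (by fun_prop)
  have hρi : Integrable (fun r => -deriv ρ r) μ := (hint 1 2).neg.1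
  have hprod : Integrable (fun z : ℝ × ℝ =>
      {z : ℝ × ℝ | |z.1| / R < z.2}.indicator (fun z => n z.1 * -deriv ρ z.2) z)
      (volume.prod μ) :=
    (hni.mul_prod hρi).indicator hS
  have hind : ∀ x r : ℝ, {z : ℝ × ℝ | |z.1| / R < z.2}.indicator (fun z => n z.1 * -deriv ρ z.2)
      (x, r) = n x * (Ioi (|x| / R)).indicator (fun r => -deriv ρ r) r := by
    intro x r
    by_cases hxr : |x| / R < r
    · rw [indicator_of_mem (by exact hxr), indicator_of_mem (by exact hxr)]
    · rw [indicator_of_notMem (by exact hxr), indicator_of_notMem (by exact hxr), mul_zero]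
  have hl : ∀ x, m x * ρ (x / R) = ∫ r, {z : ℝ × ℝ | |z.1| / R < z.2}.indicator
      (fun z => n z.1 * -deriv ρ z.2) (x, r) ∂μ := by
    intro x
    simp only [hind]
    rw [integral_const_mul, hrep]
    by_cases hx : x ∈ Icc (-(2 * R)) (2 * R)
    · rw [hn, indicator_of_mem hx]
    · rw [hn, indicator_of_notMem hx, zero_mul, h.eq_zero, mul_zero]
      rw [abs_div, abs_of_pos hR, le_div_iff₀ hR]
      by_contra hcon
      exact hx (abs_le.1 (not_le.1 hcon).le)
  simp only [hl]
  rw [integral_integral_swap hprod]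
  have hr : ∀ r ∈ Ioc (1 : ℝ) 2, ∫ x, {z : ℝ × ℝ | |z.1| / R < z.2}.indicator
      (fun z => n z.1 * -deriv ρ z.2) (x, r) = -deriv ρ r * ∫ x in (-(r * R))..(r * R), m x := by
    intro r hr
    have hrR : 0 < r * R := mul_pos (by linarith [hr.1]) hR
    have hrR2 : r * R ≤ 2 * R := mul_le_mul_of_nonneg_right hr.2 hR.le
    have e : ∀ x, {z : ℝ × ℝ | |z.1| / R < z.2}.indicator (fun z => n z.1 * -deriv ρ z.2) (x, r) =
        -deriv ρ r * (Ioo (-(r * R)) (r * R)).indicator m x := by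
      intro x
      by_cases hxr : |x| / R < r
      · have hx := abs_lt.1 ((div_lt_iff₀ hR).1 hxr)
        rw [indicator_of_mem (by exact hxr), indicator_of_mem (by exact hx)]
        simp only [hn]
        rw [indicator_of_mem (mem_Icc.2 ⟨by linarith [hx.1], by linarith [hx.2]⟩), mul_comm]
      · rw [indicator_of_notMem (by exact hxr), indicator_of_notMem, mul_zero]
        exact fun hx => hxr ((div_lt_iff₀ hR).2 (abs_lt.2 hx))
    simp only [e]
    rw [integral_const_mul, integral_indicator measurableSet_Ioo,
      intervalIntegral.integral_of_le (by linarith), integral_Ioc_eq_integral_Ioo]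
  -- The density has total mass `ρ 1 - ρ 2 = 1`.
  have hone : ∫ r, -deriv ρ r * c ∂μ = c := by
    rw [integral_mul_const, hμ, ← intervalIntegral.integral_of_le one_le_two,
      intervalIntegral.integral_neg, intervalIntegral.integral_eq_sub_of_hasDerivAt
        (fun r _ => hd r) (hint _ _), h.eq_zero 2 (by norm_num), h.eq_one 1 (by norm_num)]
    ring
  rw [← hone]
  refine integral_mono_ae (hρi.mul_const c) hprod.integral_prod_right ?_
  filter_upwards [ae_restrict_mem measurableSet_Ioc] with r hrm
  rw [hr r hrm]
  refine mul_le_mul_of_nonneg_left (hc _ ?_) (neg_nonneg.2 (hle r (by linarith [hrm.1])))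
  nlinarith [hrm.1]

theorem exists_young {p q : ℝ} (hpq : p.HolderConjugate q) {ε : ℝ} (hε : 0 < ε) :
    ∃ K, 0 ≤ K ∧ ∀ s b : ℝ, 0 ≤ s → 0 ≤ b → s * b ≤ ε * s ^ p + K * b ^ q := by
  have hp0 : 0 < p := hpq.pos
  have hq0 : 0 < q := hpq.symm.pos
  have hp1 : 1 ≤ p := hpq.lt.le
  -- The next choice, `c = ε ^ (1/p)`, splits `s b` as `(c s)(c⁻¹ b)`, placing exactly `ε` in front
  -- of `s ^ p`.
  have hq1 : 1 ≤ q := hpq.symm.lt.le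
  set c := ε ^ (1 / p) with hc
  have hc0 : 0 < c := Real.rpow_pos_of_pos hε _
  refine ⟨(c⁻¹) ^ q, by positivity, fun s b hs hb => ?_⟩
  have h := Real.young_inequality_of_nonneg (mul_nonneg hc0.le hs)
    (mul_nonneg (inv_nonneg.2 hc0.le) hb) hpq
  have hcp : c ^ p = ε := by
    rw [hc, ← Real.rpow_mul hε.le, one_div_mul_cancel hp0.ne', Real.rpow_one]
  rw [Real.mul_rpow hc0.le hs, Real.mul_rpow (inv_nonneg.2 hc0.le) hb, hcp] at h
  have h1 : ε * s ^ p / p ≤ ε * s ^ p := div_le_self (by positivity) hp1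
  have h2 : (c⁻¹) ^ q * b ^ q / q ≤ (c⁻¹) ^ q * b ^ q := div_le_self (by positivity) hq1
  have h3 : c * s * (c⁻¹ * b) = s * b := by field_simp
  linarith

theorem integral_div_one_add_rpow_le {k T : ℝ} (hk : 1 < k) (hT : 0 ≤ T) :
    ∫ t in (0 : ℝ)..T, 1 / (1 + t) ^ k ≤ 1 / (k - 1) := by
  have hk1 : 0 < k - 1 := sub_pos.2 hk
  have hd : ∀ t ∈ uIcc 0 T, HasDerivAt (fun t : ℝ => -((1 + t) ^ (1 - k) / (k - 1)))
      (1 / (1 + t) ^ k) t := by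
    intro t ht
    rw [uIcc_of_le hT] at ht
    have h1 : 0 < 1 + t := by linarith [ht.1]
    have h2 := (((hasDerivAt_id t).const_add 1).rpow_const (p := 1 - k) (Or.inl h1.ne')).div_const
      (k - 1)
    refine h2.neg.congr_deriv ?_
    simp only [id]
    rw [show 1 - k - 1 = -k by ring, Real.rpow_neg h1.le]
    field_simp
    ring
  have hc : ContinuousOn (fun t : ℝ => 1 / (1 + t) ^ k) (uIcc 0 T) := by
    rw [uIcc_of_le hT]
    have hpos : ∀ t ∈ Icc 0 T, 0 < 1 + t := fun t ht => by linarith [ht.1]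
    exact continuousOn_const.div ((by fun_prop : ContinuousOn (fun t : ℝ => 1 + t) _).rpow_const
      fun t ht => Or.inl (hpos t ht).ne') fun t ht => (Real.rpow_pos_of_pos (hpos t ht) k).ne'
  rw [intervalIntegral.integral_eq_sub_of_hasDerivAt hd hc.intervalIntegrable]
  have : 0 ≤ (1 + T) ^ (1 - k) / (k - 1) := by positivity
  simp only [add_zero, Real.one_rpow]
  linarith

/-! ### Product rules for the partial derivatives -/

section

variable {T : EReal} {f g : ℝ → ℝ → ℝ}

theorem dt_congr (h : ∀ t, 0 ≤ t → ∀ x, f t x = g t x) {t : ℝ} (ht : 0 ≤ t) (x : ℝ) :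
    dt f t x = dt g t x :=
  derivWithin_congr (fun s hs => h s hs x) (h t ht x)

theorem dx_congr {t : ℝ} (h : ∀ x, f t x = g t x) (x : ℝ) : dx f t x = dx g t x := by
  simp only [dx, h]

namespace IsSmooth

theorem dt_mul (hf : IsSmooth T 1 f) (hg : IsSmooth T 1 g) {t : ℝ} (ht : t ∈ timeInterval T)
    (x : ℝ) : DampedWave.dt (fun t x => f t x * g t x) t x =
      DampedWave.dt f t x * g t x + f t x * DampedWave.dt g t x :=
  ((hf.hasDerivWithinAt_dt ht x).mul (hg.hasDerivWithinAt_dt ht x)).derivWithin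
    (uniqueDiffOn_Ici 0 t ht.1)

theorem dx_mul (hf : IsSmooth T 1 f) (hg : IsSmooth T 1 g) {t : ℝ} (ht : t ∈ timeInterval T)
    (x : ℝ) : DampedWave.dx (fun t x => f t x * g t x) t x =
      DampedWave.dx f t x * g t x + f t x * DampedWave.dx g t x :=
  ((hf.hasDerivAt_dx ht x).mul (hg.hasDerivAt_dx ht x)).deriv

theorem dt_add (hf : IsSmooth T 1 f) (hg : IsSmooth T 1 g) {t : ℝ} (ht : t ∈ timeInterval T)
    (x : ℝ) : DampedWave.dt (fun t x => f t x + g t x) t x =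
      DampedWave.dt f t x + DampedWave.dt g t x :=
  ((hf.hasDerivWithinAt_dt ht x).add (hg.hasDerivWithinAt_dt ht x)).derivWithin
    (uniqueDiffOn_Ici 0 t ht.1)

theorem dx_add (hf : IsSmooth T 1 f) (hg : IsSmooth T 1 g) {t : ℝ} (ht : t ∈ timeInterval T)
    (x : ℝ) : DampedWave.dx (fun t x => f t x + g t x) t x =
      DampedWave.dx f t x + DampedWave.dx g t x :=
  ((hf.hasDerivAt_dx ht x).add (hg.hasDerivAt_dx ht x)).deriv

theorem mem_timeInterval_top {t : ℝ} : t ∈ timeInterval ⊤ ↔ 0 ≤ t := by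
  rw [timeInterval_top, mem_Ici]

theorem dt_dt_mul (hf : IsSmooth ⊤ 2 f) (hg : IsSmooth ⊤ 2 g) {t : ℝ} (ht : 0 ≤ t) (x : ℝ) :
    DampedWave.dt (DampedWave.dt fun t x => f t x * g t x) t x =
      DampedWave.dt (DampedWave.dt f) t x * g t x +
        2 * (DampedWave.dt f t x * DampedWave.dt g t x) +
        f t x * DampedWave.dt (DampedWave.dt g) t x := by
  have hm : ∀ {t : ℝ}, 0 ≤ t → t ∈ timeInterval ⊤ := mem_timeInterval_top.2
  rw [dt_congr (fun t ht x => hf.one.dt_mul hg.one (hm ht) x) ht x,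
    dt_add (hf.dt_one.mul hg.one) (hf.one.mul hg.dt_one) (hm ht), dt_mul hf.dt_one hg.one (hm ht),
    dt_mul hf.one hg.dt_one (hm ht)]
  ring

theorem dx_dx_mul (hf : IsSmooth T 2 f) (hg : IsSmooth T 2 g) {t : ℝ} (ht : t ∈ timeInterval T)
    (x : ℝ) : DampedWave.dx (DampedWave.dx fun t x => f t x * g t x) t x =
      DampedWave.dx (DampedWave.dx f) t x * g t x +
        2 * (DampedWave.dx f t x * DampedWave.dx g t x) +
        f t x * DampedWave.dx (DampedWave.dx g) t x := by
  rw [dx_congr (g := fun t x => DampedWave.dx f t x * g t x + f t x * DampedWave.dx g t x)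
      (fun x => hf.one.dx_mul hg.one ht x) x,
    dx_add (hf.dx_one.mul hg.one) (hf.one.mul hg.dx_one) ht, dx_mul hf.dx_one hg.one ht,
    dx_mul hf.one hg.dx_one ht]
  ring

end IsSmooth

end

/-! ### Testing with a weight times a cut-off -/

/-- The weights `g` that solve the adjoint equation `g_tt - g_xx - a g_t - a_t g = 0` and stay
between positive constants, with decaying first derivatives. -/
structure IsWeight (a : ℝ → ℝ → ℝ) (k c K : ℝ) (g : ℝ → ℝ → ℝ) : Prop where
  contDiff : IsC2 g
  equation : ∀ t, 0 ≤ t → ∀ x,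
    dt (dt g) t x - dx (dx g) t x - a t x * dt g t x - dt a t x * g t x = 0
  lower : ∀ t, 0 ≤ t → ∀ x, c ≤ g t x
  upper : ∀ t, 0 ≤ t → ∀ x, g t x ≤ K
  bound_dt : ∀ t, 0 ≤ t → ∀ x, |dt g t x| ≤ K / (1 + t) ^ k
  bound_dx : ∀ t, 0 ≤ t → ∀ x, |dx g t x| ≤ K / (1 + t) ^ k
  bound_coeff : ∀ t, 0 ≤ t → ∀ x, |a t x| ≤ K / (1 + t) ^ k

/-- The space-time cut-off at scale `R`. -/
def cutoff (ρ : ℝ → ℝ) (R t x : ℝ) : ℝ := ρ (t / R) * ρ (x / R)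

section

variable {p C R : ℝ} {ρ : ℝ → ℝ} {a g : ℝ → ℝ → ℝ} {k c K : ℝ}

theorem IsCutoff.hasDerivAt_div (h : IsCutoff p C ρ) (R s : ℝ) :
    HasDerivAt (fun s => ρ (s / R)) (deriv ρ (s / R) / R) s := by
  have h1 := ((h.contDiff.differentiable (by norm_num)) (s / R)).hasDerivAt.comp s
    ((hasDerivAt_id s).div_const R)
  exact h1.congr_deriv (by ring)

theorem IsCutoff.hasDerivAt_deriv_div (h : IsCutoff p C ρ) (R s : ℝ) :
    HasDerivAt (fun s => deriv ρ (s / R) / R) (deriv (deriv ρ) (s / R) / R ^ 2) s := by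
  have hd : ContDiff ℝ 1 (deriv ρ) :=
    ((contDiff_succ_iff_deriv (n := 1)).1 (h.contDiff.of_le (by norm_num))).2.2
  have h1 := (((hd.differentiable (by norm_num)) (s / R)).hasDerivAt.comp s
    ((hasDerivAt_id s).div_const R)).div_const R
  exact h1.congr_deriv (by ring)

theorem IsCutoff.isSmooth_cutoff (h : IsCutoff p C ρ) (R : ℝ) (T : EReal) :
    IsSmooth T 2 (cutoff ρ R) := by
  have h1 : ContDiff ℝ 2 fun z : ℝ × ℝ => ρ (z.1 / R) := h.contDiff.comp (by fun_prop)
  have h2 : ContDiff ℝ 2 fun z : ℝ × ℝ => ρ (z.2 / R) := h.contDiff.comp (by fun_prop)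
  exact (h1.mul h2).contDiffOn

theorem IsCutoff.vanishesOff_cutoff (h : IsCutoff p C ρ) (hR : 0 < R) (T : EReal) :
    VanishesOff T (2 * R) (2 * R) (cutoff ρ R) := by
  intro t ht x hx
  rcases hx with hx | hx
  · rw [cutoff, h.eq_zero, zero_mul]
    rw [abs_div, abs_of_pos hR, abs_of_nonneg ht.1, le_div_iff₀ hR]
    exact hx.le
  · rw [cutoff, h.eq_zero (x / R), mul_zero]
    rw [abs_div, abs_of_pos hR, le_div_iff₀ hR]
    by_contra hcon
    exact hx (abs_le.1 (not_le.1 hcon).le)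

theorem IsCutoff.dt_cutoff (h : IsCutoff p C ρ) {t : ℝ} (ht : 0 ≤ t) (x : ℝ) :
    dt (cutoff ρ R) t x = deriv ρ (t / R) / R * ρ (x / R) :=
  dt_eq_of_hasDerivAt ht ((h.hasDerivAt_div R t).mul_const _)

theorem IsCutoff.dt_dt_cutoff (h : IsCutoff p C ρ) {t : ℝ} (ht : 0 ≤ t) (x : ℝ) :
    dt (dt (cutoff ρ R)) t x = deriv (deriv ρ) (t / R) / R ^ 2 * ρ (x / R) := by
  rw [dt_congr (fun t ht x => h.dt_cutoff ht x) ht]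
  exact dt_eq_of_hasDerivAt ht ((h.hasDerivAt_deriv_div R t).mul_const _)

theorem IsCutoff.dx_cutoff (h : IsCutoff p C ρ) (t x : ℝ) :
    dx (cutoff ρ R) t x = ρ (t / R) * (deriv ρ (x / R) / R) :=
  ((h.hasDerivAt_div R x).const_mul _).deriv

theorem IsCutoff.dx_dx_cutoff (h : IsCutoff p C ρ) (t x : ℝ) :
    dx (dx (cutoff ρ R)) t x = ρ (t / R) * (deriv (deriv ρ) (x / R) / R ^ 2) := by
  rw [dx_congr (g := fun t x => ρ (t / R) * (deriv ρ (x / R) / R)) (h.dx_cutoff t)]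
  exact ((h.hasDerivAt_deriv_div R x).const_mul _).deriv

theorem IsCutoff.cutoff_nonneg (h : IsCutoff p C ρ) (R t x : ℝ) : 0 ≤ cutoff ρ R t x :=
  mul_nonneg (h.nonneg _) (h.nonneg _)

theorem IsCutoff.le_rpow (h : IsCutoff p C ρ) (hp : 1 < p) (s : ℝ) : ρ s ≤ ρ s ^ (1 / p) := by
  have := Real.rpow_le_rpow_of_exponent_ge' (h.nonneg s) (h.le_one s) (z := 1 / p) (y := 1)
    (by positivity) (by rw [div_le_one (by linarith)]; exact hp.le)
  rwa [Real.rpow_one] at this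

/-- The undifferentiated factor satisfies `ρ ≤ ρ ^ (1/p)` because it lies in `[0, 1]`; hence
derivatives of the product are controlled by the power `1/p` of the whole cut-off. -/
theorem IsCutoff.abs_mul_le (h : IsCutoff p C ρ) (hp : 1 < p) {q s r n : ℝ}
    (hq : |q| ≤ C * ρ s ^ (1 / p)) (hn : 0 < n) :
    |q / n * ρ r| ≤ C * (ρ s * ρ r) ^ (1 / p) / n := by
  rw [Real.mul_rpow (h.nonneg _) (h.nonneg _), abs_mul, abs_div, abs_of_pos hn,
    abs_of_nonneg (h.nonneg r), div_mul_eq_mul_div, ← mul_assoc]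
  have := (abs_nonneg q).trans hq
  have := h.nonneg r
  gcongr
  exact h.le_rpow hp r

/-- The wave operator applied to the product of a weight and a cut-off. -/
theorem IsWeight.abs_waveOperator_le (hg : IsWeight a k c K g) (ha : IsC2 a) (hc : 0 < c)
    (h : IsCutoff p C ρ) (hC : 0 ≤ C) (hp : 1 < p) (hR : 0 < R) {t : ℝ} (ht : 0 ≤ t) (x : ℝ) :
    |dt (dt fun t x => g t x * cutoff ρ R t x) t x - dx (dx fun t x => g t x * cutoff ρ R t x) t x -
        dt (fun s y => a s y * (g s y * cutoff ρ R s y)) t x| ≤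
      C * (K * (4 + K)) * cutoff ρ R t x ^ (1 / p) * (1 / R ^ 2 + 1 / R * (1 / (1 + t) ^ k)) := by
  have hm := IsSmooth.mem_timeInterval_top.2 ht
  have hgs : IsSmooth ⊤ 2 g := IsSmooth.of_isC2 hg.contDiff
  have has : IsSmooth ⊤ 2 a := IsSmooth.of_isC2 ha
  have hφ := h.isSmooth_cutoff R ⊤
  rw [IsSmooth.dt_dt_mul hgs hφ ht, IsSmooth.dx_dx_mul hgs hφ hm,
    IsSmooth.dt_mul has.one (hgs.mul hφ).one hm, IsSmooth.dt_mul hgs.one hφ.one hm]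
  have heq := hg.equation t ht x
  have hk0 : 0 < (1 + t) ^ k := Real.rpow_pos_of_pos (by linarith) k
  set Φ := cutoff ρ R t x with hΦ
  set X := Φ ^ (1 / p) with hX
  have hX0 : 0 ≤ X := Real.rpow_nonneg (h.cutoff_nonneg R t x) _
  have b1 : |dt (cutoff ρ R) t x| ≤ C * X / R := by
    rw [h.dt_cutoff ht]
    exact h.abs_mul_le hp (h.bound _) hR
  have b2 : |dt (dt (cutoff ρ R)) t x| ≤ C * X / R ^ 2 := by
    rw [h.dt_dt_cutoff ht]
    exact h.abs_mul_le hp (h.bound_two _) (by positivity)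
  have b3 : |dx (cutoff ρ R) t x| ≤ C * X / R := by
    rw [h.dx_cutoff, mul_comm]
    refine (h.abs_mul_le hp (h.bound _) hR).trans_eq ?_
    rw [mul_comm (ρ (x / R))]
    rfl
  have b4 : |dx (dx (cutoff ρ R)) t x| ≤ C * X / R ^ 2 := by
    rw [h.dx_dx_cutoff, mul_comm]
    refine (h.abs_mul_le hp (h.bound_two _) (by positivity)).trans_eq ?_
    rw [mul_comm (ρ (x / R))]
    rfl
  have hg1 : |g t x| ≤ K := by
    rw [abs_of_nonneg (hc.le.trans (hg.lower t ht x))]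
    exact hg.upper t ht x
  have hK : 0 ≤ K := (abs_nonneg _).trans hg1
  set κ := 1 / (1 + t) ^ k with hκ
  have hκ0 : 0 ≤ κ := by positivity
  have g1 : |dt g t x| ≤ K * κ := by rw [hκ, mul_one_div]; exact hg.bound_dt t ht x
  have g2 : |dx g t x| ≤ K * κ := by rw [hκ, mul_one_div]; exact hg.bound_dx t ht x
  have g3 : |a t x| ≤ K * κ := by rw [hκ, mul_one_div]; exact hg.bound_coeff t ht x
  -- The adjoint equation times `Φ` removes every term without a derivative of the cut-off. In the
  -- rest, each first derivative of the cut-off is multiplied by a decaying factor.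
  have hid : dt (dt g) t x * Φ + 2 * (dt g t x * dt (cutoff ρ R) t x) +
        g t x * dt (dt (cutoff ρ R)) t x -
      (dx (dx g) t x * Φ + 2 * (dx g t x * dx (cutoff ρ R) t x) +
        g t x * dx (dx (cutoff ρ R)) t x) -
      (dt a t x * (g t x * Φ) + a t x * (dt g t x * Φ + g t x * dt (cutoff ρ R) t x)) =
      2 * (dt g t x * dt (cutoff ρ R) t x) + g t x * dt (dt (cutoff ρ R)) t x -
        2 * (dx g t x * dx (cutoff ρ R) t x) - g t x * dx (dx (cutoff ρ R)) t x -
        a t x * g t x * dt (cutoff ρ R) t x := by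
    linear_combination Φ * heq
  rw [hid]
  have c1 : |dt g t x * dt (cutoff ρ R) t x| ≤ K * κ * (C * X / R) := by
    rw [abs_mul]; gcongr
  have c2 : |g t x * dt (dt (cutoff ρ R)) t x| ≤ K * (C * X / R ^ 2) := by
    rw [abs_mul]; gcongr
  have c3 : |dx g t x * dx (cutoff ρ R) t x| ≤ K * κ * (C * X / R) := by
    rw [abs_mul]; gcongr
  have c4 : |g t x * dx (dx (cutoff ρ R)) t x| ≤ K * (C * X / R ^ 2) := by
    rw [abs_mul]; gcongr
  have c5 : |a t x * g t x * dt (cutoff ρ R) t x| ≤ K * κ * K * (C * X / R) := by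
    rw [abs_mul, abs_mul]; gcongr
  have hfin : 2 * (K * κ * (C * X / R)) + K * (C * X / R ^ 2) + 2 * (K * κ * (C * X / R)) +
      K * (C * X / R ^ 2) + K * κ * K * (C * X / R) ≤
      C * (K * (4 + K)) * X * (1 / R ^ 2 + 1 / R * κ) := by
    have e1 : C * (K * (4 + K)) * X * (1 / R ^ 2 + 1 / R * κ) =
        4 * (K * κ * (C * X / R)) + K * κ * K * (C * X / R) + (4 + K) * (K * (C * X / R ^ 2)) := by
      field_simp
      ring
    have : 0 ≤ K * (C * X / R ^ 2) := by positivity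
    rw [e1]
    nlinarith
  rw [abs_le] at c1 c2 c3 c4 c5 ⊢
  constructor <;> linarith [c1.1, c1.2, c2.1, c2.2, c3.1, c3.2, c4.1, c4.2, c5.1, c5.2]

end

section

variable {p C R : ℝ} {ρ : ℝ → ℝ} {a g : ℝ → ℝ → ℝ} {k c K : ℝ} {u₀ : H1} {u₁ : L2} {B : ℝ≥0}

/-- Young's inequality absorbs the linear term into the nonlinear one and leaves an error
independent of the solution. The error tends to zero with `R` for every `p > 1`, because the decay
of the weight makes `R ∫ b` bounded. -/
theorem IsWeight.exists_initial_le (hg : IsWeight a k c K g) (ha : IsC2 a)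
    (hA : IsCoeff (freeze a) B) (hk : 1 < k) (hc : 0 < c) (h : IsCutoff p C ρ) (hC : 0 ≤ C)
    (hp : 1 < p) : ∃ D, 0 ≤ D ∧ ∀ R, 1 ≤ R → ∀ (M : ℝ) (u : ℝ → H1) (w : ℝ → L2), 0 ≤ M →
      IsMild (freeze a) p M (3 * R) u₀ u₁ u w →
      ∫ x, ((a 0 x * toL2 u₀ x + u₁ x) * (g 0 x * cutoff ρ R 0 x) -
        toL2 u₀ x * dt (fun t x => g t x * cutoff ρ R t x) 0 x) ≤
      D * (2 / R) ^ (p.conjExponent - 1) := by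
  set q := p.conjExponent with hqdef
  have hpq : p.HolderConjugate q := Real.HolderConjugate.conjExponent hp
  have hq1 : 1 < q := hpq.symm.lt
  have hK : 0 ≤ K := hc.le.trans ((hg.lower 0 le_rfl 0).trans (hg.upper 0 le_rfl 0))
  -- Since `g ≥ c`, the choice `c / 2` costs only half of the nonlinear term `∫ |u|^p g Φ`.
  obtain ⟨K₁, hK₁, hY⟩ := exists_young hpq (half_pos hc)
  set A := C * (K * (4 + K)) with hAdef
  have hA0 : 0 ≤ A := by positivity
  have hk1 : 0 < k - 1 := sub_pos.2 hk
  refine ⟨4 * (K₁ * A ^ q) * (3 + 1 / (k - 1)), by positivity, fun R hR M u w hM hmild => ?_⟩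
  have hR0 : 0 < R := zero_lt_one.trans_le hR
  set ψ : ℝ → ℝ → ℝ := fun t x => g t x * cutoff ρ R t x with hψ
  have hgs : IsSmooth ⊤ 2 g := IsSmooth.of_isC2 hg.contDiff
  have hψs : IsSmooth ⊤ 2 ψ := hgs.mul (h.isSmooth_cutoff R ⊤)
  have hv : VanishesOff ⊤ (2 * R) (2 * R) ψ := (h.vanishesOff_cutoff hR0 ⊤).mul_left g
  -- The cut-off vanishes for `t ≥ 2R`; any time strictly beyond serves as upper limit.
  have hT : 3 * R ∈ timeInterval ⊤ := IsSmooth.mem_timeInterval_top.2 (by positivity)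
  have hid := hmild.integral_identity hA ha hp hM hψs hv hT (by linarith)
  have hsub := Icc_subset_timeInterval hT
  set L : ℝ → ℝ → ℝ := fun t x =>
    dt (dt ψ) t x - dx (dx ψ) t x - dt (fun s y => a s y * ψ s y) t x with hL
  set b : ℝ → ℝ := fun t => 1 / R ^ 2 + 1 / R * (1 / (1 + t) ^ k) with hb
  have haψs : IsSmooth ⊤ 2 fun t x => a t x * ψ t x := (IsSmooth.of_isC2 ha).mul hψs
  have hLc : IsTestCurve (Icc 0 (3 * R)) L := by
    refine IsTestCurve.mono (s := timeInterval ⊤) ⟨(hψs.dt_one.dt_zero.continuousOn.sub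
      hψs.dx_one.dx_zero.continuousOn).sub haψs.one.dt_zero.continuousOn, 2 * R,
      fun t ht x hx => ?_⟩ hsub
    simp only [hL, hv.dt.dt t ht x (Or.inr hx), hv.dx.dx t ht x (Or.inr hx),
      (hv.mul_left a).dt t ht x (Or.inr hx), sub_zero]
  have hψc : IsTestCurve (Icc 0 (3 * R)) ψ := (hv.isTestCurve hψs).mono hsub
  have hbk : ∀ t : ℝ, 0 ≤ t → 1 ≤ (1 + t) ^ k := fun t ht =>
    Real.one_le_rpow (by linarith) (by linarith)
  have hb0 : ∀ t, 0 ≤ t → 0 ≤ b t := fun t ht => by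
    have := hbk t ht
    simp only [hb]; positivity
  have hb2 : ∀ t, 0 ≤ t → b t ≤ 2 / R := fun t ht => by
    have e1 : 1 / R ^ 2 ≤ 1 / R := one_div_le_one_div_of_le hR0 (by nlinarith)
    have e2 : 1 / R * (1 / (1 + t) ^ k) ≤ 1 / R * 1 :=
      mul_le_mul_of_nonneg_left (div_le_one_of_le₀ (hbk t ht) (by linarith [hbk t ht]))
        (by positivity)
    have e3 : 2 / R = 1 / R + 1 / R := by ring
    simp only [hb]
    linarith
  -- Of the power `b ^ q`, the part `b ^ (q - 1)` is estimated by the supremum `2 / R` and produces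
  -- the decay; one factor `b` is kept for integration.
  have hbq : ∀ t, 0 ≤ t → K₁ * (A * b t) ^ q ≤ K₁ * A ^ q * (2 / R) ^ (q - 1) * b t := by
    intro t ht
    have hp0 : 0 < b t := by
      have := hbk t ht
      simp only [hb]; positivity
    have e1 : b t ^ q = b t ^ (q - 1) * b t := by
      rw [← Real.rpow_add_one hp0.ne', sub_add_cancel]
    have e2 : b t ^ (q - 1) ≤ (2 / R) ^ (q - 1) :=
      Real.rpow_le_rpow hp0.le (hb2 t ht) (by linarith)
    rw [Real.mul_rpow hA0 hp0.le, e1, mul_assoc, mul_assoc]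
    gcongr
  -- The factor `4R` is the length of the interval containing the support in space.
  have hbd : ∀ t ∈ Icc 0 (3 * R), pair (toL2 (u t)) (L t) ≤
      1 / 2 * pair (nem p M (toL2 (u t))) (ψ t) +
        4 * R * (K₁ * A ^ q * (2 / R) ^ (q - 1) * b t) := by
    intro t ht
    set β := K₁ * A ^ q * (2 / R) ^ (q - 1) * b t with hβ
    have i1 : Integrable fun x => toL2 (u t) x * L t x :=
      MemLp.integrable_mul (Lp.memLp (toL2 (u t))) (hLc.memLp ht)
    have i2 : Integrable fun x => nem p M (toL2 (u t)) x * ψ t x :=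
      MemLp.integrable_mul (Lp.memLp (nem p M (toL2 (u t)))) (hψc.memLp ht)
    have i3 : Integrable ((Icc (-(2 * R)) (2 * R)).indicator fun _ => β) :=
      (integrable_indicator_iff measurableSet_Icc).2 (by simp)
    have e3 : ∫ x, (Icc (-(2 * R)) (2 * R)).indicator (fun _ => β) x = 4 * R * β := by
      rw [integral_indicator measurableSet_Icc, setIntegral_const, Real.volume_real_Icc_of_le
        (by linarith), smul_eq_mul]
      ring
    rw [← e3, pair, pair, ← integral_const_mul, ← integral_add (i2.const_mul _) i3]
    refine integral_mono_ae i1 ((i2.const_mul _).add i3) ?_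
    filter_upwards [nem_ae_of_le hp hM (hmild.bound t ht)] with x hx
    simp only [hx]
    by_cases hxR : x ∈ Icc (-(2 * R)) (2 * R)
    · rw [indicator_of_mem hxR]
      set Φ := cutoff ρ R t x with hΦ
      have hΦ0 : 0 ≤ Φ := h.cutoff_nonneg R t x
      have hX0 : 0 ≤ Φ ^ (1 / p) := Real.rpow_nonneg hΦ0 _
      have hw := hg.abs_waveOperator_le ha hc h hC hp hR0 ht.1 x
      have hy := hY (|toL2 (u t) x| * Φ ^ (1 / p)) (A * b t) (by positivity)
        (mul_nonneg hA0 (hb0 t ht.1))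
      have e4 : (|toL2 (u t) x| * Φ ^ (1 / p)) ^ p = |toL2 (u t) x| ^ p * Φ := by
        rw [Real.mul_rpow (abs_nonneg _) hX0, ← Real.rpow_mul hΦ0,
          one_div_mul_cancel (by linarith), Real.rpow_one]
      rw [e4] at hy
      have e5 : toL2 (u t) x * L t x ≤ |toL2 (u t) x| * (A * Φ ^ (1 / p) * b t) := by
        refine (le_abs_self _).trans ?_
        rw [abs_mul]
        exact mul_le_mul_of_nonneg_left hw (abs_nonneg _)
      have e6 : c * (|toL2 (u t) x| ^ p * Φ) ≤ g t x * (|toL2 (u t) x| ^ p * Φ) :=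
        mul_le_mul_of_nonneg_right (hg.lower t ht.1 x)
          (mul_nonneg (Real.rpow_nonneg (abs_nonneg _) _) hΦ0)
      have e7 := hbq t ht.1
      have e8 : |toL2 (u t) x| ^ p * ψ t x = g t x * (|toL2 (u t) x| ^ p * Φ) := by
        simp only [hψ]; ring
      rw [e8]
      linarith
    · rw [indicator_of_notMem hxR]
      have hts := hsub ht
      have z1 : L t x = 0 := by
        simp only [hL, hv.dt.dt t hts x (Or.inr hxR), hv.dx.dx t hts x (Or.inr hxR),
          (hv.mul_left a).dt t hts x (Or.inr hxR), sub_zero]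
      simp [z1, hv t hts x (Or.inr hxR)]
  have hT0 : (0 : ℝ) ≤ 3 * R := by positivity
  have hnc : ContinuousOn (fun t => pair (nem p M (toL2 (u t))) (ψ t)) (Icc 0 (3 * R)) :=
    hψc.continuousOn_pair ((lipschitzWith_nem hp hM).continuous.comp_continuousOn
      (continuousOn_H1_iff.1 hmild.continuousOn).1)
  have huc : ContinuousOn (fun t => pair (toL2 (u t)) (L t)) (Icc 0 (3 * R)) :=
    hLc.continuousOn_pair (continuousOn_H1_iff.1 hmild.continuousOn).1
  have hbc : ContinuousOn b (Icc 0 (3 * R)) := by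
    have hpos : ∀ t ∈ Icc 0 (3 * R), 0 < 1 + t := fun t ht => by linarith [ht.1]
    exact continuousOn_const.add (continuousOn_const.mul (continuousOn_const.div
      ((by fun_prop : ContinuousOn (fun t : ℝ => 1 + t) _).rpow_const
        fun t ht => Or.inl (hpos t ht).ne') fun t ht => (Real.rpow_pos_of_pos (hpos t ht) k).ne'))
  have iN : IntervalIntegrable (fun t => 1 / 2 * pair (nem p M (toL2 (u t))) (ψ t)) volume 0
      (3 * R) := (hnc.const_smul (1 / 2 : ℝ)).intervalIntegrable_of_Icc hT0
  have iB : IntervalIntegrable (fun t => 4 * R * (K₁ * A ^ q * (2 / R) ^ (q - 1) * b t)) volume 0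
      (3 * R) :=
    ((hbc.const_smul (K₁ * A ^ q * (2 / R) ^ (q - 1))).const_smul
      (4 * R)).intervalIntegrable_of_Icc hT0
  have hmono := intervalIntegral.integral_mono_on hT0 (huc.intervalIntegrable_of_Icc hT0)
    (iN.add iB) hbd
  rw [intervalIntegral.integral_add iN iB, intervalIntegral.integral_const_mul,
    intervalIntegral.integral_const_mul, intervalIntegral.integral_const_mul] at hmono
  -- The part `R⁻²` contributes `3`, and the integrable tail of order `k > 1` contributes at most `1
  -- / (k - 1)`.
  have hbint : R * ∫ t in (0 : ℝ)..3 * R, b t ≤ 3 + 1 / (k - 1) := by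
    have e1 : IntervalIntegrable (fun t : ℝ => 1 / R * (1 / (1 + t) ^ k)) volume 0 (3 * R) := by
      refine ((hbc.sub (continuousOn_const (c := 1 / R ^ 2))).congr
        fun t _ => ?_).intervalIntegrable_of_Icc hT0
      simp only [hb, Pi.sub_apply]
      ring
    have e2 := integral_div_one_add_rpow_le hk hT0
    simp only [hb]
    rw [intervalIntegral.integral_add (by simp) e1, intervalIntegral.integral_const_mul]
    have e3 : R * ((∫ _ in (0 : ℝ)..3 * R, 1 / R ^ 2) +
        1 / R * ∫ t in (0 : ℝ)..3 * R, 1 / (1 + t) ^ k) =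
        3 + ∫ t in (0 : ℝ)..3 * R, 1 / (1 + t) ^ k := by
      rw [intervalIntegral.integral_const, smul_eq_mul]
      field_simp
      ring
    rw [e3]
    linarith
  have hpos : 0 ≤ ∫ t in (0 : ℝ)..3 * R, pair (nem p M (toL2 (u t))) (ψ t) := by
    refine intervalIntegral.integral_nonneg hT0 fun t ht => ?_
    rw [pair_nem hp hM (hmild.bound t ht)]
    refine integral_nonneg fun x => mul_nonneg (Real.rpow_nonneg (abs_nonneg _) _)
      (mul_nonneg (hc.le.trans (hg.lower t ht.1 x)) (h.cutoff_nonneg R t x))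
  have hN : ∫ t in (0 : ℝ)..3 * R, ∫ x, |toL2 (u t) x| ^ p * ψ t x =
      ∫ t in (0 : ℝ)..3 * R, pair (nem p M (toL2 (u t))) (ψ t) := by
    refine intervalIntegral.integral_congr fun t ht => ?_
    rw [uIcc_of_le hT0] at ht
    exact (pair_nem hp hM (hmild.bound t ht) (ψ t)).symm
  rw [hN] at hid
  have hlast : 4 * R * (K₁ * A ^ q * (2 / R) ^ (q - 1) * ∫ t in (0 : ℝ)..3 * R, b t) ≤
      4 * (K₁ * A ^ q) * (3 + 1 / (k - 1)) * (2 / R) ^ (q - 1) := by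
    have : 0 ≤ 4 * (K₁ * A ^ q) * (2 / R) ^ (q - 1) := by positivity
    nlinarith [mul_le_mul_of_nonneg_left hbint this]
  have hl : ∫ t in (0 : ℝ)..3 * R, pair (toL2 (u t)) (L t) =
    ∫ t in (0 : ℝ)..3 * R, ∫ x, toL2 (u t) x *
      (dt (dt ψ) t x - dx (dx ψ) t x - dt (fun s y => a s y * ψ s y) t x) := rfl
  rw [hl, hid] at hmono
  linarith

/-- Positivity gives a number `e > 0` below the cut-off data integral for all large `R`, whereas
existence up to `3R` forces that integral below a quantity tending to zero. -/
theorem IsWeight.exists_lifespan_bound (hg : IsWeight a k c K g) (ha : IsC2 a)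
    (hA : IsCoeff (freeze a) B) (hk : 1 < k) (hc : 0 < c) (hp : 1 < p)
    (hd : PositiveData a g u₀ u₁) : ∃ T₀, 0 < T₀ ∧ ∀ T, T₀ ≤ T →
      ∀ (M : ℝ) (u : ℝ → H1) (w : ℝ → L2), 0 ≤ M → ¬ IsMild (freeze a) p M T u₀ u₁ u w := by
  obtain ⟨C, ρ, hC, h⟩ := exists_isCutoff hp
  obtain ⟨D, hD, hJ⟩ := hg.exists_initial_le (u₀ := u₀) (u₁ := u₁) ha hA hk hc h hC hp
  obtain ⟨e, he0, he⟩ := EReal.lt_iff_exists_real_btwn.1 hd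
  have he0 : 0 < e := by exact_mod_cast he0
  obtain ⟨R₀, hR₀⟩ := eventually_atTop.1 (eventually_lt_of_lt_liminf he)
  have hq : 0 < p.conjExponent - 1 :=
    sub_pos.2 (Real.HolderConjugate.conjExponent hp).symm.lt
  have hlim : Tendsto (fun R : ℝ => D * (2 / R) ^ (p.conjExponent - 1)) atTop (𝓝 0) := by
    have h1 : Tendsto (fun R : ℝ => 2 / R) atTop (𝓝 0) := tendsto_const_nhds.div_atTop tendsto_id
    have h2 := (h1.rpow_const (p := p.conjExponent - 1) (Or.inr hq.le)).const_mul D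
    rwa [Real.zero_rpow hq.ne', mul_zero] at h2
  obtain ⟨R, hRe, hRR, hR1⟩ := ((hlim.eventually_lt_const he0).and
    ((eventually_ge_atTop R₀).and (eventually_ge_atTop 1))).exists
  have hR0 : 0 < R := zero_lt_one.trans_le hR1
  refine ⟨3 * R, by positivity, fun T hT M u w hM hmild => ?_⟩
  have h1 := hJ R hR1 M u w hM (hmild.mono hT)
  set m : ℝ → ℝ := fun x => (-dt g 0 x + g 0 x * a 0 x) * toL2 u₀ x + g 0 x * u₁ x with hm
  have hgs : IsSmooth ⊤ 2 g := IsSmooth.of_isC2 hg.contDiff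
  have h0 : (0 : ℝ) ∈ timeInterval ⊤ := IsSmooth.mem_timeInterval_top.2 le_rfl
  have hcont : ∀ {n : WithTop ℕ∞} {f : ℝ → ℝ → ℝ}, IsSmooth ⊤ n f → Continuous (f 0) := by
    intro n f hf
    exact hf.continuousOn.comp_continuous (f := fun x : ℝ => ((0 : ℝ), x)) (by fun_prop)
      fun x => ⟨h0, mem_univ _⟩
  have hloc : ∀ f : L2, IntegrableOn f (Icc (-(2 * R)) (2 * R)) := fun f =>
    ((Lp.memLp f).restrict _).integrable one_le_two
  have hgc := hcont hgs
  have hmi : IntegrableOn m (Icc (-(2 * R)) (2 * R)) := by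
    refine Integrable.add ?_ ?_
    · exact (hloc (toL2 u₀)).continuousOn_mul ((hcont hgs.dt_one).neg.add
        (hgc.mul (hcont (IsSmooth.of_isC2 ha)))).continuousOn isCompact_Icc
    · exact (hloc u₁).continuousOn_mul hgc.continuousOn isCompact_Icc
  have h2 := h.le_integral_mul hR0 hmi (c := e) fun r hr => by
    have := hR₀ r (hRR.trans hr)
    exact_mod_cast this.le
  have hρ0 : ρ 0 = 1 := h.eq_one 0 (by simp)
  -- The cut-off is flat near `0`, so at the initial time the time derivative falls on `g` alone.
  have hρ1 : deriv ρ 0 = 0 := by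
    have : ρ =ᶠ[𝓝 0] fun _ => 1 := by
      filter_upwards [Icc_mem_nhds (show (-1 : ℝ) < 0 by norm_num) zero_lt_one] with s hs
      exact h.eq_one s (abs_le.2 hs)
    rw [this.deriv_eq, deriv_const]
  have heq : ∀ x, (a 0 x * toL2 u₀ x + u₁ x) * (g 0 x * cutoff ρ R 0 x) -
      toL2 u₀ x * dt (fun t x => g t x * cutoff ρ R t x) 0 x = m x * ρ (x / R) := by
    intro x
    rw [hgs.one.dt_mul (h.isSmooth_cutoff R ⊤).one h0, h.dt_cutoff le_rfl]
    simp only [cutoff, zero_div, hρ0, hρ1, hm]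
    ring
  simp only [heq] at h1
  linarith

end

/-! ### Maximal solutions and the continuation argument -/

section

variable {A a : ℝ → ℝ → ℝ} {p M T : ℝ} {u₀ : H1} {u₁ : L2} {u : ℝ → H1} {w : ℝ → L2} {C : ℝ≥0}

namespace IsMild

theorem flow_of_le (h : IsMild A p M T u₀ u₁ u w) (hp : 1 < p) (hM : 0 ≤ M) {N : ℝ} (hN : 0 ≤ N)
    (hb : ∀ t ∈ Icc 0 T, ∀ᵐ x, |toL2 (u t) x| ≤ N) : IsFlow A p N T fun t => phase t (u t) (w t) := by
  intro t ht
  have := h.flow t ht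
  rwa [field_eq_of_le hp hM hN t (y := phase t (u t) (w t)) (h.bound t ht) (hb t ht)] at this

theorem initial_eq (h : IsMild A p M T u₀ u₁ u w) :
    (fun t => phase t (u t) (w t)) 0 = phase 0 u₀ u₁ := by
  simp only [h.initial, h.init_velocity]

/-- Both solutions satisfy the equation truncated at the larger of the two levels, where uniqueness
for Lipschitz equations applies. -/
theorem eq (hA : IsCoeff A C) (hp : 1 < p) (hM : 0 ≤ M) (h : IsMild A p M T u₀ u₁ u w)
    {N S : ℝ} {v : ℝ → H1} {z : ℝ → L2} (hN : 0 ≤ N) (h' : IsMild A p N S u₀ u₁ v z) {t : ℝ}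
    (ht : t ∈ Icc 0 T) (ht' : t ∈ Icc 0 S) : u t = v t ∧ w t = z t := by
  have hm : 0 ≤ max M N := hM.trans (le_max_left _ _)
  have f1 := (h.mono ht.2).flow_of_le hp hM hm fun s hs => by
    filter_upwards [(h.mono ht.2).bound s hs] with x hx using hx.trans (le_max_left _ _)
  have f2 := (h'.mono ht'.2).flow_of_le hp hN hm fun s hs => by
    filter_upwards [(h'.mono ht'.2).bound s hs] with x hx using hx.trans (le_max_right _ _)
  have he := f1.eq hA hp hm f2 (h.initial_eq.trans h'.initial_eq.symm) t ⟨ht.1, le_rfl⟩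
  constructor
  · exact toL2_injective (congrArg (fun y : Phase => y.1) he :)
  · have := congrArg (wave t) he
    simpa only [wave_phase] using this

theorem congr (h : IsMild A p M T u₀ u₁ u w) (hT : 0 ≤ T) {v : ℝ → H1} {z : ℝ → L2}
    (he : ∀ t ∈ Icc 0 T, u t = v t ∧ w t = z t) : IsMild A p M T u₀ u₁ v z := by
  have h0 := he 0 ⟨le_rfl, hT⟩
  refine ⟨fun t ht => ?_, h0.1.symm.trans h.initial, h0.2.symm.trans h.init_velocity, fun t ht => ?_⟩
  · have h1 := (h.flow t ht).congr (f₁ := fun t => phase t (v t) (z t))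
      (fun s hs => by rw [(he s hs).1, (he s hs).2]) (by rw [(he t ht).1, (he t ht).2])
    simpa only [(he t ht).1, (he t ht).2] using h1
  · rw [← (he t ht).1]
    exact h.bound t ht

end IsMild

/-- A flow of a truncated field that stays below the truncation extends as a mild solution. -/
theorem exists_isMild_gt (hA : IsCoeff A C) (hp : 1 < p) {B : ℝ} (hB : 0 ≤ B) (hT : 0 ≤ T)
    (h : ∀ y : ℝ → Phase, IsFlow A p (4 * (B + 1)) (T + 1) y → y 0 = phase 0 u₀ u₁ →
      ∀ t ∈ Icc 0 T, ‖y t‖ ≤ B) :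
    ∃ T' > T, ∃ u w, IsMild A p (4 * (B + 1)) T' u₀ u₁ u w := by
  have hM : 0 ≤ 4 * (B + 1) := by positivity
  obtain ⟨y, hy0, hy⟩ := exists_isFlow hA hp hM (phase 0 u₀ u₁) (T := T + 1) (by positivity)
  have hbd := h y hy hy0
  have hc := hy.continuousOn T ⟨hT, by linarith⟩
  have hev : ∀ᶠ t in 𝓝[Icc 0 (T + 1)] T, ‖y t‖ < B + 1 :=
    hc.norm.eventually_lt_const (by linarith [hbd T ⟨hT, le_rfl⟩])
  rw [eventually_nhdsWithin_iff, Metric.eventually_nhds_iff] at hev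
  obtain ⟨ε, hε, hev⟩ := hev
  -- A time beyond `T` at which continuity still keeps the norm below `B + 1`, so the truncation at
  -- `4 * (B + 1)` stays inactive. The minimum with `1` remains inside the interval of the flow.
  set T' := T + min (ε / 2) 1 with hT'
  have hm : 0 < min (ε / 2) 1 := by positivity
  have hT1 : T' ≤ T + 1 := by rw [hT']; linarith [min_le_right (ε / 2) 1]
  have hyT := hy.mono hT1
  have hlt : ∀ t ∈ Icc 0 T', ‖y t‖ ≤ B + 1 := by
    intro t ht
    rcases le_total t T with htT | htT
    · linarith [hbd t ⟨ht.1, htT⟩]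
    · refine (hev ?_ ⟨ht.1, ht.2.trans hT1⟩).le
      rw [Real.dist_eq, abs_of_nonneg (by linarith)]
      have := ht.2
      rw [hT'] at this
      linarith [min_le_left (ε / 2) 1]
  obtain ⟨u, hu⟩ := hyT.exists_eq_phase hy0
  have h0 : (0 : ℝ) ∈ Icc 0 T' := ⟨le_rfl, by rw [hT']; linarith⟩
  have e0 := (hu 0 h0).symm.trans hy0
  refine ⟨T', by rw [hT']; linarith, u, fun t => wave t (y t), fun t ht => ?_, ?_, ?_,
    fun t ht => ?_⟩
  · have := (hyT t ht).congr (f₁ := fun t => phase t (u t) (wave t (y t)))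
      (fun s hs => (hu s hs).symm) (hu t ht).symm
    refine this.congr_deriv ?_
    change _ = field A p (4 * (B + 1)) t (phase t (u t) (wave t (y t)))
    rw [← hu t ht]
  · exact toL2_injective (congrArg (fun y : Phase => y.1) e0 :)
  · simp only [hy0, wave_phase]
  · filter_upwards [ae_abs_phase_le t (u t) (wave t (y t))] with x hx
    refine hx.trans ?_
    rw [← hu t ht]
    linarith [hlt t ht]

theorem norm_le_energyNorm (u : ℝ → H1) (t : ℝ) :
    ‖phase t (u t) (velocity u t)‖ ≤ 2 * energyNorm u t := by
  have h1 : ‖u t‖ ≤ energyNorm u t :=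
    Real.le_sqrt_of_sq_le (by nlinarith [sq_nonneg ‖velocity u t‖])
  have h2 : ‖velocity u t‖ ≤ energyNorm u t :=
    Real.le_sqrt_of_sq_le (by nlinarith [sq_nonneg ‖u t‖])
  linarith [norm_phase_le t (u t) (velocity u t)]

/-- The norm of a mild solution grows at most linearly as long as it is smaller than `E + 1`. -/
theorem IsMild.norm_le (hA : IsCoeff A C) (hp : 1 < p) (hM : 0 ≤ M)
    (h : IsMild A p M T u₀ u₁ u w) {E L s : ℝ} (hE : 0 ≤ E)
    (hL : fieldLip p (4 * (E + 1)) C * (E + 1) < L) (hs : 0 ≤ s)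
    (hsE : ‖phase s (u s) (w s)‖ ≤ E) (hT : L * (T - s) ≤ 1) :
    ∀ t ∈ Icc s T, ‖phase t (u t) (w t)‖ ≤ E + 1 := by
  have hN : 0 ≤ 4 * (E + 1) := by positivity
  have hL0 : 0 ≤ L := le_trans (by positivity) hL.le
  have hsub : Icc s T ⊆ Icc 0 T := Icc_subset_Icc_left hs
  -- At a contact with the barrier `E + L (t - s)` the norm is at most `E + 1`. The field then
  -- agrees with the one truncated at `4 * (E + 1)`, whose size is below `L`; hence `L` does not
  -- depend on the truncation level `M` of the solution.
  have key := image_norm_le_of_norm_deriv_right_lt_deriv_boundary'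
    (f := fun t => phase t (u t) (w t)) (f' := fun t => field A p M t (phase t (u t) (w t)))
    (a := s) (b := T) (B := fun t => E + L * (t - s)) (B' := fun _ => L)
    (h.flow.continuousOn.mono hsub)
    (fun t ht => hasDerivWithinAt_Ici_of_Icc ht
      ((h.flow t (hsub (Ico_subset_Icc_self ht))).mono hsub))
    (by simpa using hsE) (by fun_prop)
    (fun t _ => by
      have h1 := (((hasDerivAt_id t).sub_const s).const_mul L).const_add E
      exact (h1.congr_deriv (by ring)).hasDerivWithinAt)
    (fun t ht he => by
      have hle : ‖phase t (u t) (w t)‖ ≤ E + 1 := by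
        have : L * (t - s) ≤ L * (T - s) := mul_le_mul_of_nonneg_left (by linarith [ht.2]) hL0
        linarith
      have hb : ∀ᵐ x, |toL2 (u t) x| ≤ 4 * (E + 1) := by
        filter_upwards [ae_abs_phase_le t (u t) (w t)] with x hx
        exact hx.trans (by linarith)
      rw [field_eq_of_le hp hM hN t (y := phase t (u t) (w t))
        (h.bound t (hsub (Ico_subset_Icc_self ht))) hb]
      refine ((norm_field_le hA hp hN t _).trans ?_).trans_lt hL
      gcongr)
  intro t ht
  have h1 := key ht
  have : L * (t - s) ≤ L * (T - s) := mul_le_mul_of_nonneg_left (by linarith [ht.2]) hL0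
  linarith

/-- If mild solutions have a bounded life span, then there is a maximal weak solution; it blows up
in the energy norm and every weak solution is a restriction of it. -/
theorem exists_maximal_solution (hA : IsCoeff (freeze a) C) (ha : IsC2 a) (hp : 1 < p) {T₀ : ℝ}
    (hT₀ : ∀ T, T₀ ≤ T → ∀ (M : ℝ) (u : ℝ → H1) (w : ℝ → L2), 0 ≤ M →
      ¬ IsMild (freeze a) p M T u₀ u₁ u w) :
    ∃ T : ℝ, 0 < T ∧ ∃ u : ℝ → H1, IsSolution a p u₀ u₁ (T : EReal) u ∧
      Tendsto (energyNorm u) (𝓝[<] T) atTop ∧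
      ∀ S : EReal, 0 < S → ∀ v : ℝ → H1, IsSolution a p u₀ u₁ S v →
        S ≤ (T : EReal) ∧ ∀ t ∈ timeInterval S, v t = u t := by
  set 𝒯 : Set ℝ := {T | ∃ M u w, 0 ≤ M ∧ IsMild (freeze a) p M T u₀ u₁ u w} with h𝒯
  have hbdd : BddAbove 𝒯 := ⟨T₀, fun T ⟨M, u, w, hM, h⟩ => by
    by_contra hcon
    exact hT₀ T (not_le.1 hcon).le M u w hM h⟩
  obtain ⟨T₁, hT₁, u', w', h'⟩ := exists_isMild_gt (T := 0) (u₀ := u₀) (u₁ := u₁) hA hp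
    (norm_nonneg (phase 0 u₀ u₁)) le_rfl fun y _ hy0 t ht => by
      rw [le_antisymm ht.2 ht.1, hy0]
  have hT₁𝒯 : T₁ ∈ 𝒯 := ⟨_, u', w', by positivity, h'⟩
  set T := sSup 𝒯 with hT
  have hT0 : 0 < T := hT₁.trans_le (le_csSup hbdd hT₁𝒯)
  -- Mild solutions agree wherever they are defined, so one value per time can be chosen; where none
  -- is defined the choice is arbitrary.
  have hex : ∀ t : ℝ, ∃ z : H1 × L2, ∀ M S u w, 0 ≤ M → IsMild (freeze a) p M S u₀ u₁ u w →
      t ∈ Icc 0 S → u t = z.1 ∧ w t = z.2 := by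
    intro t
    by_cases hcon : ∃ M S u w, 0 ≤ M ∧ IsMild (freeze a) p M S u₀ u₁ u w ∧ t ∈ Icc 0 S
    · obtain ⟨N, S', v, z, hN, hv, ht'⟩ := hcon
      exact ⟨(v t, z t), fun M S u w hM hu ht => hu.eq hA hp hM hN hv ht ht'⟩
    · exact ⟨0, fun M S u w hM hu ht => absurd ⟨M, S, u, w, hM, hu, ht⟩ hcon⟩
  choose z hz using hex
  set u : ℝ → H1 := fun t => (z t).1 with hu
  set w : ℝ → L2 := fun t => (z t).2 with hw
  have hmild : ∀ T' < T, 0 < T' → ∃ M, 0 ≤ M ∧ IsMild (freeze a) p M T' u₀ u₁ u w := by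
    intro T' hT' h0
    obtain ⟨S, ⟨M, v, y, hM, hv⟩, hS⟩ := exists_lt_of_lt_csSup ⟨T₁, hT₁𝒯⟩ hT'
    exact ⟨M, hM, (hv.mono hS.le).congr h0.le fun t ht => hz t M T' v y hM (hv.mono hS.le) ht⟩
  obtain ⟨hsol, hvel⟩ := isSolution_of_isMild hA ha hp hT0 hmild
  refine ⟨T, hT0, u, hsol, ?_, fun S hS v hv => ⟨?_, fun t ht => ?_⟩⟩
  -- If the energy norm did not tend to infinity, it would stay below some `E₀` at times `s`
  -- arbitrarily close to `T`. The growth bound depends on `E₀` only, so it would reach `T` and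
  -- allow an extension past `T`.
  · by_contra hcon
    rw [tendsto_atTop] at hcon
    push Not at hcon
    obtain ⟨E₀, hE₀⟩ := hcon
    set E := 2 * max E₀ 0 with hE
    have hE0 : 0 ≤ E := by positivity
    -- The summand `1` makes the comparison of speeds strict. Starting at `s > T - 1/L`, the norm
    -- rises by at most `1` before `T`.
    set L : ℝ := fieldLip p (4 * (E + 1)) C * (E + 1) + 1 with hL
    have hL0 : 0 < L := by positivity
    have hnear : ∀ᶠ s in 𝓝[<] T, max 0 (T - 1 / L) < s ∧ s < T := by
      refine Ioo_mem_nhdsLT (max_lt hT0 ?_)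
      linarith [one_div_pos.2 hL0]
    obtain ⟨s, hsE, hs, hsT⟩ := (hE₀.and_eventually hnear).exists
    have hs0 : 0 < s := (le_max_left _ _).trans_lt hs
    have hsL : L * (T - s) ≤ 1 := by
      have h1 : T - s ≤ 1 / L := by linarith [(le_max_right 0 (T - 1 / L)).trans_lt hs]
      calc L * (T - s) ≤ L * (1 / L) := mul_le_mul_of_nonneg_left h1 hL0.le
        _ = 1 := mul_one_div_cancel hL0.ne'
    have hsE' : ‖phase s (u s) (w s)‖ ≤ E := by
      rw [← hvel s ⟨hs0.le, hsT⟩]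
      refine (norm_le_energyNorm u s).trans ?_
      rw [hE]
      linarith [le_max_left E₀ 0, hsE]
    obtain ⟨M₁, hM₁, hm₁⟩ := hmild s hsT hs0
    obtain ⟨B₁, hB₁⟩ := isCompact_Icc.exists_bound_of_continuousOn hm₁.flow.continuousOn
    set B := max B₁ (E + 1) with hB
    have hB0 : 0 ≤ B := le_trans (by positivity) (le_max_right B₁ (E + 1))
    have hbound : ∀ t ∈ Ico 0 T, ‖phase t (u t) (w t)‖ ≤ B := by
      intro t ht
      rcases le_total t s with hts | hts
      · exact (hB₁ t ⟨ht.1, hts⟩).trans (le_max_left _ _)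
      · obtain ⟨M₂, hM₂, hm₂⟩ := hmild t ht.2 (hs0.trans_le hts)
        refine (hm₂.norm_le hA hp hM₂ hE0 (L := L) (by rw [hL]; linarith) hs0.le hsE' ?_ t
          ⟨hts, le_rfl⟩).trans (le_max_right _ _)
        exact le_trans (mul_le_mul_of_nonneg_left (by linarith [ht.2]) hL0.le) hsL
    have hN : 0 ≤ 4 * (B + 1) := by positivity
    obtain ⟨S, hS, v, y, hvy⟩ := exists_isMild_gt (T := T) (u₀ := u₀) (u₁ := u₁) hA hp hB0 hT0.le
      fun y hy hy0 => by
        -- Before `T` the truncated flow coincides with the solution already found; continuity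
        -- carries its bound to the endpoint.
        have h1 : ∀ t ∈ Ioo 0 T, ‖y t‖ ≤ B := by
          intro t ht
          obtain ⟨M₂, hM₂, hm₂⟩ := hmild t ht.2 ht.1
          have f1 := hm₂.flow_of_le hp hM₂ hN fun r hr => by
            filter_upwards [ae_abs_phase_le r (u r) (w r)] with x hx
            refine hx.trans ?_
            linarith [hbound r ⟨hr.1, hr.2.trans_lt ht.2⟩]
          have f2 := f1.eq hA hp hN (hy.mono (by linarith [ht.2])) (hm₂.initial_eq.trans hy0.symm) t
            ⟨ht.1.le, le_rfl⟩
          rw [← f2]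
          exact hbound t ⟨ht.1.le, ht.2⟩
        have hcl : Icc 0 T = closure (Ioo 0 T) := (closure_Ioo hT0.ne).symm
        have hcy : ContinuousOn (fun t => ‖y t‖) (closure (Ioo 0 T)) := by
          rw [← hcl]
          exact (hy.mono (by linarith)).continuousOn.norm
        intro t ht
        rw [hcl] at ht
        exact ContinuousWithinAt.closure_le ht
          ((hcy t ht).mono subset_closure) continuousWithinAt_const h1
    exact hS.not_ge (le_csSup hbdd ⟨_, v, y, hN, hvy⟩)
  · by_contra hcon
    obtain ⟨S', h1, h2⟩ := EReal.lt_iff_exists_real_btwn.1 (not_le.1 hcon)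
    have h1' : T < S' := by exact_mod_cast h1
    obtain ⟨M, hM, hm⟩ := hv.exists_isMild hA ha hp ⟨hT0.le.trans h1'.le, h2⟩
    exact h1'.not_ge (le_csSup hbdd ⟨M, v, velocity v, hM, hm⟩)
  · obtain ⟨M, hM, hm⟩ := hv.exists_isMild hA ha hp ht
    exact (hz t M t v (velocity v) hM hm ⟨ht.1, le_rfl⟩).1

end

/-! ### From correctors to blow-up -/

theorem IsCorrector.exists_isWeight {a h : ℝ → ℝ → ℝ} {θ k δ : ℝ} (hh : IsCorrector a θ k h)
    (hθ : θ ∈ Ioo (0 : ℝ) 1) (hk : 1 < k) (ha : IsDamping k δ a) :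
    ∃ K, IsWeight a k (1 - θ) K fun t x => 1 + h t x := by
  obtain ⟨C, -, hC⟩ := hh.bound_deriv
  have hs : IsSmooth ⊤ 2 h := IsSmooth.of_isC2 hh.contDiff
  have h1 : dt (fun t x => 1 + h t x) = dt h := by
    funext t x
    exact derivWithin_const_add 1
  have h2 : dx (fun t x => 1 + h t x) = dx h := by
    funext t x
    exact deriv_const_add 1
  have hb : ∀ t, 0 ≤ t → ∀ x, |h t x| ≤ θ := fun t ht x =>
    (hh.bound t ht x).trans (div_one_add_rpow_le hθ.1.le (by linarith) ht)
  -- One constant for all upper bounds: `C` for the derivatives, `δ` for the coefficient, and `2`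
  -- because `g ≤ 1 + θ < 2`.
  set K := max (max C δ) 2 with hK
  have hmono : ∀ {c t : ℝ}, c ≤ K → 0 ≤ t → c / (1 + t) ^ k ≤ K / (1 + t) ^ k := by
    intro c t hc ht
    exact div_le_div_of_nonneg_right hc (Real.rpow_nonneg (by linarith) k)
  have hCK : C ≤ K := (le_max_left _ _).trans (le_max_left _ _)
  refine ⟨K, contDiffOn_const.add hh.contDiff, fun t ht x => ?_, fun t ht x => ?_,
    fun t ht x => ?_, fun t ht x => ?_, fun t ht x => ?_, fun t ht x => ?_⟩
  · rw [h1, h2]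
    exact hh.equation t ht x
  · linarith [(abs_le.1 (hb t ht x)).1]
  · linarith [(abs_le.1 (hb t ht x)).2, hθ.2, le_max_right (max C δ) 2]
  · rw [h1]
    exact (hC t ht x).1.trans (hmono hCK ht)
  · rw [h2]
    exact (hC t ht x).2.trans (hmono hCK ht)
  · exact (ha.bound t ht x).trans (hmono ((le_max_right _ _).trans (le_max_left _ _)) ht)

theorem IsCorrector.blowup {a h : ℝ → ℝ → ℝ} {θ k δ p : ℝ} (hh : IsCorrector a θ k h)
    (hθ : θ ∈ Ioo (0 : ℝ) 1) (hk : 1 < k) (hδ : 0 ≤ δ) (ha : IsDamping k δ a) (hp : 1 < p)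
    {u₀ : H1} {u₁ : L2} (hd : PositiveData a (fun t x => 1 + h t x) u₀ u₁) :
    ∃ T : ℝ, 0 < T ∧ ∃ u : ℝ → H1, IsSolution a p u₀ u₁ (T : EReal) u ∧
      Tendsto (energyNorm u) (𝓝[<] T) atTop ∧
      ∀ S : EReal, 0 < S → ∀ v : ℝ → H1, IsSolution a p u₀ u₁ S v →
        S ≤ (T : EReal) ∧ ∀ t ∈ timeInterval S, v t = u t := by
  obtain ⟨K, hg⟩ := hh.exists_isWeight hθ hk ha
  have hA := ha.isCoeff (by linarith) hδ
  obtain ⟨T₀, -, hT₀⟩ := hg.exists_lifespan_bound ha.contDiff hA hk (sub_pos.2 hθ.2) hp hd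
  exact exists_maximal_solution hA ha.contDiff hp hT₀

/-! ### Integrals along characteristics -/

/-- `F` is continuous and of order `(1 + |t|)^(-α)` as `t → ∞`, uniformly in `x`. -/
structure Decays (α : ℝ) (F : ℝ → ℝ → ℝ) : Prop where
  continuous : Continuous fun z : ℝ × ℝ => F z.1 z.2
  bound : ∀ n : ℝ, ∃ m, ∀ t, -n ≤ t → ∀ x, |F t x| ≤ m * (1 + |t|) ^ (-α)

/-- The integral of `F` along the ray of slope `σ` from `(t, x)`. -/
def lineIntegral (σ : ℝ) (F : ℝ → ℝ → ℝ) (t x : ℝ) : ℝ := ∫ r in Ioi (0 : ℝ), F (t + r) (x + σ * r)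

theorem integrableOn_decay {α : ℝ} (hα : 1 < α) (m : ℝ) :
    IntegrableOn (fun r : ℝ => m * (r + 1) ^ (-α)) (Ioi 0) :=
  (integrableOn_add_rpow_Ioi_of_lt (by linarith) (by norm_num)).const_mul m

theorem integral_Ioi_comp_add (f : ℝ → ℝ) (t : ℝ) :
    ∫ r in Ioi (0 : ℝ), f (t + r) = ∫ r in Ioi t, f r := by
  have h := (measurePreserving_add_left volume t).setIntegral_preimage_emb
    (measurableEmbedding_addLeft t) f (Ioi t)
  rwa [preimage_const_add_Ioi, sub_self] at h

theorem integral_add_rpow_le {α t : ℝ} (hα : 0 < α) (ht : 0 ≤ t) :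
    ∫ r in Ioi (0 : ℝ), (1 + (t + r)) ^ (-(α + 1)) = (1 + t) ^ (-α) / α := by
  have h1 : ∫ r in Ioi (0 : ℝ), (1 + (t + r)) ^ (-(α + 1)) =
      ∫ r in Ioi (0 : ℝ), (fun s => s ^ (-(α + 1))) ((1 + t) + r) := by simp only [add_assoc]
  rw [h1, integral_Ioi_comp_add (fun s => s ^ (-(α + 1))), integral_Ioi_rpow_of_lt (by linarith)
    (by linarith)]
  rw [show -(α + 1) + 1 = -α by ring, neg_div_neg_eq]

theorem hasFDerivAt_of_partials {f f₁ f₂ : ℝ → ℝ → ℝ}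
    (h₁ : ∀ t x, HasDerivAt (fun t => f t x) (f₁ t x) t)
    (h₂ : ∀ t x, HasDerivAt (f t) (f₂ t x) x) (c₁ : Continuous fun z : ℝ × ℝ => f₁ z.1 z.2)
    (c₂ : Continuous fun z : ℝ × ℝ => f₂ z.1 z.2) (z : ℝ × ℝ) :
    HasFDerivAt (fun z : ℝ × ℝ => f z.1 z.2)
      (f₁ z.1 z.2 • ContinuousLinearMap.fst ℝ ℝ ℝ + f₂ z.1 z.2 • ContinuousLinearMap.snd ℝ ℝ ℝ)
      z := by
  have h := (hasStrictFDerivAt_uncurry_coprod (𝕜 := ℝ) (u := z) (f := f)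
    (f₁ := fun t x => ContinuousLinearMap.toSpanSingleton ℝ (f₁ t x))
    (f₂ := fun t x => ContinuousLinearMap.toSpanSingleton ℝ (f₂ t x))
    (Eventually.of_forall fun v => (h₁ v.1 v.2).hasFDerivAt)
    (Eventually.of_forall fun v => (h₂ v.1 v.2).hasFDerivAt)
    ((ContinuousLinearMap.toSpanSingletonCLE (𝕜 := ℝ) (E := ℝ)).continuous.comp c₁).continuousAt
    ((ContinuousLinearMap.toSpanSingletonCLE (𝕜 := ℝ) (E := ℝ)).continuous.comp c₂).continuousAt)
  refine h.hasFDerivAt.congr_fderiv ?_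
  ext <;> simp [Function.HasUncurry.uncurry]

theorem contDiff_succ_of_partials {n : ℕ} {f f₁ f₂ : ℝ → ℝ → ℝ}
    (h₁ : ∀ t x, HasDerivAt (fun t => f t x) (f₁ t x) t)
    (h₂ : ∀ t x, HasDerivAt (f t) (f₂ t x) x) (c₁ : ContDiff ℝ n fun z : ℝ × ℝ => f₁ z.1 z.2)
    (c₂ : ContDiff ℝ n fun z : ℝ × ℝ => f₂ z.1 z.2) :
    ContDiff ℝ (n + 1) fun z : ℝ × ℝ => f z.1 z.2 :=
  contDiff_succ_iff_hasFDerivAt.2 ⟨_, (c₁.smul contDiff_const).add (c₂.smul contDiff_const),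
    hasFDerivAt_of_partials h₁ h₂ c₁.continuous c₂.continuous⟩

namespace Decays

variable {α β σ : ℝ} {F G : ℝ → ℝ → ℝ}

theorem add (h : Decays α F) (h' : Decays α G) : Decays α fun t x => F t x + G t x := by
  refine ⟨h.continuous.add h'.continuous, fun n => ?_⟩
  obtain ⟨m, hm⟩ := h.bound n
  obtain ⟨m', hm'⟩ := h'.bound n
  refine ⟨m + m', fun t ht x => (abs_add_le _ _).trans ?_⟩
  rw [add_mul]
  exact add_le_add (hm t ht x) (hm' t ht x)

theorem const_mul (h : Decays α F) (c : ℝ) : Decays α fun t x => c * F t x := by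
  refine ⟨continuous_const.mul h.continuous, fun n => ?_⟩
  obtain ⟨m, hm⟩ := h.bound n
  refine ⟨|c| * m, fun t ht x => ?_⟩
  rw [abs_mul, mul_assoc]
  exact mul_le_mul_of_nonneg_left (hm t ht x) (abs_nonneg _)

/-- For `t` in a bounded interval, the decay in `t + r` is comparable to decay in `r`. This gives a
majorant independent of `t` and `x` for dominated convergence. -/
theorem exists_dominated (h : Decays α F) (hα : 0 ≤ α) (n : ℝ) :
    ∃ m, ∀ t ∈ Icc (-n) n, ∀ r, 0 ≤ r → ∀ x, |F (t + r) x| ≤ m * (r + 1) ^ (-α) := by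
  obtain ⟨m, hm⟩ := h.bound n
  refine ⟨m * (1 + n) ^ α, fun t ht r hr x => ?_⟩
  have hn : 0 ≤ n := by linarith [ht.1.trans ht.2]
  have h1 := hm (t + r) (by linarith [ht.1]) x
  have hpos : 0 < (1 + |t + r|) ^ (-α) := Real.rpow_pos_of_pos (by positivity) _
  have hm0 : 0 ≤ m := nonneg_of_mul_nonneg_left ((abs_nonneg _).trans h1) hpos
  refine h1.trans ?_
  rw [mul_assoc]
  refine mul_le_mul_of_nonneg_left ?_ hm0
  have h2 : r + 1 ≤ (1 + n) * (1 + |t + r|) := by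
    have : r ≤ |t + r| + n := by linarith [le_abs_self (t + r), ht.1]
    nlinarith [abs_nonneg (t + r)]
  have h3 : ((1 + n) * (1 + |t + r|)) ^ (-α) ≤ (r + 1) ^ (-α) :=
    Real.rpow_le_rpow_of_nonpos (by linarith) h2 (by linarith)
  rw [Real.mul_rpow (by linarith) (by positivity)] at h3
  calc (1 + |t + r|) ^ (-α) = (1 + n) ^ α * ((1 + n) ^ (-α) * (1 + |t + r|) ^ (-α)) := by
        rw [← mul_assoc, ← Real.rpow_add (by linarith), add_neg_cancel, Real.rpow_zero, one_mul]
    _ ≤ _ := mul_le_mul_of_nonneg_left h3 (Real.rpow_nonneg (by linarith) _)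

theorem continuous_line (h : Decays α F) (σ t x : ℝ) :
    Continuous fun r => F (t + r) (x + σ * r) :=
  h.continuous.comp (f := fun r : ℝ => (t + r, x + σ * r)) (by fun_prop)

theorem integrableOn_line (h : Decays α F) (hα : 1 < α) (σ t x : ℝ) :
    IntegrableOn (fun r => F (t + r) (x + σ * r)) (Ioi 0) := by
  obtain ⟨m, hm⟩ := h.exists_dominated (by linarith) |t|
  refine (integrableOn_decay hα m).mono' (h.continuous_line σ t x).aestronglyMeasurable ?_
  filter_upwards [ae_restrict_mem measurableSet_Ioi] with r hr
  exact hm t (abs_le.1 le_rfl) r (mem_Ioi.1 hr).le _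

theorem continuous_lineIntegral (h : Decays α F) (hα : 1 < α) (σ : ℝ) :
    Continuous fun z : ℝ × ℝ => lineIntegral σ F z.1 z.2 := by
  rw [continuous_iff_continuousAt]
  intro z
  obtain ⟨m, hm⟩ := h.exists_dominated (by linarith) (|z.1| + 1)
  refine continuousAt_of_dominated (bound := fun r => m * (r + 1) ^ (-α))
    (Eventually.of_forall fun w => (h.continuous_line σ w.1 w.2).aestronglyMeasurable) ?_
    (integrableOn_decay hα m) (Eventually.of_forall fun r => ?_)
  · have : ∀ᶠ w : ℝ × ℝ in 𝓝 z, |w.1| < |z.1| + 1 :=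
      (continuous_fst.abs.continuousAt (x := z)).eventually_lt_const (lt_add_one _)
    filter_upwards [this] with w hw
    filter_upwards [ae_restrict_mem measurableSet_Ioi] with r hr
    exact hm w.1 (abs_le.1 hw.le) r (mem_Ioi.1 hr).le _
  · exact (h.continuous.comp (f := fun w : ℝ × ℝ => (w.1 + r, w.2 + σ * r))
      (by fun_prop)).continuousAt

theorem abs_lineIntegral_le {m : ℝ} (hα : 0 < α)
    (hb : ∀ t, 0 ≤ t → ∀ x, |F t x| ≤ m * (1 + t) ^ (-(α + 1))) (σ : ℝ) {t : ℝ} (ht : 0 ≤ t)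
    (x : ℝ) : |lineIntegral σ F t x| ≤ m / α * (1 + t) ^ (-α) := by
  have hi : IntegrableOn (fun r : ℝ => m * (1 + (t + r)) ^ (-(α + 1))) (Ioi 0) := by
    have := (integrableOn_add_rpow_Ioi_of_lt (a := -(α + 1)) (c := 0) (m := 1 + t) (by linarith)
      (by linarith)).const_mul m
    refine this.congr (Eventually.of_forall fun r => ?_)
    simp only
    rw [show r + (1 + t) = 1 + (t + r) by ring]
  have h1 := norm_integral_le_of_norm_le hi (f := fun r => F (t + r) (x + σ * r)) (by
    filter_upwards [ae_restrict_mem measurableSet_Ioi] with r hr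
    exact hb (t + r) (add_nonneg ht (mem_Ioi.1 hr).le) _)
  rw [integral_const_mul, integral_add_rpow_le hα ht] at h1
  rw [div_mul_eq_mul_div, ← mul_div_assoc] at *
  exact h1

/-- One integration costs one power of decay. For nonnegative times this is explicit; on the
remaining bounded time interval any constant bound is enough. -/
theorem lineIntegral (h : Decays (α + 1) F) (hα : 0 < α) (σ : ℝ) :
    Decays α (lineIntegral σ F) := by
  refine ⟨h.continuous_lineIntegral (by linarith) σ, fun n => ?_⟩
  obtain ⟨m, hm⟩ := h.bound 0
  obtain ⟨m', hm'⟩ := h.exists_dominated (by linarith) |n|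
  set c := ∫ r in Ioi (0 : ℝ), m' * (r + 1) ^ (-(α + 1)) with hc
  refine ⟨max (m / α) (c * (1 + |n|) ^ α), fun t ht x => ?_⟩
  rcases le_total 0 t with h0 | h0
  · have h1 := abs_lineIntegral_le (m := m) (F := F) hα (fun t ht x => by
      have := hm t (by simpa using ht) x
      rwa [abs_of_nonneg ht] at this) σ h0 x
    rw [abs_of_nonneg h0]
    refine h1.trans (mul_le_mul_of_nonneg_right (le_max_left _ _) ?_)
    exact Real.rpow_nonneg (by linarith) _
  · have htn : |t| ≤ |n| := by
      rw [abs_of_nonpos h0]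
      exact (by linarith : -t ≤ n).trans (le_abs_self n)
    have h1 : |DampedWave.lineIntegral σ F t x| ≤ c := by
      refine norm_integral_le_of_norm_le (f := fun r => F (t + r) (x + σ * r))
        (integrableOn_decay (α := α + 1) (by linarith) m') ?_
      filter_upwards [ae_restrict_mem measurableSet_Ioi] with r hr
      exact hm' t (abs_le.1 htn) r (mem_Ioi.1 hr).le _
    have hc0 : 0 ≤ c := (abs_nonneg _).trans h1
    have h2 : 1 ≤ (1 + |n|) ^ α * (1 + |t|) ^ (-α) := by
      rw [Real.rpow_neg (by positivity), ← div_eq_mul_inv, one_le_div (by positivity)]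
      exact Real.rpow_le_rpow (by positivity) (by linarith) hα.le
    calc _ ≤ c := h1
      _ ≤ c * ((1 + |n|) ^ α * (1 + |t|) ^ (-α)) := le_mul_of_one_le_right hc0 h2
      _ = c * (1 + |n|) ^ α * (1 + |t|) ^ (-α) := by ring
      _ ≤ _ := mul_le_mul_of_nonneg_right (le_max_right _ _) (by positivity)

theorem hasDerivAt_lineIntegral_dx (h : Decays α F) (h' : Decays α G) (hα : 1 < α)
    (hd : ∀ t x, HasDerivAt (F t) (G t x) x) (σ t x : ℝ) :
    HasDerivAt (DampedWave.lineIntegral σ F t) (DampedWave.lineIntegral σ G t x) x := by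
  obtain ⟨m, hm⟩ := h'.exists_dominated (by linarith) |t|
  refine (hasDerivAt_integral_of_dominated_loc_of_deriv_le (s := univ)
    (F := fun x r => F (t + r) (x + σ * r)) (F' := fun x r => G (t + r) (x + σ * r))
    (bound := fun r => m * (r + 1) ^ (-α)) univ_mem
    (Eventually.of_forall fun x => (h.continuous_line σ t x).aestronglyMeasurable)
    (h.integrableOn_line hα σ t x) (h'.continuous_line σ t x).aestronglyMeasurable ?_
    (integrableOn_decay hα m) (Eventually.of_forall fun r y _ => ?_)).2
  · filter_upwards [ae_restrict_mem measurableSet_Ioi] with r hr y _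
    exact hm t (abs_le.1 le_rfl) r (mem_Ioi.1 hr).le _
  · exact (hd (t + r) (y + σ * r)).comp_add_const y (σ * r)

/-- Along the characteristic through `y` the quantity is the tail `∫_t^∞ F(s, y + σ s) ds`. Its
derivative requires no differentiability of `F`. -/
theorem hasDerivAt_lineIntegral_characteristic (h : Decays α F) (hα : 1 < α) (σ t y : ℝ) :
    HasDerivAt (fun t => DampedWave.lineIntegral σ F t (y + σ * t)) (-F t (y + σ * t)) t := by
  set q : ℝ → ℝ := fun s => F s (y + σ * s) with hq
  have hqc : Continuous q := h.continuous.comp (f := fun s : ℝ => (s, y + σ * s)) (by fun_prop)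
  have hqi : ∀ s, IntegrableOn q (Ioi s) := by
    intro s
    have h1 := h.integrableOn_line hα σ s (y + σ * s)
    have h2 := (measurePreserving_add_left volume s).integrableOn_comp_preimage
      (measurableEmbedding_addLeft s) (f := q) (s := Ioi s)
    rw [preimage_const_add_Ioi, sub_self] at h2
    refine h2.1 (h1.congr (Eventually.of_forall fun r => ?_))
    simp only [hq, Function.comp]
    ring_nf
  have he : (fun s => DampedWave.lineIntegral σ F s (y + σ * s)) =
      fun s => (∫ r in Ioi t, q r) - ∫ r in t..s, q r := by
    funext s
    rw [← intervalIntegral.integral_interval_add_Ioi (hqi t) (hqi s), add_sub_cancel_left,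
      ← integral_Ioi_comp_add q s]
    simp only [DampedWave.lineIntegral, hq]
    congr 1
    funext r
    ring_nf
  rw [he]
  exact (intervalIntegral.integral_hasDerivAt_right (hqc.intervalIntegrable _ _)
    (hqc.stronglyMeasurableAtFilter _ _) hqc.continuousAt).const_sub _

theorem hasFDerivAt_characteristic (h : Decays α F) (h' : Decays α G) (hα : 1 < α)
    (hd : ∀ t x, HasDerivAt (F t) (G t x) x) (σ : ℝ) :
    ∀ z : ℝ × ℝ, HasFDerivAt
      (fun z : ℝ × ℝ => (fun t y => DampedWave.lineIntegral σ F t (y + σ * t)) z.1 z.2)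
      (-F z.1 (z.2 + σ * z.1) • ContinuousLinearMap.fst ℝ ℝ ℝ +
        DampedWave.lineIntegral σ G z.1 (z.2 + σ * z.1) • ContinuousLinearMap.snd ℝ ℝ ℝ) z :=
  hasFDerivAt_of_partials (fun t y => h.hasDerivAt_lineIntegral_characteristic hα σ t y)
    (fun t y => (h.hasDerivAt_lineIntegral_dx h' hα hd σ t (y + σ * t)).comp_add_const y (σ * t))
    (h.continuous.comp (f := fun z : ℝ × ℝ => (z.1, z.2 + σ * z.1)) (by fun_prop)).neg
    ((h'.continuous_lineIntegral hα σ).comp (f := fun z : ℝ × ℝ => (z.1, z.2 + σ * z.1))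
      (by fun_prop))

/-- The time derivative is recovered from the derivative along the characteristic and the space
derivative. Consequently `F` has to be differentiable in `x` only, and just continuous in `t`. -/
theorem hasDerivAt_lineIntegral_dt (h : Decays α F) (h' : Decays α G) (hα : 1 < α)
    (hd : ∀ t x, HasDerivAt (F t) (G t x) x) (σ t x : ℝ) :
    HasDerivAt (fun t => DampedWave.lineIntegral σ F t x)
      (-F t x - σ * DampedWave.lineIntegral σ G t x) t := by
  have h1 := h.hasFDerivAt_characteristic h' hα hd σ (t, x - σ * t)
  have h2 : HasDerivAt (fun t => (t, x - σ * t)) ((1 : ℝ), -σ) t := by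
    refine (hasDerivAt_id t).prodMk ?_
    exact (((hasDerivAt_id t).const_mul σ).const_sub x).congr_deriv (by ring)
  have h3 := h1.comp_hasDerivAt t h2
  refine (h3.congr_deriv ?_).congr_of_eventuallyEq (Eventually.of_forall fun s => ?_)
  · simp
    ring
  · simp

theorem contDiff_lineIntegral (h : Decays α F) (h' : Decays α G) (hα : 1 < α)
    (hd : ∀ t x, HasDerivAt (F t) (G t x) x) (σ : ℝ) :
    ContDiff ℝ 1 fun z : ℝ × ℝ => DampedWave.lineIntegral σ F z.1 z.2 := by
  have hz : ∀ {f : ℝ × ℝ → ℝ}, Continuous f → ContDiff ℝ ((0 : ℕ) : WithTop ℕ∞) f :=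
    fun hf => by simpa using hf
  have hc := hz (h'.continuous_lineIntegral hα σ)
  have := contDiff_succ_of_partials (n := 0) (f := DampedWave.lineIntegral σ F)
    (fun t x => h.hasDerivAt_lineIntegral_dt h' hα hd σ t x)
    (fun t x => h.hasDerivAt_lineIntegral_dx h' hα hd σ t x)
    ((hz h.continuous).neg.sub (contDiff_const.mul hc)) hc
  simpa using this

theorem tendsto_zero (h : Decays α F) (hα : 0 < α) (x : ℝ) : Tendsto (fun t => F t x) atTop (𝓝 0) := by
  obtain ⟨m, hm⟩ := h.bound 0
  have h1 : Tendsto (fun t : ℝ => m * (1 + |t|) ^ (-α)) atTop (𝓝 (m * 0)) :=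
    ((tendsto_rpow_neg_atTop hα).comp
      (tendsto_atTop_add_const_left _ 1 tendsto_abs_atTop_atTop)).const_mul m
  rw [mul_zero] at h1
  refine squeeze_zero_norm' ?_ h1
  filter_upwards [eventually_ge_atTop 0] with t ht
  exact hm t (by simpa using ht) x

/-- An antiderivative that vanishes at infinity is determined by the tail integral of its
derivative. -/
theorem lineIntegral_zero_eq (h : Decays α F) (hα : 1 < α) {D : ℝ → ℝ → ℝ} (hD : Decays β D)
    (hβ : 0 < β) (hd : ∀ t x, HasDerivAt (fun t => D t x) (-F t x) t) (t x : ℝ) :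
    DampedWave.lineIntegral 0 F t x = D t x := by
  have hi := (h.integrableOn_line hα 0 t x).neg
  have h1 : ∀ r ∈ Ici (0 : ℝ), HasDerivAt (fun r => D (t + r) x) (-F (t + r) (x + 0 * r)) r := by
    intro r _
    rw [zero_mul, add_zero]
    exact (hd (t + r) x).comp_const_add t r
  have h2 : Tendsto (fun r => D (t + r) x) atTop (𝓝 0) :=
    (hD.tendsto_zero hβ x).comp (tendsto_atTop_add_const_left _ t tendsto_id)
  have h3 := integral_Ioi_of_hasDerivAt_of_tendsto' h1 hi h2
  rw [integral_neg, add_zero] at h3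
  rw [DampedWave.lineIntegral]
  linarith

end Decays

open scoped BoundedContinuousFunction

/-! ### Existence of correctors -/

/-- The solution operator `F ↦ h_t` of `h_tt - h_xx = F` with zero data at `t = ∞`. -/
def speed (F : ℝ → ℝ → ℝ) (t x : ℝ) : ℝ :=
  -(1 / 2) * (lineIntegral 1 F t x + lineIntegral (-1) F t x)

/-- The solution operator `F ↦ h_x` of `h_tt - h_xx = F` with zero data at `t = ∞`. -/
def tilt (F : ℝ → ℝ → ℝ) (t x : ℝ) : ℝ :=
  1 / 2 * (lineIntegral 1 F t x + -1 * lineIntegral (-1) F t x)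

/-- The solution operator `F ↦ h` of `h_tt - h_xx = F` with zero data at `t = ∞`. -/
def potential (F : ℝ → ℝ → ℝ) : ℝ → ℝ → ℝ := lineIntegral 0 fun t x => -1 * speed F t x

section

variable {k m : ℝ} {F F' G : ℝ → ℝ → ℝ}

theorem lineIntegral_sub (h : Decays k F) (h' : Decays k F') (hk : 1 < k) (σ t x : ℝ) :
    lineIntegral σ (fun t x => F t x - F' t x) t x = lineIntegral σ F t x - lineIntegral σ F' t x :=
  integral_sub (h.integrableOn_line hk σ t x) (h'.integrableOn_line hk σ t x)

theorem decays_speed (h : Decays (k + 1) F) (hk : 0 < k) : Decays k (speed F) :=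
  ((h.lineIntegral hk 1).add (h.lineIntegral hk (-1))).const_mul _

theorem decays_tilt (h : Decays (k + 1) F) (hk : 0 < k) : Decays k (tilt F) :=
  ((h.lineIntegral hk 1).add ((h.lineIntegral hk (-1)).const_mul _)).const_mul _

theorem speed_sub (h : Decays (k + 1) F) (h' : Decays (k + 1) F') (hk : 0 < k) (t x : ℝ) :
    speed (fun t x => F t x - F' t x) t x = speed F t x - speed F' t x := by
  simp only [speed, lineIntegral_sub h h' (by linarith)]
  ring

theorem potential_sub (h : Decays (k + 1) F) (h' : Decays (k + 1) F') (hk : 1 < k) (t x : ℝ) :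
    potential (fun t x => F t x - F' t x) t x = potential F t x - potential F' t x := by
  have hk0 : 0 < k := by linarith
  rw [potential, potential, potential, ← lineIntegral_sub ((decays_speed h hk0).const_mul (-1))
    ((decays_speed h' hk0).const_mul (-1)) hk]
  simp only [speed_sub h h' hk0, mul_sub]

theorem abs_speed_le (hk : 0 < k)
    (hb : ∀ t, 0 ≤ t → ∀ x, |F t x| ≤ m * (1 + t) ^ (-(k + 1))) {t : ℝ} (ht : 0 ≤ t) (x : ℝ) :
    |speed F t x| ≤ m / k * (1 + t) ^ (-k) := by
  have h1 := abs_le.1 (Decays.abs_lineIntegral_le hk hb 1 ht x)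
  have h2 := abs_le.1 (Decays.abs_lineIntegral_le hk hb (-1) ht x)
  rw [speed, abs_le]
  constructor <;> linarith [h1.1, h1.2, h2.1, h2.2]

theorem abs_tilt_le (hk : 0 < k)
    (hb : ∀ t, 0 ≤ t → ∀ x, |F t x| ≤ m * (1 + t) ^ (-(k + 1))) {t : ℝ} (ht : 0 ≤ t) (x : ℝ) :
    |tilt F t x| ≤ m / k * (1 + t) ^ (-k) := by
  have h1 := abs_le.1 (Decays.abs_lineIntegral_le hk hb 1 ht x)
  have h2 := abs_le.1 (Decays.abs_lineIntegral_le hk hb (-1) ht x)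
  rw [tilt, abs_le]
  constructor <;> linarith [h1.1, h1.2, h2.1, h2.2]

theorem abs_potential_le (hk : 1 < k)
    (hb : ∀ t, 0 ≤ t → ∀ x, |F t x| ≤ m * (1 + t) ^ (-(k + 1))) {t : ℝ} (ht : 0 ≤ t) (x : ℝ) :
    |potential F t x| ≤ m / k / (k - 1) * (1 + t) ^ (-(k - 1)) := by
  refine Decays.abs_lineIntegral_le (sub_pos.2 hk) (fun t ht x => ?_) 0 ht x
  rw [abs_mul, abs_neg, abs_one, one_mul, sub_add_cancel]
  exact abs_speed_le (by linarith) hb ht x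

theorem hasDerivAt_speed_dx (h : Decays (k + 1) F) (h' : Decays (k + 1) G) (hk : 1 < k)
    (hd : ∀ t x, HasDerivAt (F t) (G t x) x) (t x : ℝ) : HasDerivAt (speed F t) (speed G t x) x :=
  ((h.hasDerivAt_lineIntegral_dx h' (by linarith) hd 1 t x).add
    (h.hasDerivAt_lineIntegral_dx h' (by linarith) hd (-1) t x)).const_mul _

theorem hasDerivAt_tilt_dx (h : Decays (k + 1) F) (h' : Decays (k + 1) G) (hk : 1 < k)
    (hd : ∀ t x, HasDerivAt (F t) (G t x) x) (t x : ℝ) : HasDerivAt (tilt F t) (tilt G t x) x :=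
  ((h.hasDerivAt_lineIntegral_dx h' (by linarith) hd 1 t x).add
    ((h.hasDerivAt_lineIntegral_dx h' (by linarith) hd (-1) t x).const_mul _)).const_mul _

/-- With `h = potential F` and `G = F_x`, this is the wave equation itself: `tilt G` is `h_xx`. -/
theorem hasDerivAt_speed_dt (h : Decays (k + 1) F) (h' : Decays (k + 1) G) (hk : 1 < k)
    (hd : ∀ t x, HasDerivAt (F t) (G t x) x) (t x : ℝ) :
    HasDerivAt (fun t => speed F t x) (F t x + tilt G t x) t := by
  refine (((h.hasDerivAt_lineIntegral_dt h' (by linarith) hd 1 t x).add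
    (h.hasDerivAt_lineIntegral_dt h' (by linarith) hd (-1) t x)).const_mul _).congr_deriv ?_
  simp only [tilt]
  ring

theorem hasDerivAt_tilt_dt (h : Decays (k + 1) F) (h' : Decays (k + 1) G) (hk : 1 < k)
    (hd : ∀ t x, HasDerivAt (F t) (G t x) x) (t x : ℝ) :
    HasDerivAt (fun t => tilt F t x) (speed G t x) t := by
  refine (((h.hasDerivAt_lineIntegral_dt h' (by linarith) hd 1 t x).add
    ((h.hasDerivAt_lineIntegral_dt h' (by linarith) hd (-1) t x).const_mul _)).const_mul
      _).congr_deriv ?_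
  simp only [speed]
  ring

theorem hasDerivAt_potential_dx (h : Decays (k + 1) F) (h' : Decays (k + 1) G) (hk : 1 < k)
    (hd : ∀ t x, HasDerivAt (F t) (G t x) x) (t x : ℝ) :
    HasDerivAt (potential F t) (potential G t x) x :=
  ((decays_speed h (by linarith)).const_mul (-1)).hasDerivAt_lineIntegral_dx
    ((decays_speed h' (by linarith)).const_mul (-1)) hk
    (fun t x => (hasDerivAt_speed_dx h h' hk hd t x).const_mul (-1)) 0 t x

/-- Both sides have time derivative `speed G` and vanish as `t → ∞`. The space derivative of the
potential is thus `tilt F`, a single integral of `F`, which is why one `x`-derivative of `F` makes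
the potential `C²`. -/
theorem potential_eq_tilt (h : Decays (k + 1) F) (h' : Decays (k + 1) G) (hk : 1 < k)
    (hd : ∀ t x, HasDerivAt (F t) (G t x) x) (t x : ℝ) : potential G t x = tilt F t x :=
  ((decays_speed h' (by linarith)).const_mul (-1)).lineIntegral_zero_eq hk
    (decays_tilt h (by linarith)) (by linarith)
    (fun t x => (hasDerivAt_tilt_dt h h' hk hd t x).congr_deriv (by ring)) t x

theorem hasDerivAt_potential_dt (h : Decays (k + 1) F) (hk : 1 < k) (t x : ℝ) :
    HasDerivAt (fun t => potential F t x) (speed F t x) t := by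
  have := ((decays_speed h (by linarith)).const_mul (-1)).hasDerivAt_lineIntegral_characteristic
    hk 0 t x
  simpa [potential] using this

theorem contDiff_potential (h : Decays (k + 1) F) (h' : Decays (k + 1) G) (hk : 1 < k)
    (hd : ∀ t x, HasDerivAt (F t) (G t x) x) :
    ContDiff ℝ 2 fun z : ℝ × ℝ => potential F z.1 z.2 := by
  have c1 := h.contDiff_lineIntegral h' (by linarith) hd 1
  have c2 := h.contDiff_lineIntegral h' (by linarith) hd (-1)
  have := contDiff_succ_of_partials (n := 1) (f := potential F) (f₁ := speed F) (f₂ := tilt F)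
    (hasDerivAt_potential_dt h hk)
    (fun t x => potential_eq_tilt h h' hk hd t x ▸ hasDerivAt_potential_dx h h' hk hd t x)
    (by rw [Nat.cast_one]; exact contDiff_const.mul (c1.add c2))
    (by rw [Nat.cast_one]; exact contDiff_const.mul (c1.add (contDiff_const.mul c2)))
  norm_num at this
  exact this

end

/-! ### The fixed point in a weighted space of bounded functions -/

/-- Bounded continuous functions on the plane. -/
abbrev Plane : Type := (ℝ × ℝ) →ᵇ ℝ

/-- The function `(1 + |t|)^(-(k + 1)) f`. -/
def damp (k : ℝ) (f : Plane) (t x : ℝ) : ℝ := (1 + |t|) ^ (-(k + 1)) * f (t, x)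

theorem continuous_one_add_abs_rpow (α : ℝ) : Continuous fun z : ℝ × ℝ => (1 + |z.1|) ^ α :=
  (by fun_prop : Continuous fun z : ℝ × ℝ => 1 + |z.1|).rpow_const fun z =>
    Or.inl (by positivity)

theorem abs_damp_le (k : ℝ) (f : Plane) (t x : ℝ) :
    |damp k f t x| ≤ ‖f‖ * (1 + |t|) ^ (-(k + 1)) := by
  have h0 : 0 ≤ (1 + |t|) ^ (-(k + 1)) := Real.rpow_nonneg (by positivity) _
  rw [damp, abs_mul, abs_of_nonneg h0, mul_comm]
  exact mul_le_mul_of_nonneg_right (f.norm_coe_le_norm (t, x)) h0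

theorem abs_damp_le_of_nonneg (k : ℝ) (f : Plane) (t : ℝ) (ht : 0 ≤ t) (x : ℝ) :
    |damp k f t x| ≤ ‖f‖ * (1 + t) ^ (-(k + 1)) := by
  have := abs_damp_le k f t x
  rwa [abs_of_nonneg ht] at this

theorem decays_damp (k : ℝ) (f : Plane) : Decays (k + 1) (damp k f) :=
  ⟨(continuous_one_add_abs_rpow _).mul f.continuous,
    fun _ => ⟨‖f‖, fun t _ x => abs_damp_le k f t x⟩⟩

theorem damp_sub (k : ℝ) (f g : Plane) :
    damp k (f - g) = fun t x => damp k f t x - damp k g t x := by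
  funext t x
  simp only [damp, BoundedContinuousFunction.sub_apply]
  ring

/-- Pairs of coefficients of size `δ`, with the decay of a damping term and its time derivative. -/
structure IsSmall (k δ : ℝ) (b c : ℝ → ℝ → ℝ) : Prop where
  continuous : Continuous fun z : ℝ × ℝ => b |z.1| z.2
  continuous_snd : Continuous fun z : ℝ × ℝ => c |z.1| z.2
  bound : ∀ t, 0 ≤ t → ∀ x, |b t x| ≤ δ * (1 + t) ^ (-k)
  bound_snd : ∀ t, 0 ≤ t → ∀ x, |c t x| ≤ δ * (1 + t) ^ (-(k + 1))

/-- The forcing `b h_t + c h` produced by the solution `h` of `h_tt - h_xx = F`, in the weight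
`(1 + |t|)^(k + 1)` and reflected evenly in time. -/
def response (k : ℝ) (b c F : ℝ → ℝ → ℝ) (t x : ℝ) : ℝ :=
  (1 + |t|) ^ (k + 1) * (b |t| x * speed F |t| x + c |t| x * potential F |t| x)

section

variable {k δ : ℝ} {b c : ℝ → ℝ → ℝ}

theorem continuous_comp_abs {F : ℝ → ℝ → ℝ} (h : Continuous fun z : ℝ × ℝ => F z.1 z.2) :
    Continuous fun z : ℝ × ℝ => F |z.1| z.2 :=
  h.comp (f := fun z : ℝ × ℝ => (|z.1|, z.2)) (by fun_prop)

/-- Both products decay like `(1+t)^(-2k)`, which beats the weight `(1+t)^(k+1)` because `k > 1`.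
The constants `1/k` and `1/(k (k-1))` of the one-fold and two-fold integrations add up to `1/(k-1)`.
-/
theorem IsSmall.abs_response_le (h : IsSmall k δ b c) (hk : 1 < k) (f : Plane) (t x : ℝ) :
    |response k b c (damp k f) t x| ≤ δ / (k - 1) * ‖f‖ := by
  have ht := abs_nonneg t
  have hk1 : 0 < k - 1 := sub_pos.2 hk
  have h1 := h.bound |t| ht x
  have h2 := h.bound_snd |t| ht x
  have h3 := abs_speed_le (by linarith) (abs_damp_le_of_nonneg k f) ht x
  have h4 := abs_potential_le hk (abs_damp_le_of_nonneg k f) ht x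
  set s := 1 + |t| with hs
  have hs1 : 1 ≤ s := by linarith
  have hs0 : 0 < s := by linarith
  have hf := norm_nonneg f
  have hδ : 0 ≤ δ := nonneg_of_mul_nonneg_left ((abs_nonneg _).trans h1) (Real.rpow_pos_of_pos hs0 _)
  have hp : ∀ r : ℝ, 0 ≤ s ^ r := fun r => Real.rpow_nonneg hs0.le r
  have e1 : s ^ (k + 1) * (s ^ (-k) * s ^ (-k)) ≤ 1 := by
    rw [← Real.rpow_add hs0, ← Real.rpow_add hs0]
    exact Real.rpow_le_one_of_one_le_of_nonpos hs1 (by linarith)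
  have e2 : s ^ (k + 1) * (s ^ (-(k + 1)) * s ^ (-(k - 1))) ≤ 1 := by
    rw [← Real.rpow_add hs0, ← Real.rpow_add hs0]
    exact Real.rpow_le_one_of_one_le_of_nonpos hs1 (by linarith)
  rw [response, abs_mul, abs_of_nonneg (hp _)]
  have h5 : |b |t| x * speed (damp k f) |t| x| ≤ δ * s ^ (-k) * (‖f‖ / k * s ^ (-k)) := by
    rw [abs_mul]
    exact mul_le_mul h1 h3 (abs_nonneg _) ((abs_nonneg _).trans h1)
  have h6 : |c |t| x * potential (damp k f) |t| x| ≤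
      δ * s ^ (-(k + 1)) * (‖f‖ / k / (k - 1) * s ^ (-(k - 1))) := by
    rw [abs_mul]
    exact mul_le_mul h2 h4 (abs_nonneg _) ((abs_nonneg _).trans h2)
  have h7 := mul_le_mul_of_nonneg_left ((abs_add_le _ _).trans (add_le_add h5 h6)) (hp (k + 1))
  refine h7.trans ?_
  have e3 : s ^ (k + 1) * (δ * s ^ (-k) * (‖f‖ / k * s ^ (-k)) +
      δ * s ^ (-(k + 1)) * (‖f‖ / k / (k - 1) * s ^ (-(k - 1)))) =
      δ * ‖f‖ / k * (s ^ (k + 1) * (s ^ (-k) * s ^ (-k))) +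
        δ * ‖f‖ / k / (k - 1) * (s ^ (k + 1) * (s ^ (-(k + 1)) * s ^ (-(k - 1)))) := by ring
  rw [e3]
  have e4 : δ / (k - 1) * ‖f‖ = δ * ‖f‖ / k * 1 + δ * ‖f‖ / k / (k - 1) * 1 := by
    field_simp
    ring
  rw [e4]
  gcongr

theorem response_damp_sub (hk : 1 < k) (b c : ℝ → ℝ → ℝ) (f g : Plane) (t x : ℝ) :
    response k b c (damp k f) t x - response k b c (damp k g) t x =
      response k b c (damp k (f - g)) t x := by
  simp only [response, damp_sub,
    speed_sub (decays_damp k f) (decays_damp k g) (by linarith : 0 < k),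
    potential_sub (decays_damp k f) (decays_damp k g) hk]
  ring

theorem IsSmall.exists_response (h : IsSmall k δ b c) (hk : 1 < k) :
    ∃ T : Plane → Plane, (∀ f t x, T f (t, x) = response k b c (damp k f) t x) ∧
      (∀ f, ‖T f‖ ≤ δ / (k - 1) * ‖f‖) ∧ ∀ f g, T f - T g = T (f - g) := by
  have hδ : 0 ≤ δ := by
    have := (abs_nonneg _).trans (h.bound 0 le_rfl 0)
    simpa using this
  have hk1 : 0 < k - 1 := sub_pos.2 hk
  have hcont : ∀ f : Plane, Continuous fun z : ℝ × ℝ => response k b c (damp k f) z.1 z.2 := by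
    intro f
    have d1 := decays_speed (decays_damp k f) (by linarith : 0 < k)
    have d2 : Continuous fun z : ℝ × ℝ => potential (damp k f) z.1 z.2 :=
      (d1.const_mul (-1)).continuous_lineIntegral hk 0
    exact (continuous_one_add_abs_rpow _).mul
      ((h.continuous.mul (continuous_comp_abs d1.continuous)).add
        (h.continuous_snd.mul (continuous_comp_abs d2)))
  refine ⟨fun f => BoundedContinuousFunction.ofNormedAddCommGroup _ (hcont f) (δ / (k - 1) * ‖f‖)
    fun z => h.abs_response_le hk f z.1 z.2, fun f t x => rfl, fun f => ?_, fun f g => ?_⟩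
  · exact BoundedContinuousFunction.norm_ofNormedAddCommGroup_le _ (by positivity) _
  · ext z
    exact response_damp_sub hk b c f g z.1 z.2

theorem IsSmall.exists_source (h : IsSmall k δ b c) :
    ∃ e : Plane, (∀ t x, e (t, x) = (1 + |t|) ^ (k + 1) * c |t| x) ∧ ‖e‖ ≤ δ := by
  have hδ : 0 ≤ δ := by
    have := (abs_nonneg _).trans (h.bound 0 le_rfl 0)
    simpa using this
  have hb : ∀ z : ℝ × ℝ, ‖(1 + |z.1|) ^ (k + 1) * c |z.1| z.2‖ ≤ δ := by
    intro z
    have h0 : 0 < (1 + |z.1|) ^ (k + 1) := Real.rpow_pos_of_pos (by positivity) _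
    have h1 := h.bound_snd |z.1| (abs_nonneg _) z.2
    rw [Real.rpow_neg (by positivity), ← div_eq_mul_inv, le_div_iff₀ h0] at h1
    rwa [Real.norm_eq_abs, abs_mul, abs_of_pos h0, mul_comm]
  exact ⟨BoundedContinuousFunction.ofNormedAddCommGroup _
    ((continuous_one_add_abs_rpow _).mul h.continuous_snd) δ hb, fun t x => rfl,
    BoundedContinuousFunction.norm_ofNormedAddCommGroup_le _ hδ _⟩

theorem hasDerivAt_response {b' c' F G : ℝ → ℝ → ℝ} (hF : Decays (k + 1) F)
    (hG : Decays (k + 1) G) (hk : 1 < k) (hd : ∀ t x, HasDerivAt (F t) (G t x) x)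
    (hb : ∀ t, 0 ≤ t → ∀ x, HasDerivAt (b t) (b' t x) x)
    (hc : ∀ t, 0 ≤ t → ∀ x, HasDerivAt (c t) (c' t x) x) (t x : ℝ) :
    HasDerivAt (response k b c F t) (response k b' c' F t x + response k b c G t x) x := by
  have h := (((hb |t| (abs_nonneg t) x).mul (hasDerivAt_speed_dx hF hG hk hd |t| x)).add
    ((hc |t| (abs_nonneg t) x).mul (hasDerivAt_potential_dx hF hG hk hd |t| x))).const_mul
    ((1 + |t|) ^ (k + 1))
  refine h.congr_deriv ?_
  simp only [response]
  ring

/-- Differentiability of the fixed point in `x` is not visible in the space of bounded continuous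
functions. The candidate derivative is therefore iterated alongside, and uniform convergence of both
sequences identifies it as the derivative. -/
theorem exists_fixedPoint {b' c' : ℝ → ℝ → ℝ} (h : IsSmall k δ b c) (h' : IsSmall k δ b' c')
    (hk : 1 < k) (hδ : 4 * δ ≤ k - 1) (hb : ∀ t, 0 ≤ t → ∀ x, HasDerivAt (b t) (b' t x) x)
    (hc : ∀ t, 0 ≤ t → ∀ x, HasDerivAt (c t) (c' t x) x) :
    ∃ f g : Plane, (∀ t x, HasDerivAt (damp k f t) (damp k g t x) x) ∧ ‖f‖ ≤ 2 * δ ∧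
      ∀ t, 0 ≤ t → ∀ x, damp k f t x =
        b t x * speed (damp k f) t x + c t x * (1 + potential (damp k f) t x) := by
  obtain ⟨T, hT, hTb, hTs⟩ := h.exists_response hk
  obtain ⟨T', hT', hTb', hTs'⟩ := h'.exists_response hk
  obtain ⟨e, he, heb⟩ := h.exists_source
  obtain ⟨e', he', -⟩ := h'.exists_source
  have hk1 : 0 < k - 1 := sub_pos.2 hk
  have hq : δ / (k - 1) ≤ 1 / 4 := by rw [div_le_iff₀ hk1]; linarith
  have hn : ∀ f, ‖T f‖ ≤ 1 / 4 * ‖f‖ := fun f =>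
    (hTb f).trans (mul_le_mul_of_nonneg_right hq (norm_nonneg f))
  have hn' : ∀ f, ‖T' f‖ ≤ 1 / 4 * ‖f‖ := fun f =>
    (hTb' f).trans (mul_le_mul_of_nonneg_right hq (norm_nonneg f))
  -- The second component is the formal `x`-derivative of the first. Each response operator has norm
  -- at most `1/4`, and two of them occur in the second component, whence the contraction constant
  -- `1/2`.
  set Φ : Plane × Plane → Plane × Plane := fun z => (T z.1 + e, T' z.1 + T z.2 + e') with hΦ
  have hcon : ContractingWith (1 / 2) Φ := by
    refine ⟨by norm_num, LipschitzWith.of_dist_le_mul fun z w => ?_⟩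
    have m1 : ‖z.1 - w.1‖ ≤ ‖z - w‖ := norm_fst_le (z - w)
    have m2 : ‖z.2 - w.2‖ ≤ ‖z - w‖ := norm_snd_le (z - w)
    rw [dist_eq_norm, dist_eq_norm, Prod.norm_def]
    have h1 : (Φ z - Φ w).1 = T (z.1 - w.1) := by
      simp only [hΦ, Prod.fst_sub, ← hTs]
      abel
    have h2 : (Φ z - Φ w).2 = T' (z.1 - w.1) + T (z.2 - w.2) := by
      simp only [hΦ, Prod.snd_sub, ← hTs, ← hTs']
      abel
    rw [h1, h2]
    have i1 := hn (z.1 - w.1)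
    have i2 := (norm_add_le (T' (z.1 - w.1)) (T (z.2 - w.2))).trans
      (add_le_add (hn' _) (hn _))
    have i0 := norm_nonneg (z - w)
    push_cast
    exact max_le (by linarith) (by linarith)
  obtain ⟨z, hz, hlim, -⟩ := hcon.exists_fixedPoint (0 : Plane × Plane) (edist_ne_top _ _)
  have hz1 : T z.1 + e = z.1 := congrArg Prod.fst hz
  -- The iteration starts at the pair `(0, 0)`, where the relation holds trivially, and each step
  -- preserves it by the product rule.
  have hrel : ∀ n t x, HasDerivAt (fun x => (Φ^[n] 0).1 (t, x)) ((Φ^[n] 0).2 (t, x)) x := by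
    intro n
    induction n with
    | zero => exact fun t x => hasDerivAt_const x 0
    | succ n ih =>
      intro t x
      rw [Function.iterate_succ_apply']
      set w := Φ^[n] 0 with hw
      have hd : ∀ t x, HasDerivAt (damp k w.1 t) (damp k w.2 t x) x := fun t x =>
        (ih t x).const_mul _
      have d1 := hasDerivAt_response (decays_damp k w.1) (decays_damp k w.2) hk hd hb hc t x
      have d2 := (hc |t| (abs_nonneg t) x).const_mul ((1 + |t|) ^ (k + 1))
      have d3 := d1.add d2
      refine (d3.congr_deriv ?_).congr_of_eventuallyEq (Eventually.of_forall fun y => ?_)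
      · simp only [hΦ, BoundedContinuousFunction.add_apply, hT, hT', he']
      · simp only [hΦ, BoundedContinuousFunction.add_apply, hT, he, Pi.add_apply]
  refine ⟨z.1, z.2, fun t x => ?_, ?_, fun t ht x => ?_⟩
  · have l1 : Tendsto (fun n => (Φ^[n] 0).1) atTop (𝓝 z.1) :=
      (continuous_fst.tendsto z).comp hlim
    have l2 : Tendsto (fun n => (Φ^[n] 0).2) atTop (𝓝 z.2) :=
      (continuous_snd.tendsto z).comp hlim
    have u1 := BoundedContinuousFunction.tendsto_iff_tendstoUniformly.1 l1
    have u2 := BoundedContinuousFunction.tendsto_iff_tendstoUniformly.1 l2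
    exact (hasDerivAt_of_tendstoUniformly (u2.comp fun x => (t, x))
      (Eventually.of_forall fun n x => hrel n t x) (fun x => u1.tendsto_at (t, x)) x).const_mul _
  -- The fixed point equation gives `(3/4) ‖f‖ ≤ δ`, which is rounded to `‖f‖ ≤ 2 δ`.
  · have h1 : ‖z.1‖ ≤ 1 / 4 * ‖z.1‖ + δ := by
      calc ‖z.1‖ = ‖T z.1 + e‖ := by rw [hz1]
        _ ≤ _ := (norm_add_le _ _).trans (add_le_add (hn _) heb)
    linarith [norm_nonneg z.1]
  · have h1 : z.1 (t, x) = response k b c (damp k z.1) t x + (1 + |t|) ^ (k + 1) * c |t| x := by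
      rw [← hT, ← he, ← BoundedContinuousFunction.add_apply, hz1]
    rw [damp, h1, response, abs_of_nonneg ht, ← mul_add, ← mul_assoc,
      ← Real.rpow_add (by linarith), neg_add_cancel, Real.rpow_zero]
    ring

end

/-- Symmetry of the second derivative holds up to the boundary `t = 0`, since the half-plane is the
closure of its interior. It reconciles the bound on `∂_t ∂_x a` with the term `∂_x ∂_t a` that
arises when the fixed point map is differentiated in `x`. -/
theorem dt_dx_eq_dx_dt {f : ℝ → ℝ → ℝ} (h : IsC2 f) {t : ℝ} (ht : 0 ≤ t) (x : ℝ) :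
    dt (dx f) t x = dx (dt f) t x := by
  set S : Set (ℝ × ℝ) := timeInterval ⊤ ×ˢ univ with hS
  set q : ℝ × ℝ → ℝ := fun z => f z.1 z.2 with hq
  have hm : ∀ {s : ℝ}, 0 ≤ s → s ∈ timeInterval ⊤ := IsSmooth.mem_timeInterval_top.2
  have hs : IsSmooth ⊤ 2 f := IsSmooth.of_isC2 h
  have hu : UniqueDiffOn ℝ S := uniqueDiffOn_strip
  have hz : (t, x) ∈ S := ⟨hm ht, mem_univ _⟩
  have hdx : ∀ s, 0 ≤ s → ∀ y, dx f s y = fderivWithin ℝ q S (s, y) (0, 1) := fun s hs' y =>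
    dx_eq_of_hasFDerivWithinAt (hm hs') (hs.one.hasFDerivWithinAt (hm hs') y)
  have hdt : ∀ s, 0 ≤ s → ∀ y, dt f s y = fderivWithin ℝ q S (s, y) (1, 0) := fun s hs' y =>
    dt_eq_of_hasFDerivWithinAt (hm hs') (hs.one.hasFDerivWithinAt (hm hs') y)
  have hD : HasFDerivWithinAt (fderivWithin ℝ q S)
      (fderivWithin ℝ (fderivWithin ℝ q S) S (t, x)) S (t, x) :=
    ((ContDiffOn.fderivWithin hs hu (m := 1) (by norm_num)).differentiableOn one_ne_zero
      (t, x) hz).hasFDerivWithinAt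
  have happ : ∀ v : ℝ × ℝ, HasFDerivWithinAt (fun z => fderivWithin ℝ q S z v)
      ((ContinuousLinearMap.apply ℝ ℝ v).comp (fderivWithin ℝ (fderivWithin ℝ q S) S (t, x)))
      S (t, x) := fun v =>
    (ContinuousLinearMap.apply ℝ ℝ v).hasFDerivAt.comp_hasFDerivWithinAt (t, x) hD
  rw [dt_congr (g := fun s y => fderivWithin ℝ q S (s, y) (0, 1)) hdx ht,
    dx_congr (g := fun s y => fderivWithin ℝ q S (s, y) (1, 0)) (hdt t ht),
    dt_eq_of_hasFDerivWithinAt (hm ht) (happ (0, 1)),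
    dx_eq_of_hasFDerivWithinAt (hm ht) (happ (1, 0))]
  have hcl : (t, x) ∈ closure (interior S) := by
    rw [hS, timeInterval_top, interior_prod_eq, interior_Ici, interior_univ, closure_prod_eq,
      closure_Ioi, closure_univ]
    exact ⟨ht, mem_univ _⟩
  have hsymm := ContDiffWithinAt.isSymmSndFDerivWithinAt (hs (t, x) hz) (by simp) hu hcl hz
  exact hsymm (1, 0) (0, 1)

theorem continuous_comp_abs_of_isSmooth {n : WithTop ℕ∞} {f : ℝ → ℝ → ℝ} (h : IsSmooth ⊤ n f) :
    Continuous fun z : ℝ × ℝ => f |z.1| z.2 :=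
  h.continuousOn.comp_continuous (f := fun z : ℝ × ℝ => (|z.1|, z.2)) (by fun_prop) fun z =>
    ⟨IsSmooth.mem_timeInterval_top.2 (abs_nonneg _), mem_univ _⟩

/-- Integrating a forcing of weighted size at most `2 δ` gives derivatives at most `2 δ / k` and a
potential at most `2 δ / (k (k - 1))` times their decay rates; the last hypothesis makes the latter
constant at most `θ`. -/
theorem IsDamping.exists_isCorrector {k δ θ : ℝ} {a : ℝ → ℝ → ℝ} (ha : IsDamping k δ a)
    (hk : 1 < k) (hδ : 0 < δ) (hδk : 4 * δ ≤ k - 1) (hδθ : 2 * δ ≤ θ * (k * (k - 1))) :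
    ∃ h : ℝ → ℝ → ℝ, IsCorrector a θ k h := by
  have hk0 : 0 < k := by linarith
  have hk1 : 0 < k - 1 := sub_pos.2 hk
  have hs : IsSmooth ⊤ 2 a := IsSmooth.of_isC2 ha.contDiff
  have hm : ∀ {s : ℝ}, 0 ≤ s → s ∈ timeInterval ⊤ := IsSmooth.mem_timeInterval_top.2
  have hdiv : ∀ {y r t : ℝ}, 0 ≤ t → y ≤ δ / (1 + t) ^ r → y ≤ δ * (1 + t) ^ (-r) := by
    intro y r t ht hy
    rwa [Real.rpow_neg (by linarith), ← div_eq_mul_inv]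
  have s1 : IsSmall k δ a (dt a) := ⟨continuous_comp_abs_of_isSmooth hs,
    continuous_comp_abs_of_isSmooth hs.dt_one, fun t ht x => hdiv ht (ha.bound t ht x),
    fun t ht x => hdiv ht (ha.bound_dt t ht x)⟩
  have s2 : IsSmall k δ (dx a) (dt (dx a)) := ⟨continuous_comp_abs_of_isSmooth hs.dx_one,
    continuous_comp_abs_of_isSmooth hs.dx_one.dt_zero, fun t ht x => hdiv ht (ha.bound_dx t ht x),
    fun t ht x => hdiv ht (ha.bound_dt_dx t ht x)⟩
  obtain ⟨f, g, hd, hf, heq⟩ := exists_fixedPoint s1 s2 hk hδk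
    (fun t ht x => hs.one.hasDerivAt_dx (hm ht) x) (fun t ht x => by
      rw [dt_dx_eq_dx_dt ha.contDiff ht]
      exact hs.dt_one.hasDerivAt_dx (hm ht) x)
  set F := damp k f with hF
  set G := damp k g with hG
  have dF : Decays (k + 1) F := decays_damp k f
  have dG : Decays (k + 1) G := decays_damp k g
  have hFb : ∀ t, 0 ≤ t → ∀ x, |F t x| ≤ 2 * δ * (1 + t) ^ (-(k + 1)) := fun t ht x =>
    (abs_damp_le_of_nonneg k f t ht x).trans
      (mul_le_mul_of_nonneg_right hf (Real.rpow_nonneg (by linarith) _))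
  have ht1 : ∀ t, 0 ≤ t → ∀ x, dt (potential F) t x = speed F t x := fun t ht x =>
    dt_eq_of_hasDerivAt ht (hasDerivAt_potential_dt dF hk t x)
  have hx1 : dx (potential F) = tilt F := by
    funext t x
    rw [← potential_eq_tilt dF dG hk hd]
    exact (hasDerivAt_potential_dx dF dG hk hd t x).deriv
  have hneg : ∀ {y c r t : ℝ}, 0 ≤ t → y ≤ c * (1 + t) ^ (-r) → y ≤ c / (1 + t) ^ r := by
    intro y c r t ht hy
    rwa [Real.rpow_neg (by linarith), ← div_eq_mul_inv] at hy
  refine ⟨potential F, (contDiff_potential dF dG hk hd).contDiffOn, fun t ht x => ?_,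
    fun t ht x => hneg ht ?_, 2 * δ / k, by positivity, fun t ht x => ⟨hneg ht ?_, hneg ht ?_⟩⟩
  · rw [dt_congr ht1 ht, dt_eq_of_hasDerivAt ht (hasDerivAt_speed_dt dF dG hk hd t x), hx1, dx,
      (hasDerivAt_tilt_dx dF dG hk hd t x).deriv, ht1 t ht, heq t ht x]
    ring
  · refine (abs_potential_le hk hFb ht x).trans
      (mul_le_mul_of_nonneg_right ?_ (Real.rpow_nonneg (by linarith) _))
    rw [div_div, div_le_iff₀ (by positivity)]
    exact hδθ
  · rw [ht1 t ht]
    exact abs_speed_le hk0 hFb ht x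
  · rw [hx1]
    exact abs_tilt_le hk0 hFb ht x

end DampedWave

end

/-! ### The main theorem -/

open DampedWave in
theorem theorem1p1 (θ : ℝ) (hθ : θ ∈ Set.Ioo (0 : ℝ) 1) (k : ℝ) (hk : 1 < k) :
    ∃ δ₀ > 0, ∀ δ ∈ Set.Ioo (0 : ℝ) δ₀, ∀ a : ℝ → ℝ → ℝ, IsDamping k δ a →
      (∃ h : ℝ → ℝ → ℝ, IsCorrector a θ k h) ∧
      ∀ h : ℝ → ℝ → ℝ, IsCorrector a θ k h →
      ∀ p : ℝ, 1 < p → ∀ (u₀ : H1) (u₁ : L2),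
        PositiveData a (fun t x => 1 + h t x) u₀ u₁ →
        ∃ T : ℝ, 0 < T ∧ ∃ u : ℝ → H1,
          IsSolution a p u₀ u₁ (T : EReal) u ∧
          Tendsto (energyNorm u) (𝓝[<] T) atTop ∧
          ∀ (S : EReal), 0 < S → ∀ v : ℝ → H1, IsSolution a p u₀ u₁ S v →
            S ≤ (T : EReal) ∧ ∀ t ∈ timeInterval S, v t = u t := by
  have hk1 : 0 < k - 1 := sub_pos.2 hk
  have hθ0 : 0 < θ := hθ.1
  have hk0 : 0 < k := by linarith
  -- The first bound makes the fixed point map contract, the second keeps the corrector below `θ /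
  -- (1 + t) ^ (k - 1)`. Blow-up needs no further smallness.
  refine ⟨min ((k - 1) / 4) (θ * (k * (k - 1)) / 2), by positivity,
    fun δ hδ a ha => ⟨?_, fun h hh p hp u₀ u₁ hd => hh.blowup hθ hk hδ.1.le ha hp hd⟩⟩
  obtain ⟨h1, h2⟩ := lt_min_iff.1 hδ.2
  exact ha.exists_isCorrector hk hδ.1 (by linarith) (by linarith)
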